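/- Let $p>2$ be a prime and let $G$ be an elementary abelian $p$-group, written multiplicatively, with basis $s_1,\dots,s_r$ over $\mathbb F_p$. Let $V=\mathrm{Hom}(G,\mathbb F_p)=H^1(G,\mathbb F_p)$, let $x_1,\dots,x_r$ be the basis of $V$ dual to $s_1,\dots,s_r$, and let $y_i=\beta(x_i)\in H^2(G,\mathbb F_p)$, where $\beta:H^1(G,\mathbb F_p)\to H^2(G,\mathbb F_p)$ is the Bockstein map, i.e. the connecting map of $0\to\mathbb F_p\xrightarrow{\,p\,}\mathbb Z/p^2\mathbb Z\to\mathbb F_p\to 0$. Let $Z^n(G,\mathbb F_p)$ be the group of normalized $n$-cocycles (cocycles $a:G^n\to\mathbb F_p$ for the trivial action with $a(u_1,\dots,u_n)=0$ whenever some $u_i=1$), and let $H^n(G,\mathbb F_p)$ be its quotient by the coboundaries of normalized $(n-1)$-cochains. The cup product on $H^*(G,\mathbb F_p)=\bigoplus_n H^n(G,\mathbb F_p)$ is induced by $$(a\cup b)(u_1,\dots,u_{m+n})=(-1)^{mn}a(u_1,\dots,u_m)\,b(u_{m+1},\dots,u_{m+n}).$$ Then there is an isomorphism of $\mathbb F_p$-algebras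 $$\tau:\Lambda(x_1,\dots,x_r)\otimes\mathbb F_p[y_1,\dots,y_r]\to H^*(G,\mathbb F_p)$$ (necessarily unique) such that $\tau(x\otimes 1)=x\in H^1(G,\mathbb F_p)$ for $x\in V$ and $\tau(1\otimes y_i)=\beta(x_i)$ for $1\le i\le r$, i.e. $\tau(x_{i_1}\wedge\cdots\wedge x_{i_l}\otimes y_{j_1}\cdots y_{j_k})=x_{i_1}\cup\cdots\cup x_{i_l}\cup y_{j_1}\cup\cdots\cup y_{j_k}$, and for every $n\ge 0$ and every $a\in Z^n(G,\mathbb F_p)$ its inverse satisfies $$\tau^{-1}([a])=\sum_{n_1+\cdots+n_r=n}c_{n_1,\dots,n_r}\,x_1^{(n_1)}\cdots x_r^{(n_r)},$$ $$c_{n_1,\dots,n_r}=(-1)^{\frac{l(l-1)}2}\sum_{\sigma\in Sh(n_1,\dots,n_r)}\ \sum_{1\le q_{i,j}\le p-1}\sigma a\bigl(s_{1,n_1,q_{1,1},\dots,q_{1,k_1}},\dots,s_{r,n_r,q_{r,1},\dots,q_{r,k_r}}\bigr).$$ Here the $n_i$ are nonnegative integers, $l$ is the number of indices $i$ with $n_i$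 odd, and $k_i=\lfloor n_i/2\rfloor$; each $q_{i,j}$ with $1\le i\le r$, $1\le j\le k_i$ runs independently over $1,\dots,p-1$; $x_i^{(2k)}=1\otimes y_i^k$ and $x_i^{(2k+1)}=x_i\otimes y_i^k$; $Sh(n_1,\dots,n_r)$ is the set of $\sigma\in S_n$ with $\sigma(n_1+\cdots+n_{i-1}+1)<\cdots<\sigma(n_1+\cdots+n_i)$ for all $1\le i\le r$; $S_n$ acts on cochains by $\sigma a(u_1,\dots,u_n)=\mathrm{sgn}(\sigma)\,a(u_{\sigma^{-1}(1)},\dots,u_{\sigma^{-1}(n)})$; $$s_{i,m,q_1,\dots,q_k}=\begin{cases}(s_i^{q_1},s_i,\dots,s_i^{q_k},s_i)& m=2k\\(s_i,s_i^{q_1},s_i,\dots,s_i^{q_k},s_i)& m=2k+1\end{cases}\in G^m,$$ and the argument of $\sigma a$ is the concatenation of these tuples, of lengths $n_1,\dots,n_r$. -/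

import Mathlib

open scoped DirectSum TensorProduct

namespace ElemAb

universe u v

section Cochains

variable (R : Type v) [CommRing R] (G : Type u) [Group G]

/-- The coboundary map `d_n : R^(G^n) → R^(G^(n+1))` for trivial coefficients `R`:
`(d a)(u_1,…,u_{n+1}) = a(u_2,…,u_{n+1}) + ∑_{j=1}^n (-1)^j a(u_1,…,u_j u_{j+1},…,u_{n+1})
+ (-1)^{n+1} a(u_1,…,u_n)`; the last summand is the term of index `n` of the sum below. -/
def d (n : ℕ) : ((Fin n → G) → R) →ₗ[R] ((Fin (n + 1) → G) → R) where
  toFun a u := a (fun i => u i.succ) +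
    ∑ j : Fin (n + 1), (-1 : R) ^ ((j : ℕ) + 1) * a (Fin.contractNth j (· * ·) u)
  map_add' a b := by
    funext u
    simp only [Pi.add_apply, mul_add, Finset.sum_add_distrib]
    ring
  map_smul' c a := by
    funext u
    simp only [Pi.smul_apply, smul_eq_mul, RingHom.id_apply, mul_add, Finset.mul_sum]
    congr 1
    exact Finset.sum_congr rfl fun j _ => by ring

/-- The normalized cochains `C^n(G, R)`. -/
def C (n : ℕ) : Submodule R ((Fin n → G) → R) where
  carrier := {a | ∀ u : Fin n → G, (∃ i, u i = 1) → a u = 0}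
  add_mem' ha hb u hu := by simp [ha u hu, hb u hu]
  zero_mem' _ _ := rfl
  smul_mem' c a ha u hu := by simp [ha u hu]

/-- The normalized cocycles `Z^n(G, R)`. -/
def Z (n : ℕ) : Submodule R ((Fin n → G) → R) :=
  C R G n ⊓ LinearMap.ker (d R G n)

/-- The coboundaries `B^n(G, R) = d (C^(n-1)(G, R))`, with `B^0(G, R) = 0`. -/
def B : (n : ℕ) → Submodule R ((Fin n → G) → R)
  | 0 => ⊥
  | n + 1 => (C R G n).map (d R G n)

/-- The cohomology `H^n(G, R) = Z^n(G, R) / B^n(G, R)`, with trivial coefficients `R`. -/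
def H (n : ℕ) : Type (max u v) := Z R G n ⧸ (B R G n).submoduleOf (Z R G n)

instance (n : ℕ) : AddCommGroup (H R G n) :=
  inferInstanceAs (AddCommGroup (Z R G n ⧸ (B R G n).submoduleOf (Z R G n)))

instance (n : ℕ) : Module R (H R G n) :=
  inferInstanceAs (Module R (Z R G n ⧸ (B R G n).submoduleOf (Z R G n)))

variable {R G}

/-- The class `[a] ∈ H^n(G, R)` of a normalized cocycle `a`. -/
def cls {n : ℕ} : Z R G n →ₗ[R] H R G n := Submodule.mkQ ((B R G n).submoduleOf (Z R G n))

theorem cls_surj {n : ℕ} (x : H R G n) : ∃ a : Z R G n, cls a = x :=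
  Submodule.Quotient.mk_surjective _ x

theorem cls_eq_zero {n : ℕ} {a : Z R G n} : cls a = 0 ↔ a.1 ∈ B R G n :=
  Submodule.Quotient.mk_eq_zero _

theorem cls_eq {n : ℕ} {a b : Z R G n} : cls a = cls b ↔ a.1 - b.1 ∈ B R G n :=
  Submodule.Quotient.eq _

/-- A linear map on cocycles that vanishes on coboundaries induces a linear map on cohomology. -/
def liftH {n : ℕ} {N : Type*} [AddCommGroup N] [Module R N] (f : Z R G n →ₗ[R] N)
    (hf : ∀ a : Z R G n, a.1 ∈ B R G n → f a = 0) : H R G n →ₗ[R] N :=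
  Submodule.liftQ _ f hf

theorem liftH_cls {n : ℕ} {N : Type*} [AddCommGroup N] [Module R N] (f : Z R G n →ₗ[R] N)
    (hf : ∀ a : Z R G n, a.1 ∈ B R G n → f a = 0) (a : Z R G n) : liftH f hf (cls a) = f a := rfl

/-- The first `n` entries of a sequence. -/
def res (n : ℕ) (g : ℕ → G) : Fin n → G := fun i => g i

/-- Multiply the entries of index `j` and `j + 1` of a sequence. -/
def ctr (j : ℕ) (g : ℕ → G) : ℕ → G := fun k =>
  if k < j then g k else if k = j then g k * g (k + 1) else g (k + 1)

theorem exists_res (n : ℕ) (u : Fin n → G) : ∃ g : ℕ → G, res n g = u :=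
  ⟨fun k => if h : k < n then u ⟨k, h⟩ else 1, by funext i; simp [res]⟩

theorem d_res (n : ℕ) (a : (Fin n → G) → R) (g : ℕ → G) :
    d R G n a (res (n + 1) g) = a (res n (fun k => g (k + 1))) +
      ∑ j ∈ Finset.range (n + 1), (-1 : R) ^ (j + 1) * a (res n (ctr j g)) := by
  rw [Finset.sum_range]
  rfl

theorem res_ctr_ge (m j : ℕ) (h : m ≤ j) (g : ℕ → G) : res m (ctr j g) = res m g := by
  funext i
  have : (i : ℕ) < j := lt_of_lt_of_le i.2 h
  simp [res, ctr, this]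

theorem res_ctr_lt (m n j : ℕ) (h : j < m) (g : ℕ → G) :
    res n (fun k => ctr j g (m + k)) = res n (fun k => g (m + 1 + k)) := by
  funext i
  have h1 : ¬ (m + (i : ℕ) < j) := by omega
  have h2 : ¬ (m + (i : ℕ) = j) := by omega
  simp only [res, ctr, if_neg h1, if_neg h2]
  congr 1
  omega

theorem res_ctr_add (m n j : ℕ) (g : ℕ → G) :
    res n (fun k => ctr (m + j) g (m + k)) = res n (ctr j (fun k => g (m + k))) := by
  funext i
  simp only [res, ctr, Nat.add_lt_add_iff_left, Nat.add_left_cancel_iff]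
  rfl

/-- The product of cochains without sign. -/
def prodC {m n : ℕ} (a : (Fin m → G) → R) (b : (Fin n → G) → R) : (Fin (m + n) → G) → R :=
  fun u => a (fun i => u (Fin.castAdd n i)) * b (fun i => u (Fin.natAdd m i))

theorem prodC_res {m n : ℕ} (a : (Fin m → G) → R) (b : (Fin n → G) → R) (g : ℕ → G) :
    prodC a b (res (m + n) g) = a (res m g) * b (res n (fun k => g (m + k))) := rfl

theorem leibniz {m n : ℕ} (a : (Fin m → G) → R) (b : (Fin n → G) → R) (g : ℕ → G) :
    d R G (m + n) (prodC a b) (res (m + n + 1) g) =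
      d R G m a (res (m + 1) g) * b (res n (fun k => g (m + 1 + k))) +
      (-1) ^ m * (a (res m g) * d R G n b (res (n + 1) (fun k => g (m + k)))) := by
  simp only [d_res, prodC_res]
  have e1 : (fun k => g (m + k + 1)) = fun k => g (m + 1 + k) := by
    funext k; congr 1; omega
  have e2 : (fun k => g (m + (k + 1))) = fun k => g (m + 1 + k) := by
    funext k; congr 1; omega
  rw [show m + n + 1 = m + (n + 1) by omega, Finset.sum_range_add, Finset.sum_range_succ _ m]
  have s1 : ∑ j ∈ Finset.range m, (-1 : R) ^ (j + 1) * (a (res m (ctr j g)) *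
      b (res n (fun k => ctr j g (m + k)))) = (∑ j ∈ Finset.range m,
      (-1 : R) ^ (j + 1) * a (res m (ctr j g))) * b (res n (fun k => g (m + 1 + k))) := by
    rw [Finset.sum_mul]
    refine Finset.sum_congr rfl fun j hj => ?_
    rw [res_ctr_lt m n j (Finset.mem_range.mp hj)]
    ring
  have s2 : ∑ j ∈ Finset.range (n + 1), (-1 : R) ^ (m + j + 1) * (a (res m (ctr (m + j) g)) *
      b (res n (fun k => ctr (m + j) g (m + k)))) = (-1) ^ m * (a (res m g) *
      ∑ j ∈ Finset.range (n + 1),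
        (-1 : R) ^ (j + 1) * b (res n (ctr j (fun k => g (m + k))))) := by
    rw [Finset.mul_sum, Finset.mul_sum]
    refine Finset.sum_congr rfl fun j _ => ?_
    rw [res_ctr_ge m (m + j) (by omega), res_ctr_add]
    ring
  rw [s1, s2, res_ctr_ge m m le_rfl]
  simp only [e2]
  have e3 : (fun k => g (m + k + 1)) = fun k => g (m + 1 + k) := e1
  rw [show (fun k => (fun k => g (k + 1)) (m + k)) = fun k => g (m + 1 + k) from e1]
  ring

theorem prodC_mem {m n : ℕ} {a : (Fin m → G) → R} {b : (Fin n → G) → R}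
    (ha : a ∈ C R G m) (hb : b ∈ C R G n) : prodC a b ∈ C R G (m + n) := by
  rintro u ⟨i, hi⟩
  induction i using Fin.addCases with
  | left i => simp [prodC, ha (fun i => u (Fin.castAdd n i)) ⟨i, hi⟩]
  | right i => simp [prodC, hb (fun i => u (Fin.natAdd m i)) ⟨i, hi⟩]

theorem mem_B {m N : ℕ} (h : N = m + 1) {f : (Fin N → G) → R} {c : (Fin m → G) → R}
    (hc : c ∈ C R G m) (hf : ∀ g : ℕ → G, f (res N g) = d R G m c (res (m + 1) g)) :
    f ∈ B R G N := by
  subst h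
  refine ⟨c, hc, ?_⟩
  funext u
  obtain ⟨g, rfl⟩ := exists_res _ u
  exact (hf g).symm

theorem Z.d_eq {n : ℕ} (a : Z R G n) : d R G n a.1 = 0 := a.2.2

/-- The cup product of cocycles,
`(a ∪ b)(u_1,…,u_{m+n}) = (-1)^{mn} a(u_1,…,u_m) b(u_{m+1},…,u_{m+n})`. -/
def cupZ (m n : ℕ) : Z R G m →ₗ[R] Z R G n →ₗ[R] Z R G (m + n) :=
  LinearMap.mk₂ R
    (fun a b => ⟨((-1 : R) ^ (m * n)) • prodC a.1 b.1, by
      refine Submodule.smul_mem _ _ ⟨prodC_mem a.2.1 b.2.1, ?_⟩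
      refine LinearMap.mem_ker.mpr (funext fun u => ?_)
      obtain ⟨g, rfl⟩ := exists_res _ u
      rw [leibniz, Z.d_eq, Z.d_eq]
      simp⟩)
    (fun a a' b => by
      ext u; simp [prodC]; ring)
    (fun c a b => by
      ext u; simp [prodC]; ring)
    (fun a b b' => by
      ext u; simp [prodC]; ring)
    (fun c a b => by
      ext u; simp [prodC]; ring)

theorem cupZ_apply {m n : ℕ} (a : Z R G m) (b : Z R G n) (u : Fin (m + n) → G) :
    (cupZ m n a b).1 u = (-1 : R) ^ (m * n) *
      (a.1 (fun i => u (Fin.castAdd n i)) * b.1 (fun i => u (Fin.natAdd m i))) := rfl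

theorem cupZ_res {m n : ℕ} (a : Z R G m) (b : Z R G n) (g : ℕ → G) :
    (cupZ m n a b).1 (res (m + n) g) = (-1 : R) ^ (m * n) *
      (a.1 (res m g) * b.1 (res n (fun k => g (m + k)))) := rfl

theorem cup_B_left {m n : ℕ} (a : Z R G m) (b : Z R G n) (ha : a.1 ∈ B R G m) :
    (cupZ m n a b).1 ∈ B R G (m + n) := by
  cases m with
  | zero =>
    have : a = 0 := Subtype.ext ha
    rw [this]
    simp
  | succ m =>
    obtain ⟨c, hc, hca⟩ := ha
    refine mem_B (m := m + n) (by omega)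
      (Submodule.smul_mem _ ((-1 : R) ^ ((m + 1) * n)) (prodC_mem hc b.2.1)) fun g => ?_
    rw [cupZ_res, map_smul, Pi.smul_apply, leibniz, Z.d_eq, hca]
    simp

theorem cup_B_right {m n : ℕ} (a : Z R G m) (b : Z R G n) (hb : b.1 ∈ B R G n) :
    (cupZ m n a b).1 ∈ B R G (m + n) := by
  cases n with
  | zero =>
    have : b = 0 := Subtype.ext hb
    rw [this]
    simp
  | succ n =>
    obtain ⟨c, hc, hcb⟩ := hb
    refine mem_B (m := m + n) (by omega)
      (Submodule.smul_mem _ ((-1 : R) ^ (m * (n + 1)) * (-1) ^ m) (prodC_mem a.2.1 hc))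
      fun g => ?_
    rw [cupZ_res, map_smul, Pi.smul_apply, leibniz, Z.d_eq]
    have : ((-1 : R) ^ m) * (-1) ^ m = 1 := by rw [← mul_pow]; simp
    simp only [Pi.zero_apply, zero_mul, zero_add, smul_eq_mul]
    rw [← congrFun hcb (res (n + 1) fun k => g (m + k))]
    linear_combination (-((-1 : R) ^ (m * (n + 1)) *
      (a.1 (res m g) * d R G n c (res (n + 1) fun k => g (m + k))))) * this

/-- The cup product `H^m(G, R) × H^n(G, R) → H^{m+n}(G, R)`, `[a] ∪ [b] = [a ∪ b]`. -/
def cup (m n : ℕ) : H R G m →ₗ[R] H R G n →ₗ[R] H R G (m + n) :=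
  liftH
    { toFun := fun a => liftH (cls.comp (cupZ m n a))
        (fun b hb => cls_eq_zero.mpr (cup_B_right a b hb))
      map_add' := fun a a' => by
        ext x
        obtain ⟨b, rfl⟩ := cls_surj x
        simp [liftH_cls]
      map_smul' := fun c a => by
        ext x
        obtain ⟨b, rfl⟩ := cls_surj x
        simp [liftH_cls] }
    (fun a ha => by
      ext x
      obtain ⟨b, rfl⟩ := cls_surj x
      exact cls_eq_zero.mpr (cup_B_left a b ha))

theorem cup_cls {m n : ℕ} (a : Z R G m) (b : Z R G n) :
    cup (R := R) (G := G) m n (cls a) (cls b) = cls (cupZ m n a b) := rfl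

/-- The constant cochain of degree zero. -/
def constZ : R →ₗ[R] Z R G 0 where
  toFun c := ⟨fun _ => c, fun _ ⟨i, _⟩ => i.elim0, by
    refine LinearMap.mem_ker.mpr (funext fun u => ?_)
    simp [d]⟩
  map_add' _ _ := rfl
  map_smul' _ _ := rfl

theorem mk_eq {m n : ℕ} (h : m = n) (a : Z R G m) (b : Z R G n)
    (hab : ∀ g : ℕ → G, a.1 (res m g) = b.1 (res n g)) :
    GradedMonoid.mk (A := H R G) m (cls a) = GradedMonoid.mk n (cls b) := by
  subst h
  congr 2
  ext u
  obtain ⟨g, rfl⟩ := exists_res _ u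
  exact hab g

instance : GradedMonoid.GOne (H R G) where
  one := cls (constZ 1)

instance : GradedMonoid.GMul (H R G) where
  mul x y := cup (R := R) (G := G) _ _ x y

instance : GradedMonoid.GMonoid (H R G) where
  one_mul := by
    rintro ⟨n, x⟩
    obtain ⟨a, rfl⟩ := cls_surj x
    exact mk_eq (Nat.zero_add n) (cupZ 0 n (constZ 1) a) a fun g => by
      rw [cupZ_res]; simp [constZ]
  mul_one := by
    rintro ⟨n, x⟩
    obtain ⟨a, rfl⟩ := cls_surj x
    exact mk_eq (Nat.add_zero n) (cupZ n 0 a (constZ 1)) a fun g => by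
      rw [cupZ_res]; simp [constZ]
  mul_assoc := by
    rintro ⟨l, x⟩ ⟨m, y⟩ ⟨n, z⟩
    obtain ⟨a, rfl⟩ := cls_surj x
    obtain ⟨b, rfl⟩ := cls_surj y
    obtain ⟨c, rfl⟩ := cls_surj z
    exact mk_eq (Nat.add_assoc l m n) (cupZ (l + m) n (cupZ l m a b) c)
      (cupZ l (m + n) a (cupZ m n b c)) fun g => by
        simp only [cupZ_res, Nat.add_assoc]
        ring

/-- The cup products make `H^*(G, R) = ⨁ n, H^n(G, R)` a graded ring. -/
instance : DirectSum.GRing (H R G) where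
  mul_zero x := map_zero (cup (R := R) (G := G) _ _ x)
  zero_mul y := LinearMap.map_zero₂ (cup (R := R) (G := G) _ _) y
  mul_add x y z := map_add (cup (R := R) (G := G) _ _ x) y z
  add_mul x y z := LinearMap.map_add₂ (cup (R := R) (G := G) _ _) x y z
  natCast k := cls (constZ (k : R))
  natCast_zero := by
    rw [Nat.cast_zero, map_zero]; rfl
  natCast_succ k := by
    rw [Nat.cast_succ, map_add]; rfl
  intCast k := cls (constZ (k : R))
  intCast_ofNat k := by rw [Int.cast_natCast]
  intCast_negSucc_ofNat k := by
    rw [Int.cast_negSucc, map_neg]; rfl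

/-- `H^*(G, R)` is a graded `R`-algebra. -/
instance : DirectSum.GAlgebra R (H R G) where
  toFun :=
    { toFun := fun c => cls (constZ c)
      map_zero' := by rw [map_zero]; rfl
      map_add' := fun c c' => by rw [map_add]; rfl }
  map_one := rfl
  map_mul c c' := mk_eq rfl (constZ (c * c')) (cupZ 0 0 (constZ c) (constZ c')) fun g => by
    rw [cupZ_res]; simp [constZ]
  commutes := by
    rintro c ⟨n, x⟩
    obtain ⟨a, rfl⟩ := cls_surj x
    exact mk_eq (by omega) (cupZ 0 n (constZ c) a) (cupZ n 0 a (constZ c)) fun g => by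
      rw [cupZ_res, cupZ_res]; simp [constZ, mul_comm]
  smul_def := by
    rintro c ⟨n, x⟩
    obtain ⟨a, rfl⟩ := cls_surj x
    exact mk_eq (by omega) (c • a) (cupZ 0 n (constZ c) a) fun g => by
      rw [cupZ_res]; simp [constZ]

variable (R G) in
/-- The cohomology algebra `H^*(G, R)`, with the cup product. -/
abbrev HStar : Type (max u v) := ⨁ n, H R G n

end Cochains

section Bockstein

variable (p : ℕ) [Fact p.Prime] {G : Type u} [Group G]

/-- The injection `ℤ/p → ℤ/p²` induced by multiplication by `p` on `ℤ`. -/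
def mulP : ZMod p →+ ZMod (p ^ 2) :=
  ZMod.lift p ⟨(AddMonoidHom.mulLeft (p : ZMod (p ^ 2))).comp (Int.castAddHom _), by
    have : ((p ^ 2 : ℕ) : ZMod (p ^ 2)) = 0 := ZMod.natCast_self _
    simpa [sq] using this⟩

/-- The reduction `ℤ/p² → ℤ/p`. -/
def redP : ZMod (p ^ 2) →+* ZMod p := ZMod.castHom (Dvd.intro_left p (sq p).symm) (ZMod p)

theorem mulP_intCast (k : ℤ) : mulP p (k : ZMod p) = (p : ZMod (p ^ 2)) * (k : ZMod (p ^ 2)) := by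
  simp [mulP]

theorem mulP_injective : Function.Injective (mulP p) := by
  rw [injective_iff_map_eq_zero]
  intro x hx
  obtain ⟨k, rfl⟩ := ZMod.intCast_surjective x
  rw [mulP_intCast] at hx
  have h : (((p : ℤ) * k : ℤ) : ZMod (p ^ 2)) = 0 := by push_cast; exact hx
  rw [ZMod.intCast_zmod_eq_zero_iff_dvd] at h ⊢
  have hp : (p : ℤ) ≠ 0 := by exact_mod_cast (Fact.out : p.Prime).ne_zero
  rw [Nat.cast_pow, sq] at h
  exact Int.dvd_of_mul_dvd_mul_left hp h

theorem redP_eq_zero {y : ZMod (p ^ 2)} (h : redP p y = 0) : ∃ x, mulP p x = y := by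
  obtain ⟨k, rfl⟩ := ZMod.intCast_surjective y
  rw [map_intCast, ZMod.intCast_zmod_eq_zero_iff_dvd] at h
  obtain ⟨l, rfl⟩ := h
  exact ⟨l, by rw [mulP_intCast]; push_cast; rfl⟩

/-- `y ∈ H^2(G, ℤ/p)` is the image of `x ∈ H^1(G, ℤ/p)` under the connecting map of the exact
sequence `0 → ℤ/p → ℤ/p² → ℤ/p → 0`: there are cocycles `a`, `b` with classes `x`, `y` and a
normalized lift `c` of `a` to `ℤ/p²` with `d c = p b`. -/
def IsConnecting (x : H (ZMod p) G 1) (y : H (ZMod p) G 2) : Prop :=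
  ∃ (a : Z (ZMod p) G 1) (b : Z (ZMod p) G 2) (c : C (ZMod (p ^ 2)) G 1),
    cls a = x ∧ cls b = y ∧ (∀ u, redP p (c.1 u) = a.1 u) ∧
      ∀ u, d (ZMod (p ^ 2)) G 1 c.1 u = mulP p (b.1 u)

theorem d_map {R S : Type*} [CommRing R] [CommRing S] (f : R →+ S) (n : ℕ)
    (a : (Fin n → G) → R) (u : Fin (n + 1) → G) :
    d S G n (fun w => f (a w)) u = f (d R G n a u) := by
  have key : ∀ (k : ℕ) (x : R), f ((-1) ^ k * x) = (-1) ^ k * f x := by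
    intro k x
    rcases neg_one_pow_eq_or R k with h | h <;>
      rcases Nat.even_or_odd k with hk | hk <;> simp [hk.neg_one_pow]
  simp [d, key]

theorem existsUnique_isConnecting (x : H (ZMod p) G 1) : ∃! y, IsConnecting p x y := by
  obtain ⟨a, rfl⟩ := cls_surj x
  have hpz : NeZero p := ⟨(Fact.out : p.Prime).ne_zero⟩
  have hred : ∀ t : ZMod p, redP p ((t.val : ℕ) : ZMod (p ^ 2)) = t := by
    intro t; rw [map_natCast]; exact ZMod.natCast_zmod_val t
  let c : (Fin 1 → G) → ZMod (p ^ 2) := fun u => ((a.1 u).val : ZMod (p ^ 2))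
  have hc : c ∈ C (ZMod (p ^ 2)) G 1 := fun u hu => by simp [c, a.2.1 u hu]
  have hdc : ∀ u, redP p (d _ G 1 c u) = 0 := by
    intro u
    rw [← AddMonoidHom.coe_coe (redP p), ← d_map]
    have : (fun w => (redP p : ZMod (p ^ 2) →+ ZMod p) (c w)) = a.1 := by
      funext w; exact hred _
    rw [this, Z.d_eq]; rfl
  choose b hb using fun u => redP_eq_zero p (hdc u)
  have hbC : b ∈ C (ZMod p) G 2 := by
    intro u ⟨i, hi⟩
    apply mulP_injective p
    rw [hb, map_zero]
    have h1 : c (fun _ => 1) = 0 := hc _ ⟨0, rfl⟩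
    have e : ∀ w : Fin 1 → G, w = fun _ => w 0 := fun w => by
      funext j; rw [Subsingleton.elim j 0]
    show c _ + ∑ j : Fin 2, _ = _
    rw [Fin.sum_univ_two]
    rw [e (fun i => u i.succ), e (Fin.contractNth 0 _ u), e (Fin.contractNth 1 _ u)]
    fin_cases i
    · have hi' : u 0 = 1 := hi
      simp [Fin.contractNth, hi', h1]
    · have hi' : u 1 = 1 := hi
      simp [Fin.contractNth, hi', h1]
  have hbZ : d (ZMod p) G 2 b = 0 := by
    funext u
    apply mulP_injective p
    rw [← d_map]
    have : (fun w => mulP p (b w)) = d _ G 1 c := funext hb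
    rw [this]
    obtain ⟨g, rfl⟩ := exists_res _ u
    rw [d_res]
    simp only [Finset.sum_range_succ, Finset.sum_range_zero, d_res]
    have e : ∀ g h : ℕ → G, g 0 = h 0 → c (res 1 g) = c (res 1 h) := by
      intro g h hh
      congr 1
      funext j
      rw [Subsingleton.elim j 0]
      exact hh
    have f1 := e (ctr 0 (ctr 0 g)) (ctr 0 (ctr 1 g)) (by simp [ctr, mul_assoc])
    have f2 := e (fun k => ctr 0 g (k + 1)) (fun k => g (k + 1 + 1)) (by simp [ctr])
    have f3 := e (ctr 1 (ctr 0 g)) (ctr 0 g) (by simp [ctr])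
    have f4 := e (ctr 1 (ctr 1 g)) (ctr 1 g) (by simp [ctr])
    have f5 := e (ctr 0 (ctr 2 g)) (ctr 0 g) (by simp [ctr])
    have f6 := e (ctr 1 (ctr 2 g)) (ctr 1 g) (by simp [ctr])
    have f7 := e (fun k => ctr 1 g (k + 1)) (ctr 0 (fun k => g (k + 1))) (by simp [ctr])
    have f8 := e (fun k => ctr 2 g (k + 1)) (ctr 1 (fun k => g (k + 1))) (by simp [ctr])
    rw [f1, f2, f3, f4, f5, f6, f7, f8, Pi.zero_apply, map_zero]
    ring
  refine ⟨cls ⟨b, hbC, hbZ⟩, ⟨a, ⟨b, hbC, hbZ⟩, ⟨c, hc⟩, rfl, rfl, fun u => hred _,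
    fun u => (hb u).symm⟩, ?_⟩
  rintro y ⟨a', b', c', ha', rfl, hr', hd'⟩
  have haa : a' = a := by
    have h := cls_eq.mp ha'
    obtain ⟨f, -, hf⟩ := h
    have h0 : d (ZMod p) G 0 f = 0 := by
      funext u
      have : ∀ w : Fin 0 → G, f w = f Fin.elim0 := fun w => by
        congr 1; exact Subsingleton.elim _ _
      simp [d, this]
    rw [h0] at hf
    exact sub_eq_zero.mp (Subtype.ext hf.symm)
  subst haa
  have hdiff : ∀ u, ∃ e, mulP p e = c'.1 u - c u := fun u =>
    redP_eq_zero p (by rw [map_sub, hr']; exact sub_eq_zero.mpr (hred _).symm)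
  choose e he using hdiff
  refine cls_eq.mpr ⟨e, ?_, ?_⟩
  · intro u hu
    apply mulP_injective p
    rw [he, map_zero, c'.2 u hu, hc u hu, sub_zero]
  · funext u
    apply mulP_injective p
    rw [← d_map]
    have : (fun w => mulP p (e w)) = c'.1 - c := funext he
    rw [this, map_sub, Pi.sub_apply, hd', ← hb, ← map_sub]
    rfl

/-- The Bockstein map `β : H^1(G, ℤ/p) → H^2(G, ℤ/p)`, i.e. the connecting map of
`0 → ℤ/p → ℤ/p² → ℤ/p → 0`. -/
noncomputable def bockstein (x : H (ZMod p) G 1) : H (ZMod p) G 2 :=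
  (existsUnique_isConnecting p x).choose

theorem bockstein_spec (x : H (ZMod p) G 1) : IsConnecting p x (bockstein p x) :=
  (existsUnique_isConnecting p x).choose_spec.1

end Bockstein

section Formula

variable {p r : ℕ} {G : Type u} [CommGroup G] [Module (ZMod p) (Additive G)]

/-- The identification of `V = Hom(G, 𝔽_p)` with `H^1(G, 𝔽_p)`: a linear form is regarded as a
normalized cocycle. -/
def ofDual (v : Module.Dual (ZMod p) (Additive G)) : H (ZMod p) G 1 :=
  cls ⟨fun u => v (Additive.ofMul (u 0)), by
    rintro u ⟨i, hi⟩
    rw [Subsingleton.elim i 0] at hi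
    simp [hi], by
    refine LinearMap.mem_ker.mpr (funext fun u => ?_)
    simp [d, Fin.sum_univ_two, Fin.contractNth]⟩

/-- The action of `S_n` on cochains,
`(σ a)(u_1,…,u_n) = sgn(σ) a(u_{σ⁻¹(1)},…,u_{σ⁻¹(n)})`. -/
def permAct {n : ℕ} (σ : Equiv.Perm (Fin n)) (a : (Fin n → G) → ZMod p) :
    (Fin n → G) → ZMod p :=
  fun u => ((Equiv.Perm.sign σ : ℤ) : ZMod p) * a (fun j => u (σ⁻¹ j))

/-- The position `n_1 + ⋯ + n_{i-1} + j` in `{1,…,n}` of the `j`-th element of the `i`-th block,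
where `n = n_1 + ⋯ + n_r`. -/
def block {ν : Fin r → ℕ} {n : ℕ} (h : ∑ i, ν i = n) : (Σ i, Fin (ν i)) ≃ Fin n :=
  finSigmaFinEquiv.trans (finCongr h)

/-- The `(n_1,…,n_r)`-shuffles: the permutations that are increasing on each block. -/
def Sh {ν : Fin r → ℕ} {n : ℕ} (h : ∑ i, ν i = n) : Finset (Equiv.Perm (Fin n)) :=
  Finset.univ.filter fun σ => ∀ (i : Fin r) (j j' : Fin (ν i)), j < j' →
    σ (block h ⟨i, j⟩) < σ (block h ⟨i, j'⟩)

/-- The tuple `(s^{q_1}, s, …, s^{q_k}, s)` if `m = 2k`, and `(s, s^{q_1}, s, …, s^{q_k}, s)` if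
`m = 2k + 1`. -/
def sTuple (s : G) (m : ℕ) (q : Fin (m / 2) → ℕ) : Fin m → G := fun j =>
  if h : Even (m + (j : ℕ)) then
    s ^ q ⟨(j : ℕ) / 2, by obtain ⟨k, hk⟩ := h; have := j.2; omega⟩
  else s

/-- The concatenation of the tuples `sTuple (s_i) n_i q_i`. -/
def concat (s : Fin r → G) {ν : Fin r → ℕ} {n : ℕ} (h : ∑ i, ν i = n)
    (q : (i : Fin r) → Fin (ν i / 2) → ℕ) : Fin n → G := fun j =>
  sTuple (s ((block h).symm j).1) (ν ((block h).symm j).1) (q ((block h).symm j).1)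
    ((block h).symm j).2

/-- The number of indices `i` with `n_i` odd. -/
def numOdd (ν : Fin r → ℕ) : ℕ := (Finset.univ.filter fun i => Odd (ν i)).card

/-- The coefficient `c_{n_1,…,n_r}`. -/
def coeff (s : Fin r → G) {ν : Fin r → ℕ} {n : ℕ} (h : ∑ i, ν i = n)
    (a : (Fin n → G) → ZMod p) : ZMod p :=
  (-1) ^ (numOdd ν * (numOdd ν - 1) / 2) *
    ∑ σ ∈ Sh h, ∑ q ∈ Fintype.piFinset fun i : Fin r =>
      Fintype.piFinset fun _ : Fin (ν i / 2) => Finset.Icc 1 (p - 1),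
        permAct σ a (concat s h q)

variable (p r G) in
/-- The algebra `Λ(V) ⊗ 𝔽_p[y_1,…,y_r]`. -/
abbrev ExtPoly : Type u :=
  ExteriorAlgebra (ZMod p) (Module.Dual (ZMod p) (Additive G)) ⊗[ZMod p]
    MvPolynomial (Fin r) (ZMod p)

/-- The element `x_i^{(m)}`, equal to `1 ⊗ y_i^k` if `m = 2k` and to `x_i ⊗ y_i^k` if
`m = 2k + 1`, where `x_1,…,x_r` is the basis of `V` dual to `b`. -/
noncomputable def xPow (b : Module.Basis (Fin r) (ZMod p) (Additive G)) (i : Fin r) (m : ℕ) :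
    ExtPoly p r G :=
  (ExteriorAlgebra.ι (ZMod p) (b.coord i) ^ (m % 2)) ⊗ₜ (MvPolynomial.X i ^ (m / 2))

/-- The ordered product `x_1^{(n_1)} ⋯ x_r^{(n_r)}`. -/
noncomputable def xMon (b : Module.Basis (Fin r) (ZMod p) (Additive G)) (ν : Fin r → ℕ) :
    ExtPoly p r G :=
  (List.ofFn fun i => xPow b i (ν i)).prod

end Formula

end ElemAb

/-! Each coefficient `c_ν` is a linear functional on cocycles. The proof shows that it vanishes on
coboundaries, that the functionals are dual to the monomials `x_1^{(n_1)} ⋯ x_r^{(n_r)}`, and that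
together they separate the classes of each degree.

Vanishing. Up to sign, `c_ν` is evaluation on a cycle (`coeff_eq_itT`). In the bar complex of the
cyclic group generated by `s_i`, the sum of the tuples `s_{i,m,q_1,…,q_k}` is a cycle modulo `p`
(`isCycle_blockChain`). Shuffle products of cycles are cycles because `G` is commutative (`sh_dL`,
`itT_dL`). The sum over `Sh(n_1,…,n_r)` is exactly an iterated shuffle product (`permSum_eq_itsh`).
Cochains are extended to functions on lists, where all of this becomes recursion on the first entry.

Duality. The class `y_i` is represented by the carry cocycle of the linear form `x_i`. Both
representatives vanish as soon as one argument has `i`-th coordinate zero. So a product of them,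
evaluated on a shuffle of the blocks, sees only the unshuffled term (`sh_conv`), and the value
factors over the blocks. Within a block, only `q_j = p - 1` produces carries (`evenChain_yPowL`).
The signs of the cup product multiply to `(-1)^{l(l-1)/2}`, which the sign in `c_ν` cancels
(`exists_cocycle_xMon`).

Separation. The dimension of `H^n` is bounded above by a dévissage. The cochains with values in the
functions on `G` are acyclic in positive degrees, and invariance under `s_1,…,s_r` is imposed one
element at a time. For `T = s - 1` and the norm `N` one has `ker T = im N` and `ker N = im T`, so
the long exact sequences bound the new dimension in degree `n` by the sum of the old ones in degrees
at most `n` (`det_kerFam`). The result is the number of tuples `ν` of sum `n` (`exists_detecting`).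
There are that many independent coefficients, so a cocycle killed by all of them is a coboundary
(`mem_B_of_coeff_eq_zero`).

The map `τ` comes from universal properties: squares of degree-one classes vanish since `p` is odd,
and the classes `y_i` commute with each other and with degree one. The formula defines a left
inverse because the monomials span the domain, and a right inverse by separation. -/

namespace ElemAb
universe u v

set_option linter.unusedSectionVars false

/-! ### Cochains on lists, the shuffle product and its boundary formula -/

section ListCochains

variable {R : Type v} [CommRing R] {G : Type u} [CommGroup G]

/-- Precomposition with `w ↦ x :: w`. -/
def pre (x : G) : (List G → R) →ₗ[R] (List G → R) := LinearMap.funLeft R R (List.cons x)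

@[simp] theorem pre_apply (x : G) (a : List G → R) (w : List G) : pre x a w = a (x :: w) := rfl

/-- The alternating sum of the inner faces and the last face of `x :: l`. -/
def mg : G → List G → ((List G → R) →ₗ[R] R)
  | _, [] => LinearMap.proj []
  | x, y :: l => LinearMap.proj (x * y :: l) - (mg y l).comp (pre x)

theorem mg_nil (x : G) (a : List G → R) : mg x [] a = a [] := rfl

theorem mg_cons (x y : G) (l : List G) (a : List G → R) :
    mg x (y :: l) a = a (x * y :: l) - mg y l (pre x a) := rfl

theorem mg_congr (x : G) (l : List G) {a b : List G → R}
    (h : ∀ w, w.length = l.length → a w = b w) : mg x l a = mg x l b := by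
  induction l generalizing x a b with
  | nil => exact h [] rfl
  | cons y l ih =>
    rw [mg_cons, mg_cons, h (x * y :: l) rfl, ih]
    intro w hw
    exact h (x :: w) (by simp [hw])

/-- `mg x l a` as a function of `l`. -/
def mgL (x : G) : (List G → R) →ₗ[R] (List G → R) := LinearMap.pi fun l => mg x l

theorem mgL_apply (x : G) (a : List G → R) (l : List G) : mgL x a l = mg x l a := rfl

/-- The recursion of `mg` read as an identity of cochains; the later boundary computations on lists
run on it. -/
theorem pre_mgL (x y : G) (a : List G → R) :
    pre y (mgL x a) = pre (x * y) a - mgL y (pre x a) := rfl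

/-- The coboundary of a cochain on lists. -/
def dL (a : List G → R) : List G → R
  | [] => 0
  | x :: l => a l - mg x l a

theorem dL_cons (a : List G → R) (x : G) (l : List G) : dL a (x :: l) = a l - mg x l a := rfl

theorem pre_dL (x : G) (a : List G → R) : pre x (dL a) = a - mgL x a := rfl

/-- The signed sum of the values at the shuffles of two lists. -/
def sh : List G → List G → ((List G → R) →ₗ[R] R)
  | [], m => LinearMap.proj m
  | x :: l, [] => LinearMap.proj (x :: l)
  | x :: l, y :: m => (sh l (y :: m)).comp (pre x) +
      ((-1 : R) ^ (l.length + 1)) • (sh (x :: l) m).comp (pre y)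
termination_by l m => l.length + m.length

theorem sh_nil_left (m : List G) (a : List G → R) : sh [] m a = a m := by
  rw [sh]; rfl

theorem sh_nil_right (l : List G) (a : List G → R) : sh l [] a = a l := by
  cases l <;> rw [sh] <;> rfl

theorem sh_cons (x y : G) (l m : List G) (a : List G → R) :
    sh (x :: l) (y :: m) a = sh l (y :: m) (pre x a) +
      (-1) ^ (l.length + 1) * sh (x :: l) m (pre y a) := by
  rw [sh]; rfl

theorem mg_sh_left (x y z : G) (l m : List G) (a : List G → R) :
    mg x (z :: l) (fun w => sh w (y :: m) a) = sh l (y :: m) (pre (x * z) a) -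
      mg z l (fun w => sh w (y :: m) (pre x a)) +
      (-1) ^ (l.length + 1) * mg x (z :: l) (fun w => sh w m (pre y a)) := by
  rw [mg_cons, mg_cons, sh_cons]
  -- The functional `mg z l` only sees lists of the length of `l`, so the sign in `sh_cons`, which
  -- depends on the length of `w`, is constant.
  have : mg z l (pre x fun w => sh w (y :: m) a) =
      mg z l ((fun w => sh w (y :: m) (pre x a)) +
        ((-1 : R) ^ (l.length + 1)) • (pre x fun w => sh w m (pre y a))) := by
    refine mg_congr _ _ fun w hw => ?_
    simp [sh_cons, hw]
  rw [this, map_add, map_smul, smul_eq_mul]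
  ring

theorem mg_sh_left_nil (x y : G) (m : List G) (a : List G → R) :
    mg x [] (fun w => sh w (y :: m) a) = mg x [] (fun w => sh w m (pre y a)) := by
  simp [mg_nil, sh_nil_left]

theorem mg_sh_right (x y z : G) (l m : List G) (a : List G → R) :
    mg y (z :: m) (fun w => sh (x :: l) w a) = mg y (z :: m) (fun w => sh l w (pre x a)) +
      (-1) ^ (l.length + 1) * (sh (x :: l) m (pre (y * z) a) -
        mg z m (fun w => sh (x :: l) w (pre y a))) := by
  rw [mg_cons, mg_cons, sh_cons]
  have : (pre y fun w => sh (x :: l) w a) =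
      ((pre y fun w => sh l w (pre x a)) +
        ((-1 : R) ^ (l.length + 1)) • fun w => sh (x :: l) w (pre y a)) := by
    funext w
    simp [sh_cons]
  rw [this, map_add, map_smul, smul_eq_mul]
  ring

theorem mg_sh_right_nil (x y : G) (l : List G) (a : List G → R) :
    mg y [] (fun w => sh (x :: l) w a) = mg y [] (fun w => sh l w (pre x a)) := by
  simp [mg_nil, sh_nil_right]

/-- This is the boundary formula of `sh_dL` without the leading faces, the form that can be proved
by recursion on both lists. Faces that multiply an entry of one list with an entry of the other
occur in pairs, from two shuffles of opposite sign differing by a swap; they cancel because `x * y =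
y * x`. -/
theorem sh_mgL : (x y : G) → (l m : List G) → (a : List G → R) →
    sh l (y :: m) (mgL x a) + (-1) ^ (l.length + 1) * sh (x :: l) m (mgL y a) =
      mg x l (fun w => sh w (y :: m) a) +
        (-1) ^ (l.length + 1) * mg y m (fun w => sh (x :: l) w a)
  | x, y, [], [], a => by
    simp [sh_nil_left, sh_nil_right, mgL_apply, mg_cons, mg_nil, mul_comm x y]
    ring
  | x, y, [], z :: m, a => by
    have ih := sh_mgL x z [] m (pre y a)
    have e : (fun w => sh [] w (pre x a)) = pre x a := funext fun w => sh_nil_left w _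
    rw [mg_sh_left_nil, mg_sh_right, e, sh_nil_left, mgL_apply, mg_cons, sh_cons, pre_mgL, pre_mgL,
      map_sub, map_sub, mul_comm y x]
    simp only [sh_nil_left, mgL_apply, List.length_nil, pre_apply] at ih ⊢
    linear_combination ih
  | x, y, z :: l, [], a => by
    have ih := sh_mgL z y l [] (pre x a)
    have e : (fun w => sh w [] (pre y a)) = pre y a := funext fun w => sh_nil_right w _
    rw [mg_sh_left, mg_sh_right_nil, e, sh_cons, pre_mgL, pre_mgL,
      map_sub, map_sub, mul_comm x y]
    simp only [sh_nil_right, mgL_apply, mg_cons, mg_nil, List.length_cons, pre_apply] at ih ⊢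
    linear_combination (-1 : R) * ih
  | x, y, z :: l, w :: m, a => by
    have ih1 := sh_mgL z y l (w :: m) (pre x a)
    have ih2 := sh_mgL x w (z :: l) m (pre y a)
    rw [mg_sh_left, mg_sh_right, sh_cons, sh_cons _ _ (z :: l), pre_mgL, pre_mgL, pre_mgL, pre_mgL,
      map_sub, map_sub, map_sub, map_sub, mul_comm x y]
    simp only [List.length_cons, pow_succ] at ih1 ih2 ⊢
    linear_combination (-1 : R) * ih1 - ((-1 : R) ^ l.length) * ih2
termination_by _ _ l m => l.length + m.length

/-- The shuffle product is a chain map: the boundary acts on it as a signed derivation. Only the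
leading faces have to be added to `sh_mgL`. -/
theorem sh_dL (l m : List G) (a : List G → R) :
    sh l m (dL a) = dL (fun w => sh w m a) l + (-1) ^ l.length * dL (fun w => sh l w a) m := by
  cases l with
  | nil =>
    simp only [sh_nil_left, List.length_nil]
    simp [dL]
  | cons x l =>
    cases m with
    | nil =>
      simp only [sh_nil_right]
      simp [dL]
    | cons y m =>
      have h := sh_mgL x y l m a
      rw [sh_cons, pre_dL, pre_dL, map_sub, map_sub, dL_cons, dL_cons, List.length_cons]
      linear_combination (-1 : R) * h

/-- The cochain vanishes on the lists that have an entry in `S`. -/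
def Kills (S : Set G) (a : List G → R) : Prop := ∀ w : List G, (∃ z ∈ w, z ∈ S) → a w = 0

theorem Kills.pre {S : Set G} {a : List G → R} (h : Kills S a) (x : G) : Kills S (pre x a) :=
  fun _ ⟨z, hz, hS⟩ => h _ ⟨z, List.mem_cons_of_mem _ hz, hS⟩

theorem Kills.pre_eq_zero {S : Set G} {a : List G → R} (h : Kills S a) {x : G} (hx : x ∈ S) :
    ElemAb.pre x a = 0 :=
  funext fun _ => h _ ⟨x, List.mem_cons_self, hx⟩

theorem Kills.sh {S : Set G} : {l m : List G} → {a : List G → R} → (h : Kills S a) →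
    (∃ z ∈ l ++ m, z ∈ S) → sh l m a = 0
  | [], m, a, h, hz => by rw [sh_nil_left]; exact h _ hz
  | x :: l, [], a, h, hz => by rw [sh_nil_right]; exact h _ (by simpa using hz)
  | x :: l, y :: m, a, h, ⟨z, hz, hS⟩ => by
    rw [sh_cons]
    have h1 : ElemAb.sh l (y :: m) (ElemAb.pre x a) = 0 := by
      by_cases hx : z = x
      · subst hx; rw [h.pre_eq_zero hS, map_zero]
      · exact (h.pre x).sh ⟨z, by simp_all, hS⟩
    have h2 : ElemAb.sh (x :: l) m (ElemAb.pre y a) = 0 := by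
      by_cases hy : z = y
      · subst hy; rw [h.pre_eq_zero hS, map_zero]
      · exact (h.pre y).sh ⟨z, by simp_all, hS⟩
    rw [h1, h2]; simp
termination_by l m => l.length + m.length

/-- The product of cochains on lists. -/
def conv (f g : List G → R) : List G → R
  | [] => f [] * g []
  | x :: w => conv (fun w => f (x :: w)) g w + f [] * g (x :: w)

theorem conv_nil (f g : List G → R) : conv f g [] = f [] * g [] := rfl

/-- Either the first entry goes to `f`, or `f` takes the empty prefix and the entry goes to `g`. -/
theorem pre_conv (f g : List G → R) (x : G) :
    pre x (conv f g) = conv (pre x f) g + f [] • pre x g := rfl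

theorem zero_conv (g : List G → R) : conv 0 g = 0 := by
  have : ∀ w, conv (0 : List G → R) g w = 0 := by
    intro w
    induction w with
    | nil => simp [conv_nil]
    | cons x w ih =>
      have h := congrFun (pre_conv 0 g x) w
      rw [map_zero] at h
      simpa [ih] using h
  exact funext this

/-- A term of `conv f g` cuts the shuffled list into a prefix for `f` and a suffix for `g`. The
vanishing hypotheses force the prefix to consist of `l` and the suffix of `m`, so only the trivial
shuffle, of sign `1`, survives. -/
theorem sh_conv : {l m : List G} → {f g : List G → R} →
    Kills {z | z ∈ m} f → Kills {z | z ∈ l} g → sh l m (conv f g) = f l * g m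
  | [], [], f, g, hf, hg => by rw [sh_nil_left, conv_nil]
  | [], y :: m, f, g, hf, hg => by
    rw [sh_nil_left, ← pre_apply y (conv f g), pre_conv, hf.pre_eq_zero (by simp), zero_conv]
    simp
  | x :: l, [], f, g, hf, hg => by
    have ih := sh_conv (l := l) (m := []) (f := pre x f) (g := g)
      (fun w ⟨z, hz, h⟩ => by simp at h) (fun w ⟨z, hz, h⟩ => hg w ⟨z, hz, by
        exact List.mem_cons_of_mem _ h⟩)
    rw [sh_nil_right] at ih ⊢
    rw [← pre_apply x (conv f g), pre_conv, hg.pre_eq_zero (by simp)]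
    simpa using ih
  | x :: l, y :: m, f, g, hf, hg => by
    have ih := sh_conv (l := l) (m := y :: m) (f := pre x f) (g := g)
      (hf.pre x) (fun w ⟨z, hz, h⟩ => hg w ⟨z, hz, List.mem_cons_of_mem _ h⟩)
    have h2 : sh (x :: l) m (pre y g) = 0 :=
      (hg.pre y).sh ⟨x, by simp, by simp⟩
    rw [sh_cons, pre_conv, pre_conv, hg.pre_eq_zero (x := x) (by simp),
      hf.pre_eq_zero (x := y) (by simp), zero_conv, smul_zero, add_zero, zero_add, map_smul, h2, ih]
    simp
termination_by l m => l.length + m.length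

end ListCochains

/-! ### Slant products with cycles and shuffles of several lists -/

section IteratedShuffle

variable {R : Type v} [CommRing R] {G : Type u} [CommGroup G]

theorem mg_comm (φ : (List G → R) →ₗ[R] R) (F : List G → List G → R) (x : G) (w : List G) :
    mg x w (fun w' => φ (F w')) = φ (fun l => mg x w (fun w' => F w' l)) := by
  induction w generalizing x F with
  | nil => rfl
  | cons y w ih =>
    simp only [mg_cons]
    have := ih (fun w' => F (x :: w')) y
    change φ _ - mg y w (fun w' => φ (F (x :: w'))) = φ ((fun l => F (x * y :: w) l) - fun l =>
      mg y w (fun w' => F (x :: w') l))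
    rw [map_sub, this]

theorem dL_comm (φ : (List G → R) →ₗ[R] R) (F : List G → List G → R) (w : List G) :
    dL (fun w' => φ (F w')) w = φ (fun l => dL (fun w' => F w' l) w) := by
  cases w with
  | nil => exact (map_zero φ).symm
  | cons x w =>
    simp only [dL_cons, mg_comm]
    exact (map_sub φ (F w) _).symm

theorem dL_neg_one_pow (m : ℕ) (a : List G → R) (w : List G) :
    dL (((-1 : R) ^ m) • a) w = (-1) ^ m * dL a w := by
  cases w with
  | nil => simp [dL]
  | cons x w => simp [dL_cons, mul_sub]

/-- The slant product with a functional `φ`. -/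
def slant (φ : (List G → R) →ₗ[R] R) : (List G → R) →ₗ[R] (List G → R) :=
  LinearMap.pi fun w => φ.comp (LinearMap.pi fun l => sh l w)

theorem slant_apply (φ : (List G → R) →ₗ[R] R) (a : List G → R) (w : List G) :
    slant φ a w = φ (fun l => sh l w a) := rfl

/-- The functional vanishes on coboundaries and depends only on lists of length `m`. -/
structure IsCycle (φ : (List G → R) →ₗ[R] R) (m : ℕ) : Prop where
  dL_eq_zero : ∀ a : List G → R, Kills {1} a → φ (dL a) = 0
  congr : ∀ a b : List G → R, (∀ l, l.length = m → a l = b l) → φ a = φ b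

theorem Kills.slant {S : Set G} {a : List G → R} (h : Kills S a) (φ : (List G → R) →ₗ[R] R) :
    Kills S (slant φ a) := by
  intro w ⟨z, hz, hS⟩
  rw [slant_apply]
  have : (fun l => ElemAb.sh l w a) = 0 := funext fun l => h.sh ⟨z, by simp [hz], hS⟩
  rw [this, map_zero]

/-- In `sh_dL` the boundary in the first variable is killed by `φ`. The boundary in the second one
carries the sign `(-1) ^ m`, since `φ` only sees lists of length `m`; the sign is kept inside `dL`
so that the result is again a coboundary. -/
theorem IsCycle.slant_dL {φ : (List G → R) →ₗ[R] R} {m : ℕ} (hφ : IsCycle φ m) {a : List G → R}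
    (ha : Kills {1} a) : slant φ (dL a) = dL (((-1 : R) ^ m) • slant φ a) := by
  funext w
  rw [dL_neg_one_pow]
  have e : dL (slant φ a) w = φ (fun l => dL (fun w' => sh l w' a) w) :=
    dL_comm φ (fun w' l => sh l w' a) w
  rw [e, slant_apply]
  have e2 : φ (fun l => sh l w (dL a)) = φ (dL (fun l => sh l w a) +
      ((-1 : R) ^ m) • fun l => dL (fun w' => sh l w' a) w) := by
    refine hφ.congr _ _ fun l hl => ?_
    simp [sh_dL, hl]
  rw [e2, map_add, map_smul, hφ.dL_eq_zero, zero_add, smul_eq_mul]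
  rintro l ⟨z, hz, hS⟩
  exact ha.sh ⟨z, by simp [hz], hS⟩

/-- The iterated slant product with functionals `φ 0, …, φ (r - 1)`. -/
def itT : {r : ℕ} → (Fin r → ((List G → R) →ₗ[R] R)) → ((List G → R) →ₗ[R] R)
  | 0, _ => LinearMap.proj []
  | _ + 1, φ => (itT fun i => φ i.succ).comp (slant (φ 0))

theorem itT_zero (φ : Fin 0 → ((List G → R) →ₗ[R] R)) (a : List G → R) : itT φ a = a [] := rfl

theorem itT_succ {r : ℕ} (φ : Fin (r + 1) → ((List G → R) →ₗ[R] R)) (a : List G → R) :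
    itT φ a = itT (fun i => φ i.succ) (slant (φ 0) a) := rfl

/-- Each slant product turns a coboundary into a coboundary, and after the last one it is evaluated
at the empty list, where every coboundary is zero. -/
theorem itT_dL {r : ℕ} {φ : Fin r → ((List G → R) →ₗ[R] R)} {ν : Fin r → ℕ}
    (hφ : ∀ i, IsCycle (φ i) (ν i)) {a : List G → R} (ha : Kills {1} a) : itT φ (dL a) = 0 := by
  induction r generalizing a with
  | zero => rfl
  | succ r ih =>
    rw [itT_succ, (hφ 0).slant_dL ha]
    refine ih (fun i => hφ i.succ) fun w hw => ?_
    simp [ha.slant (φ 0) w hw]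

theorem sum_slant {ι : Type*} (s : Finset ι) (φ : ι → ((List G → R) →ₗ[R] R)) (a : List G → R) :
    slant (∑ q ∈ s, φ q) a = ∑ q ∈ s, slant (φ q) a := by
  funext w
  simp [slant_apply]

theorem sum_piFinset_succ {M : Type*} [AddCommMonoid M] {r : ℕ} {κ : Fin (r + 1) → Type*}
    (S : ∀ i, Finset (κ i)) (F : (∀ i, κ i) → M) :
    ∑ q ∈ Fintype.piFinset S, F q =
      ∑ q' ∈ Fintype.piFinset (fun i : Fin r => S i.succ), ∑ x ∈ S 0, F (Fin.cons x q') := by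
  rw [← Finset.sum_product']
  symm
  refine Finset.sum_bij' (fun x _ => Fin.cons x.2 x.1) (fun q _ => (fun i => q i.succ, q 0))
    ?_ ?_ ?_ ?_ ?_
  · rintro ⟨q, x⟩ h
    simp only [Finset.mem_product, Fintype.mem_piFinset] at h ⊢
    intro i
    refine Fin.cases ?_ (fun i => ?_) i
    · exact h.2
    · exact h.1 i
  · intro q h
    simp only [Finset.mem_product, Fintype.mem_piFinset] at h ⊢
    exact ⟨fun i => h _, h 0⟩
  · rintro ⟨q, x⟩ _
    simp
  · intro q _
    exact Fin.cons_self_tail q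
  · intros; rfl

theorem itT_sum {r : ℕ} {κ : Fin r → Type*} (S : ∀ i, Finset (κ i))
    (φ : ∀ i, κ i → ((List G → R) →ₗ[R] R)) (a : List G → R) :
    itT (fun i => ∑ q ∈ S i, φ i q) a = ∑ q ∈ Fintype.piFinset S, itT (fun i => φ i (q i)) a := by
  induction r generalizing a with
  | zero => simp [itT_zero]
  | succ r ih =>
    rw [itT_succ, sum_slant, map_sum, sum_piFinset_succ]
    simp only [ih]
    rw [Finset.sum_comm]
    refine Finset.sum_congr rfl fun q' _ => Finset.sum_congr rfl fun x _ => ?_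
    rw [itT_succ]
    simp

/-- The signed sum of the values at the shuffles of several lists. -/
def itsh {r : ℕ} (ls : Fin r → List G) : (List G → R) →ₗ[R] R :=
  itT fun i => LinearMap.proj (ls i)

theorem itsh_zero (ls : Fin 0 → List G) (a : List G → R) : itsh ls a = a [] := rfl

theorem itsh_succ {r : ℕ} (ls : Fin (r + 1) → List G) (a : List G → R) :
    itsh ls a = itsh (fun i => ls i.succ) (fun w => sh (ls 0) w a) := rfl

theorem itsh_nil {r : ℕ} {ls : Fin r → List G} (h : ∀ i, ls i = []) (a : List G → R) :
    itsh ls a = a [] := by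
  induction r generalizing a with
  | zero => rfl
  | succ r ih => rw [itsh_succ, ih fun i => h _, h, sh_nil_left]

/-- Case distinction on a list, with value zero at the empty list. -/
def hd (l : List G) (F : G → List G → R) : R :=
  match l with
  | [] => 0
  | x :: t => F x t

theorem hd_add (l : List G) (F F' : G → List G → R) :
    hd l (fun x t => F x t + F' x t) = hd l F + hd l F' := by
  cases l <;> simp [hd]

theorem hd_congr {l : List G} {F F' : G → List G → R} (h : ∀ x t, l = x :: t → F x t = F' x t) :
    hd l F = hd l F' := by
  cases l with
  | nil => rfl
  | cons x t => exact h x t rfl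

theorem update_succ_comp {r : ℕ} {α : Type*} (ls : Fin (r + 1) → α) (i : Fin r) (t : α) :
    (fun j => Function.update ls i.succ t j.succ) = Function.update (fun j => ls j.succ) i t := by
  funext j
  by_cases h : j = i
  · subst h; simp
  · rw [Function.update_of_ne h, Function.update_of_ne (fun h' => h (Fin.succ_injective _ h'))]

/-- The first entry of a shuffle is the head of some `ls i`, and moving it to the front passes all
entries of the earlier lists, whence the sign. If all lists were empty, the left side would be `a
[]` and the right side zero. This recursion is compared with `permSum_succ`. -/
theorem itsh_eq_sum_hd {r : ℕ} (ls : Fin r → List G) (h : ∃ i, ls i ≠ []) (a : List G → R) :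
    itsh ls a = ∑ i, hd (ls i) fun x t =>
      (-1) ^ (∑ j, if j < i then (ls j).length else 0) *
        itsh (Function.update ls i t) (pre x a) := by
  induction r generalizing a with
  | zero => exact h.choose.elim0
  | succ r ih =>
    rw [Fin.sum_univ_succ]
    have e0 : ∀ x t, itsh (Function.update ls 0 t) (pre x a) =
        itsh (fun i => ls i.succ) (fun w => sh t w (pre x a)) := by
      intro x t
      rw [itsh_succ]
      simp
    have e1 : ∀ (i : Fin r) x t, itsh (Function.update ls i.succ t) (pre x a) =
        itsh (Function.update (fun j => ls j.succ) i t) (fun w => sh (ls 0) w (pre x a)) := by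
      intro i x t
      rw [itsh_succ, update_succ_comp]
      rfl
    have e2 : ∀ i : Fin r, (∑ j, if j < i.succ then (ls j).length else 0) =
        (ls 0).length + ∑ j : Fin r, if j < i then (ls j.succ).length else 0 := by
      intro i
      rw [Fin.sum_univ_succ]
      simp
    simp only [e0, e1, e2, Fin.not_lt_zero, if_false, Finset.sum_const_zero, pow_zero, one_mul]
    rw [itsh_succ]
    -- The induction hypothesis needs a nonempty list among the later ones; otherwise the only list
    -- that can contribute is `ls 0`.
    by_cases hL : ∃ i : Fin r, ls i.succ ≠ []
    · have ih' := ih (fun i => ls i.succ) hL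
      rw [ih']
      cases h0 : ls 0 with
      | nil =>
        simp only [hd, List.length_nil, zero_add]
        refine Finset.sum_congr rfl fun i _ => hd_congr fun y t _ => ?_
        congr 2
        funext w
        simp [sh_nil_left]
      | cons x t =>
        simp only [hd]
        rw [ih', ← Finset.sum_add_distrib]
        refine Finset.sum_congr rfl fun i _ => ?_
        change _ = hd _ _ + hd _ _
        rw [← hd_add]
        refine hd_congr fun y t' _ => ?_
        have : (pre y fun w => sh (x :: t) w a) = (pre y fun w => sh t w (pre x a)) +
            ((-1 : R) ^ (t.length + 1)) • fun w => sh (x :: t) w (pre y a) := by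
          funext w
          simp [sh_cons]
        rw [this, map_add, map_smul, List.length_cons, smul_eq_mul]
        ring
    · push Not at hL
      rw [itsh_nil hL, sh_nil_right]
      have : ∑ i : Fin r, hd (ls i.succ) (fun x t => (-1) ^ ((ls 0).length + ∑ j : Fin r,
          if j < i then (ls j.succ).length else 0) *
          itsh (Function.update (fun j => ls j.succ) i t) fun w => sh (ls 0) w (pre x a)) = 0 :=
        Finset.sum_eq_zero fun i _ => by rw [hL]; rfl
      rw [this, add_zero]
      cases h0 : ls 0 with
      | nil => exact absurd h (by
          push Not
          intro i
          exact Fin.cases h0 hL i)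
      | cons x t =>
        simp only [hd]
        rw [itsh_nil hL, sh_nil_right]
        rfl

theorem sh_congr : {l m : List G} → {a b : List G → R} →
    (∀ w : List G, (∀ z ∈ w, z ∈ l ∨ z ∈ m) → a w = b w) → sh l m a = sh l m b
  | [], m, a, b, h => by
    rw [sh_nil_left, sh_nil_left]
    exact h _ fun z hz => Or.inr hz
  | x :: l, [], a, b, h => by
    rw [sh_nil_right, sh_nil_right]
    exact h _ fun z hz => Or.inl hz
  | x :: l, y :: m, a, b, h => by
    have h1 : sh l (y :: m) (pre x a) = sh l (y :: m) (pre x b) := sh_congr fun w hw => h _ (by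
      intro z hz
      rcases List.mem_cons.mp hz with rfl | hz
      · simp
      · exact (hw z hz).imp_left (List.mem_cons_of_mem _))
    have h2 : sh (x :: l) m (pre y a) = sh (x :: l) m (pre y b) := sh_congr fun w hw => h _ (by
      intro z hz
      rcases List.mem_cons.mp hz with rfl | hz
      · simp
      · exact (hw z hz).imp_right (List.mem_cons_of_mem _))
    rw [sh_cons, sh_cons, h1, h2]
termination_by l m => l.length + m.length

theorem itsh_congr {r : ℕ} {ls : Fin r → List G} {a b : List G → R}
    (h : ∀ w : List G, (∀ z ∈ w, ∃ i, z ∈ ls i) → a w = b w) : itsh ls a = itsh ls b := by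
  induction r generalizing a b with
  | zero => exact h _ (by simp)
  | succ r ih =>
    rw [itsh_succ, itsh_succ]
    refine ih fun w hw => sh_congr fun w' hw' => h _ fun z hz => ?_
    rcases hw' z hz with h1 | h1
    · exact ⟨0, h1⟩
    · obtain ⟨i, hi⟩ := hw z h1
      exact ⟨i.succ, hi⟩

/-- The product of several cochains on lists. -/
def convs : {r : ℕ} → (Fin r → List G → R) → List G → R
  | 0, _ => fun w => if w = [] then 1 else 0
  | _ + 1, f => conv (f 0) (convs fun i => f i.succ)

theorem Kills.conv {S : Set G} {f g : List G → R} (hf : Kills S f) (hg : Kills S g) :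
    Kills S (conv f g) := by
  intro w
  induction w generalizing f with
  | nil => rintro ⟨z, hz, -⟩; simp at hz
  | cons x w ih =>
    rintro ⟨z, hz, hS⟩
    have e : ElemAb.conv f g (x :: w) = ElemAb.conv (ElemAb.pre x f) g w + f [] * g (x :: w) := rfl
    rw [e, hg _ ⟨z, hz, hS⟩, mul_zero, add_zero]
    rcases List.mem_cons.mp hz with rfl | hz
    · rw [hf.pre_eq_zero hS, zero_conv]; rfl
    · exact ih (hf.pre x) ⟨z, hz, hS⟩

theorem Kills.convs {S : Set G} {r : ℕ} {f : Fin r → List G → R} (hf : ∀ i, Kills S (f i)) :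
    Kills S (convs f) := by
  induction r with
  | zero =>
    rintro w ⟨z, hz, -⟩
    have : w ≠ [] := by rintro rfl; simp at hz
    simp [ElemAb.convs, this]
  | succ r ih => exact (hf 0).conv (ih fun i => hf i.succ)

/-- Iterates `sh_conv`: only the concatenation of the lists in their given order survives. -/
theorem itsh_convs {r : ℕ} {ls : Fin r → List G} {f : Fin r → List G → R}
    (h : ∀ i j, i ≠ j → Kills {z | z ∈ ls i} (f j)) :
    itsh ls (convs f) = ∏ i, f i (ls i) := by
  induction r with
  | zero => simp [itsh_zero, convs]
  | succ r ih =>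
    rw [itsh_succ, Fin.prod_univ_succ,
      ← ih (ls := fun i => ls i.succ) (f := fun i => f i.succ)
        fun i j hij => h _ _ (fun e => hij (Fin.succ_injective _ e)),
      ← smul_eq_mul, ← map_smul]
    -- It suffices to treat lists `w` with entries in the later lists; this is what makes `f 0`
    -- vanish on the entries of `w`.
    refine itsh_congr fun w hw => ?_
    refine sh_conv ?_ (Kills.convs fun i => h _ _ (Fin.succ_ne_zero i).symm)
    rintro w' ⟨z, hz, hzw⟩
    obtain ⟨i, hi⟩ := hw z hzw
    exact h i.succ 0 (Fin.succ_ne_zero i) w' ⟨z, hz, hi⟩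

end IteratedShuffle

/-! ### The standard cycles of a cyclic group of order dividing `p` -/

section SingleBlock

variable {p : ℕ} {R : Type v} [CommRing R] {G : Type u} [CommGroup G]

variable (p R) in
/-- The sum over `1 ≤ q_j ≤ p - 1` of the values at `[s ^ q_1, s, …, s ^ q_k, s]`. -/
def evenChain (s : G) : ℕ → ((List G → R) →ₗ[R] R)
  | 0 => LinearMap.proj []
  | k + 1 => ∑ q ∈ Finset.Icc 1 (p - 1), (evenChain s k).comp ((pre s).comp (pre (s ^ q)))

theorem evenChain_succ (s : G) (k : ℕ) (a : List G → R) : evenChain p R s (k + 1) a =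
    ∑ q ∈ Finset.Icc 1 (p - 1), evenChain p R s k (pre s (pre (s ^ q) a)) := by
  simp [evenChain]

/-- Applied to values at `s ^ q`: the term at `q = p` vanishes because `s ^ p = 1` and the cochains
are normalized. -/
theorem sum_Icc_shift {M : Type*} [AddCommGroup M] {p : ℕ} (hp : 1 < p) (f : ℕ → M)
    (h : f p = 0) : ∑ q ∈ Finset.Icc 1 (p - 1), f (q + 1) =
      ∑ q ∈ Finset.Icc 1 (p - 1), f q - f 1 := by
  obtain ⟨m, rfl⟩ : ∃ m, p = m + 1 := ⟨p - 1, by omega⟩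
  have e : Finset.Icc 1 (m + 1 - 1) = Finset.Ico 1 (m + 1) := by ext; simp
  rw [e, Finset.sum_Ico_eq_sum_range, Finset.sum_Ico_eq_sum_range]
  have h1 := Finset.sum_range_succ (fun i => f (1 + i)) m
  have h2 := Finset.sum_range_succ' (fun i => f (1 + i)) m
  simp only [Nat.add_sub_cancel, add_zero] at h1 h2 ⊢
  rw [add_comm 1 m, h, add_zero] at h1
  rw [← h1, h2, add_sub_cancel_right]
  exact Finset.sum_congr rfl fun i _ => by rw [add_assoc]

/-- Two of the faces of `s, s ^ q, s, …` replace `s ^ q` by `s ^ (q + 1)`, once before and once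
after an `s`. Shifting the sum over `q` leaves the same boundary term `f 1` in both, so these
cancel; the remaining faces are handled by induction. -/
theorem evenChain_mgL (hp : 1 < p) {s : G} (hs : s ^ p = 1) (k : ℕ) {a : List G → R}
    (ha : Kills {1} a) : evenChain p R s k (mgL s a) = evenChain p R s k a := by
  induction k generalizing a with
  | zero => rfl
  | succ k ih =>
    rw [evenChain_succ, evenChain_succ]
    have h0 : ∀ a : List G → R, Kills {1} a → pre (s ^ p) a = 0 := fun a ha => by
      rw [hs]; exact ha.pre_eq_zero rfl
    have e : ∀ q, pre s (pre (s ^ q) (mgL s a)) = pre s (pre (s ^ (q + 1)) a) -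
        (pre (s ^ (q + 1)) (pre s a) - mgL s (pre (s ^ q) (pre s a))) := by
      intro q
      rw [pre_mgL, map_sub, pre_mgL, ← pow_succ', ← pow_succ]
    have e1 := sum_Icc_shift hp (fun q => evenChain p R s k (pre s (pre (s ^ q) a)))
      (by simp [h0 a ha])
    have e2 := sum_Icc_shift hp (fun q => evenChain p R s k (pre (s ^ q) (pre s a)))
      (by simp [h0 _ (ha.pre s)])
    simp only [e, map_sub, Finset.sum_sub_distrib, ih ((ha.pre s).pre _)]
    simp only [pow_one] at e1 e2
    rw [e1, e2]
    abel

theorem evenChain_congr (s : G) (k : ℕ) (a b : List G → R)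
    (h : ∀ l, l.length = 2 * k → a l = b l) : evenChain p R s k a = evenChain p R s k b := by
  induction k generalizing a b with
  | zero => exact h _ rfl
  | succ k ih =>
    rw [evenChain_succ, evenChain_succ]
    refine Finset.sum_congr rfl fun q _ => ih _ _ fun l hl => h _ ?_
    simp [hl, mul_add]

variable (p R) in
/-- The sum of the values at the tuples `sTuple s m q`. -/
def blockChain (s : G) (m : ℕ) : (List G → R) →ₗ[R] R :=
  if Even m then evenChain p R s (m / 2) else (evenChain p R s (m / 2)).comp (pre s)

/-- In odd degree the leading face equals the sum of all other faces by `evenChain_mgL`. In even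
degree the leading face does not depend on `q_1` and occurs `p - 1` times, the shift of `q_1`
produces it once more, and `p = 0` in `R`. -/
theorem isCycle_blockChain [CharP R p] (hp : 1 < p) {s : G} (hs : s ^ p = 1) (m : ℕ) :
    IsCycle (blockChain p R s m) m := by
  refine ⟨fun a ha => ?_, fun a b h => ?_⟩
  · unfold blockChain
    split_ifs with hm
    · generalize m / 2 = k
      cases k with
      | zero => rfl
      | succ k =>
        have e : ∀ q, pre s (pre (s ^ q) (dL a)) =
            pre s a - (pre (s ^ (q + 1)) a - mgL s (pre (s ^ q) a)) := by
          intro q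
          rw [pre_dL, map_sub, pre_mgL, ← pow_succ]
        have e1 := sum_Icc_shift hp (fun q => evenChain p R s k (pre (s ^ q) a))
          (by rw [hs, ha.pre_eq_zero rfl, map_zero])
        simp only [pow_one] at e1
        rw [evenChain_succ]
        simp only [e, map_sub, Finset.sum_sub_distrib, evenChain_mgL hp hs k (ha.pre _)]
        rw [e1, Finset.sum_const, Nat.card_Icc, nsmul_eq_mul]
        -- The number of values of `q_1`, in the form given by `Nat.card_Icc`.
        have : ((p - 1 + 1 - 1 : ℕ) : R) = -1 := by
          rw [Nat.add_sub_cancel, Nat.cast_sub hp.le, CharP.cast_eq_zero]; simp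
        rw [this]
        ring
    · rw [LinearMap.comp_apply, pre_dL, map_sub, evenChain_mgL hp hs _ ha, sub_self]
  · unfold blockChain
    split_ifs with hm
    · exact evenChain_congr _ _ _ _ fun l hl => h l (by obtain ⟨k, hk⟩ := hm; omega)
    · refine evenChain_congr _ _ _ _ fun l hl => h _ ?_
      rw [Nat.not_even_iff_odd] at hm
      obtain ⟨k, hk⟩ := hm
      rw [List.length_cons]; omega

theorem evenChain_eq_sum (s : G) (k : ℕ) (a : List G → R) :
    evenChain p R s k a = ∑ q ∈ Fintype.piFinset fun _ : Fin k => Finset.Icc 1 (p - 1),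
      a (List.ofFn fun j : Fin (2 * k) => if Even (j : ℕ) then s ^ q ⟨(j : ℕ) / 2, by omega⟩
        else s) := by
  induction k generalizing a with
  | zero => simp [evenChain]
  | succ k ih =>
    rw [evenChain_succ, sum_piFinset_succ, Finset.sum_comm]
    refine Finset.sum_congr rfl fun x _ => ?_
    rw [ih]
    refine Finset.sum_congr rfl fun q _ => ?_
    change a (s ^ x :: s :: List.ofFn _) = _
    congr 1
    change _ = List.ofFn (n := 2 * k + 1 + 1) _
    rw [List.ofFn_succ, List.ofFn_succ]
    congr 1
    · simp
    congr 1
    congr 1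
    funext j
    have h1 : Even (((j.succ).succ : Fin (2 * k + 1 + 1)) : ℕ) ↔ Even (j : ℕ) := by
      simp [Nat.even_add_one]
    simp only [h1]
    split_ifs with h
    · congr 1
      have : (⟨(((j.succ).succ : Fin (2 * k + 1 + 1)) : ℕ) / 2, by simp; omega⟩ : Fin (k + 1)) =
          Fin.succ ⟨(j : ℕ) / 2, by omega⟩ := by
        ext
        simp; omega
      rw [this, Fin.cons_succ]
    · rfl

theorem blockChain_eq_sum (s : G) (m : ℕ) (a : List G → R) :
    blockChain p R s m a = ∑ q ∈ Fintype.piFinset fun _ : Fin (m / 2) => Finset.Icc 1 (p - 1),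
      a (List.ofFn (sTuple s m q)) := by
  unfold blockChain
  split_ifs with hm
  · rw [evenChain_eq_sum]
    have h2 : 2 * (m / 2) = m := by obtain ⟨k, hk⟩ := hm; omega
    refine Finset.sum_congr rfl fun q _ => ?_
    congr 1
    rw [List.ofFn_congr h2]
    congr 1
    funext j
    have : Even (m + (j : ℕ)) ↔ Even (j : ℕ) := by simp [Nat.even_add, hm]
    simp only [sTuple, this, Fin.val_cast]
    split_ifs <;> rfl
  · rw [LinearMap.comp_apply, evenChain_eq_sum]
    have hm' := hm
    rw [Nat.not_even_iff_odd] at hm'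
    have h2 : 2 * (m / 2) + 1 = m := by obtain ⟨k, hk⟩ := hm'; omega
    refine Finset.sum_congr rfl fun q _ => ?_
    rw [pre_apply]
    congr 1
    rw [List.ofFn_congr h2.symm (sTuple s m q), List.ofFn_succ]
    congr 1
    · simp [sTuple, hm]
    congr 1
    funext j
    have : Even (m + ((j : ℕ) + 1)) ↔ Even (j : ℕ) := by simp [Nat.even_add, hm, Nat.even_add_one]
    simp only [sTuple, this, Fin.val_cast, Fin.val_succ]
    split_ifs with h
    · congr 2
      ext
      obtain ⟨k, hk⟩ := h
      simp; omega
    · rfl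

end SingleBlock

/-! ### Shuffle permutations compared with recursive shuffles -/

section Permutations

variable {R : Type v} [CommRing R] {G : Type u} [CommGroup G]

/-- `σ` is increasing on the fibres of `lam`. -/
def IsSh {n r : ℕ} (lam : Fin n → Fin r) (σ : Equiv.Perm (Fin n)) : Prop :=
  ∀ j j', j < j' → lam j = lam j' → σ j < σ j'

/-- The permutation that maps `P` to `0` and is `τ` on the other elements. -/
def insertPerm {n : ℕ} (x : Fin (n + 1) × Equiv.Perm (Fin n)) : Equiv.Perm (Fin (n + 1)) :=
  Equiv.Perm.decomposeFin.symm (0, x.2) * Fin.cycleRange x.1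

theorem insertPerm_self {n : ℕ} (P : Fin (n + 1)) (τ : Equiv.Perm (Fin n)) :
    insertPerm (P, τ) P = 0 := by
  simp [insertPerm]

theorem insertPerm_succAbove {n : ℕ} (P : Fin (n + 1)) (τ : Equiv.Perm (Fin n)) (k : Fin n) :
    insertPerm (P, τ) (P.succAbove k) = (τ k).succ := by
  simp [insertPerm]

theorem insertPerm_inv_zero {n : ℕ} (P : Fin (n + 1)) (τ : Equiv.Perm (Fin n)) :
    (insertPerm (P, τ))⁻¹ 0 = P := by
  rw [Equiv.Perm.inv_eq_iff_eq, insertPerm_self]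

theorem insertPerm_inv_succ {n : ℕ} (P : Fin (n + 1)) (τ : Equiv.Perm (Fin n)) (k : Fin n) :
    (insertPerm (P, τ))⁻¹ k.succ = P.succAbove (τ⁻¹ k) := by
  rw [Equiv.Perm.inv_eq_iff_eq, insertPerm_succAbove]
  simp

theorem sign_insertPerm {n : ℕ} (P : Fin (n + 1)) (τ : Equiv.Perm (Fin n)) :
    Equiv.Perm.sign (insertPerm (P, τ)) = (-1) ^ (P : ℕ) * Equiv.Perm.sign τ := by
  simp [insertPerm, mul_comm]

theorem insertPerm_bijective (n : ℕ) :
    Function.Bijective (insertPerm : Fin (n + 1) × Equiv.Perm (Fin n) → _) := by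
  rw [Fintype.bijective_iff_injective_and_card]
  constructor
  · rintro ⟨P, τ⟩ ⟨P', τ'⟩ h
    have hP : P = P' := by rw [← insertPerm_inv_zero P τ, h, insertPerm_inv_zero]
    subst hP
    refine Prod.ext rfl (Equiv.ext fun k => Fin.succ_injective _ ?_)
    rw [← insertPerm_succAbove P, h, insertPerm_succAbove]
  · simp [Fintype.card_perm, Nat.factorial_succ]

/-- A permutation increasing on fibres can send `P` to the first place only if `P` is the least
element of its fibre; beyond this only the order of the other elements matters. -/
theorem isSh_insertPerm {n r : ℕ} (lam : Fin (n + 1) → Fin r) (P : Fin (n + 1))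
    (τ : Equiv.Perm (Fin n)) : IsSh lam (insertPerm (P, τ)) ↔
      (∀ j, j < P → lam j ≠ lam P) ∧ IsSh (fun k => lam (P.succAbove k)) τ := by
  constructor
  · intro h
    refine ⟨fun j hj hl => ?_, fun j j' hj hl => ?_⟩
    · have := h j P hj hl
      rw [insertPerm_self] at this
      exact absurd this (Fin.not_lt_zero _)
    · have := h _ _ (Fin.strictMono_succAbove P hj) hl
      rwa [insertPerm_succAbove, insertPerm_succAbove, Fin.succ_lt_succ_iff] at this
  · rintro ⟨h1, h2⟩ j j' hj hl
    rcases Fin.eq_self_or_eq_succAbove P j with rfl | ⟨k, rfl⟩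
    · rcases Fin.eq_self_or_eq_succAbove j j' with rfl | ⟨k', rfl⟩
      · exact absurd hj (lt_irrefl _)
      · rw [insertPerm_self, insertPerm_succAbove]
        exact Fin.succ_pos _
    · rcases Fin.eq_self_or_eq_succAbove P j' with rfl | ⟨k', rfl⟩
      · exact absurd hl (h1 _ hj)
      · rw [insertPerm_succAbove, insertPerm_succAbove, Fin.succ_lt_succ_iff]
        exact h2 k k' ((Fin.strictMono_succAbove P).lt_iff_lt.mp hj) hl

open scoped Classical in
/-- The signed sum over the permutations that are increasing on the fibres of `lam`. -/
noncomputable def permSum {n r : ℕ} (lam : Fin n → Fin r) (u : Fin n → G) (a : List G → R) : R :=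
  ∑ σ : Equiv.Perm (Fin n), if IsSh lam σ then
    ((Equiv.Perm.sign σ : ℤ) : R) * a (List.ofFn fun j => u (σ⁻¹ j)) else 0

theorem permSum_zero {r : ℕ} (lam : Fin 0 → Fin r) (u : Fin 0 → G) (a : List G → R) :
    permSum lam u a = a [] := by
  have : ∀ σ, IsSh lam σ := fun _ j => j.elim0
  simp [permSum, this]

open scoped Classical in
-- Permutations are sorted by the element `P` sent to `0`; the cycle that brings `P` to the front
-- has sign `(-1) ^ P`.
theorem permSum_succ {n r : ℕ} (lam : Fin (n + 1) → Fin r) (u : Fin (n + 1) → G)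
    (a : List G → R) : permSum lam u a = ∑ P, if ∀ j, j < P → lam j ≠ lam P then
      (-1) ^ (P : ℕ) * permSum (fun k => lam (P.succAbove k)) (fun k => u (P.succAbove k))
        (pre (u P) a) else 0 := by
  rw [permSum, ← Function.Bijective.sum_comp (insertPerm_bijective n), Fintype.sum_prod_type]
  refine Finset.sum_congr rfl fun P _ => ?_
  simp only [isSh_insertPerm]
  by_cases h : ∀ j, j < P → lam j ≠ lam P
  · rw [if_pos h, permSum, Finset.mul_sum]
    refine Finset.sum_congr rfl fun τ _ => ?_
    by_cases h2 : IsSh (fun k => lam (P.succAbove k)) τ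
    · rw [if_pos ⟨h, h2⟩, if_pos h2, List.ofFn_succ, sign_insertPerm]
      simp only [insertPerm_inv_zero, insertPerm_inv_succ, pre_apply]
      push_cast
      ring
    · rw [if_neg fun h' => h2 h'.2, if_neg h2, mul_zero]
  · rw [if_neg h]
    exact Finset.sum_eq_zero fun τ _ => if_neg fun h' => h h'.1

/-- The subsequence of `u` on the fibre of `lam` above `i`. -/
def fibreList {n r : ℕ} (lam : Fin n → Fin r) (u : Fin n → G) (i : Fin r) : List G :=
  (List.finRange n).filterMap fun k => if lam k = i then some (u k) else none

theorem filterMap_finRange_none {α : Type*} {n : ℕ} (f : Fin (n + 1) → Option α) (P : Fin (n + 1))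
    (h : f P = none) : (List.finRange (n + 1)).filterMap f =
      (List.finRange n).filterMap fun k => f (P.succAbove k) := by
  induction n with
  | zero =>
    rw [Fin.fin_one_eq_zero P] at h
    simp [List.finRange_succ, h]
  | succ n ih =>
    rw [List.finRange_succ]
    refine Fin.cases ?_ (fun P => ?_) P h
    · intro h
      rw [List.filterMap_cons_none h, List.filterMap_map]
      rfl
    · intro h
      have := ih (fun k => f k.succ) P h
      conv_rhs => rw [List.finRange_succ]
      rw [List.filterMap_cons, List.filterMap_cons, List.filterMap_map, List.filterMap_map]
      simp only [Function.comp_def, Fin.succ_succAbove_succ, Fin.succ_succAbove_zero]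
      rw [this]

theorem filterMap_finRange_some {α : Type*} {n : ℕ} (f : Fin (n + 1) → Option α) (P : Fin (n + 1))
    {x : α} (h : f P = some x) (h' : ∀ j, j < P → f j = none) :
    (List.finRange (n + 1)).filterMap f =
      x :: (List.finRange n).filterMap fun k => f (P.succAbove k) := by
  induction n with
  | zero =>
    rw [Fin.fin_one_eq_zero P] at h
    simp [List.finRange_succ, h]
  | succ n ih =>
    rw [List.finRange_succ]
    refine Fin.cases ?_ (fun P => ?_) P h h'
    · intro h _
      rw [List.filterMap_cons_some h, List.filterMap_map]
      rfl
    · intro h h'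
      have := ih (fun k => f k.succ) P h fun j hj => h' _ (Fin.succ_lt_succ_iff.mpr hj)
      have h0 := h' 0 (Fin.succ_pos _)
      conv_rhs => rw [List.finRange_succ]
      rw [List.filterMap_cons, List.filterMap_cons, List.filterMap_map, List.filterMap_map]
      simp only [Function.comp_def, Fin.succ_succAbove_succ, Fin.succ_succAbove_zero, h0]
      rw [this]

theorem length_fibreList {n r : ℕ} (lam : Fin n → Fin r) (u : Fin n → G) (i : Fin r) :
    (fibreList lam u i).length = ∑ k, if lam k = i then 1 else 0 := by
  induction n with
  | zero => simp [fibreList]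
  | succ n ih =>
    rw [Fin.sum_univ_succ, ← ih (fun k => lam k.succ) (fun k => u k.succ)]
    simp only [fibreList, List.finRange_succ, List.filterMap_cons, List.filterMap_map]
    split_ifs with h
    · simp [add_comm]
    · simp

/-- Both sides obey the same recursion on the first entry. Only the least element `P` of a fibre can
come first, and monotonicity of `lam` makes `P` equal to the total length of the earlier fibres, so
the signs agree. -/
theorem permSum_eq_itsh {n r : ℕ} {lam : Fin n → Fin r} (hl : Monotone lam) (u : Fin n → G)
    (a : List G → R) : permSum lam u a = itsh (fibreList lam u) a := by
  classical
  induction n generalizing a with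
  | zero =>
    rw [permSum_zero, itsh_nil]
    intro i
    simp [fibreList]
  | succ n ih =>
    rw [permSum_succ, itsh_eq_sum_hd]
    swap
    · refine ⟨lam 0, ?_⟩
      rw [fibreList, List.finRange_succ, List.filterMap_cons_some (b := u 0) (by simp)]
      simp
    -- Regroups the sum over `P` by the fibre in which `P` lies.
    have e : ∀ P : Fin (n + 1), ∀ F : R, (if ∀ j, j < P → lam j ≠ lam P then F else 0) =
        ∑ i, if lam P = i ∧ ∀ j, j < P → lam j ≠ i then F else 0 := by
      intro P F
      rw [Finset.sum_eq_single (lam P)]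
      · simp
      · intro i _ hi
        rw [if_neg fun h => hi h.1.symm]
      · simp
    simp only [e]
    rw [Finset.sum_comm]
    refine Finset.sum_congr rfl fun i _ => ?_
    by_cases hi : ∃ P, lam P = i
    · obtain ⟨P, hP, hmin⟩ : ∃ P, lam P = i ∧ ∀ j, j < P → lam j ≠ i := by
        refine ⟨Fin.find (fun k => lam k = i) hi, Fin.find_spec hi, fun j hj => Fin.find_min hi hj⟩
      rw [Finset.sum_eq_single P, if_pos ⟨hP, hmin⟩]
      · have e1 : fibreList lam u i = u P ::
            fibreList (fun k => lam (P.succAbove k)) (fun k => u (P.succAbove k)) i :=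
          filterMap_finRange_some _ P (by simp [hP]) fun j hj => by simp [hmin j hj]
        rw [e1, hd]
        have e2 : Function.update (fibreList lam u) i
            (fibreList (fun k => lam (P.succAbove k)) (fun k => u (P.succAbove k)) i) =
            fibreList (fun k => lam (P.succAbove k)) (fun k => u (P.succAbove k)) := by
          funext j
          by_cases hj : j = i
          · subst hj; simp
          · rw [Function.update_of_ne hj]
            refine filterMap_finRange_none _ P ?_
            rw [if_neg]
            rw [hP]; exact Ne.symm hj
        rw [e2, ih (lam := fun k => lam (P.succAbove k))
          (hl.comp (Fin.strictMono_succAbove P).monotone)]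
        congr 2
        have e3 : ∀ j, (if j < i then (fibreList lam u j).length else 0) =
            ∑ k, if lam k = j then (if j < i then 1 else 0) else 0 := by
          intro j
          rw [length_fibreList]
          split_ifs <;> simp
        simp only [e3]
        rw [Finset.sum_comm]
        simp only [Finset.sum_ite_eq, Finset.mem_univ, if_true]
        -- Since the fibres are consecutive and `P` begins its own, the indices below `P` are
        -- exactly those in earlier fibres.
        have e4 : ∀ k, lam k < i ↔ k < P := by
          intro k
          constructor
          · intro h
            by_contra h'
            exact absurd (hl (not_lt.mp h')) (by rw [hP]; exact not_le.mpr h)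
          · intro h
            exact lt_of_le_of_ne (hP ▸ hl h.le) (hmin k h)
        simp only [e4]
        have e5 : (Finset.univ.filter fun k => k < P) = Finset.Iio P := by ext; simp
        rw [Finset.sum_boole, e5, Fin.card_Iio, Nat.cast_id]
      · intro Q _ hQ
        rw [if_neg]
        rintro ⟨h1, h2⟩
        rcases lt_trichotomy P Q with h | h | h
        · exact h2 P h hP
        · exact hQ h.symm
        · exact hmin Q h h1
      · simp
    · push Not at hi
      have : fibreList lam u i = [] := by
        simp [fibreList, hi]
      rw [this]
      simp [hi, hd]

theorem fibreList_eq {n r m : ℕ} {lam : Fin n → Fin r} (u : Fin n → G) (i : Fin r)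
    {e : Fin m → Fin n} (he : StrictMono e) (h : ∀ k, lam k = i ↔ ∃ j, e j = k) :
    fibreList lam u i = List.ofFn fun j => u (e j) := by
  have e1 : fibreList lam u i = ((List.finRange n).filter fun k => lam k = i).map u := by
    simp only [fibreList]
    generalize List.finRange n = L
    induction L with
    | nil => rfl
    | cons x L ih => by_cases hx : lam x = i <;> simp [hx, ih]
  have e2 : ((List.finRange n).filter fun k => lam k = i) = List.ofFn e := by
    have h1 : ((List.finRange n).filter fun k => lam k = i).SortedLT :=
      ((List.sortedLT_finRange n).pairwise.filter _).sortedLT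
    exact h1.eq_of_mem_iff (List.sortedLT_ofFn_iff.mpr he) fun k => by simp [h]
  rw [e1, e2, List.map_ofFn]
  rfl

end Permutations

/-! ### Contraction of tuples with a prepended entry -/

section Contract

variable {M : Type*} (op : M → M → M)

theorem contractNth_zero_cons {n : ℕ} (x : M) (u : Fin (n + 1) → M) :
    Fin.contractNth 0 op (Fin.cons x u : Fin (n + 2) → M) =
      Fin.cons (op x (u 0)) (fun i => u i.succ) := by
  funext k
  refine Fin.cases ?_ (fun k => ?_) k
  · simp [Fin.contractNth]
  · simp [Fin.contractNth]

theorem contractNth_succ_cons {n : ℕ} (x : M) (u : Fin (n + 1) → M) (j : Fin (n + 1)) :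
    Fin.contractNth j.succ op (Fin.cons x u : Fin (n + 2) → M) =
      Fin.cons x (Fin.contractNth j op u) := by
  funext k
  refine Fin.cases ?_ (fun k => ?_) k
  · simp [Fin.contractNth]
  · simp only [Fin.contractNth, Fin.val_succ, Fin.cons_succ, Nat.add_lt_add_iff_right,
      Nat.add_right_cancel_iff]
    rfl

end Contract

/-! ### Extension of homogeneous cochains to lists -/

section OfLists

variable {R : Type v} [CommRing R] {G : Type u} [CommGroup G]

/-- The extension of a cochain of degree `n` to lists, by zero in the other degrees. -/
def toL {n : ℕ} (a : (Fin n → G) → R) : List G → R := fun l =>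
  if h : l.length = n then a fun i => l.get (i.cast h.symm) else 0

theorem toL_ofFn {n : ℕ} (a : (Fin n → G) → R) (u : Fin n → G) : toL a (List.ofFn u) = a u := by
  rw [toL, dif_pos (List.length_ofFn)]
  congr 1
  funext i
  simp

theorem toL_of_ne {n : ℕ} (a : (Fin n → G) → R) {l : List G} (h : l.length ≠ n) : toL a l = 0 :=
  dif_neg h

theorem exists_ofFn (l : List G) : ∃ u : Fin l.length → G, List.ofFn u = l :=
  ⟨l.get, List.ofFn_get l⟩

theorem dL_ofFn {n : ℕ} (b : List G → R) (u : Fin (n + 1) → G) :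
    dL b (List.ofFn u) = b (List.ofFn fun i => u i.succ) + ∑ j : Fin (n + 1),
      (-1 : R) ^ ((j : ℕ) + 1) * b (List.ofFn (Fin.contractNth j (· * ·) u)) := by
  induction n generalizing b with
  | zero => simp [dL_cons, mg_nil]
  | succ n ih =>
    obtain ⟨x, v, rfl⟩ : ∃ x v, u = Fin.cons x v := ⟨u 0, fun i => u i.succ,
      (Fin.cons_self_tail u).symm⟩
    have h := ih (pre x b) v
    rw [Fin.sum_univ_succ]
    simp only [contractNth_zero_cons, contractNth_succ_cons, Fin.val_zero, Fin.val_succ]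
    rw [List.ofFn_cons, dL_cons]
    rw [List.ofFn_succ, dL_cons] at h
    rw [List.ofFn_succ, mg_cons, List.ofFn_cons]
    simp only [Fin.cons_succ, List.ofFn_cons, List.ofFn_succ (f := v)]
    have e : ∑ j : Fin (n + 1), (-1 : R) ^ ((j : ℕ) + 1 + 1) *
        b (x :: List.ofFn (Fin.contractNth j (· * ·) v)) = - ∑ j : Fin (n + 1),
        (-1 : R) ^ ((j : ℕ) + 1) * pre x b (List.ofFn (Fin.contractNth j (· * ·) v)) := by
      rw [← Finset.sum_neg_distrib]
      refine Finset.sum_congr rfl fun j _ => ?_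
      rw [pre_apply, pow_succ _ ((j : ℕ) + 1)]
      ring
    rw [e]
    simp only [pre_apply] at h ⊢
    linear_combination -h

/-- The transfer of the list calculus to `d`; in lengths other than `n + 1` both sides vanish. -/
theorem toL_d {n : ℕ} (a : (Fin n → G) → R) : toL (d R G n a) = dL (toL a) := by
  funext l
  obtain ⟨u, hu⟩ := exists_ofFn l
  generalize l.length = k at u hu
  subst hu
  cases k with
  | zero =>
    rw [toL_of_ne _ (by simp)]
    simp [dL]
  | succ k =>
    rw [dL_ofFn]
    by_cases h : k = n
    · subst h
      rw [toL_ofFn]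
      simp only [toL_ofFn]
      rfl
    · rw [toL_of_ne _ (by simpa using h), toL_of_ne _ (by simpa using h)]
      simp [toL_of_ne, h]

theorem toL_kills {n : ℕ} {a : (Fin n → G) → R} (ha : a ∈ C R G n) : Kills {1} (toL a) := by
  rintro l ⟨z, hz, rfl⟩
  obtain ⟨u, hu⟩ := exists_ofFn l
  generalize l.length = k at u hu
  subst hu
  by_cases h : k = n
  · subst h
    rw [toL_ofFn]
    obtain ⟨i, hi⟩ := List.mem_ofFn.mp hz
    exact ha u ⟨i, hi⟩
  · exact toL_of_ne _ (by simpa using h)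

end OfLists

/-! ### The coefficients as evaluations on cycles -/

section Coefficient

variable {p r : ℕ} {G : Type u} [CommGroup G]

/-- The blocks follow each other, so the lexicographic order of pairs becomes the order of
positions. -/
theorem block_lt {ν : Fin r → ℕ} {n : ℕ} (h : ∑ i, ν i = n) {x y : Σ i, Fin (ν i)}
    (hxy : x.1 < y.1 ∨ x.1 = y.1 ∧ (x.2 : ℕ) < y.2) : block h x < block h y := by
  -- Extension by zero, so that the offset of a block is a sum over an initial range of naturals.
  let ν' : ℕ → ℕ := fun m => if h : m < r then ν ⟨m, h⟩ else 0
  have key : ∀ z : Σ i, Fin (ν i),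
      (block h z : ℕ) = ∑ m ∈ Finset.range z.1, ν' m + z.2 := by
    intro z
    rw [block, Equiv.trans_apply, finCongr_apply, Fin.val_cast, finSigmaFinEquiv_apply,
      Finset.sum_range]
    congr 1
    refine Finset.sum_congr rfl fun i _ => ?_
    have : (i : ℕ) < r := i.2.trans z.1.2
    simp only [ν', this, dif_pos]
    rfl
  rw [Fin.lt_def, key, key]
  rcases hxy with hlt | ⟨he, hlt⟩
  · have h1 : ∑ m ∈ Finset.range ((x.1 : ℕ) + 1), ν' m ≤ ∑ m ∈ Finset.range (y.1 : ℕ), ν' m :=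
      Finset.sum_le_sum_of_subset (Finset.range_subset_range.mpr hlt)
    rw [Finset.sum_range_succ] at h1
    have h2 : ν' (x.1 : ℕ) = ν x.1 := by simp [ν']
    have := x.2.2
    omega
  · have h1 : ∑ m ∈ Finset.range (x.1 : ℕ), ν' m = ∑ m ∈ Finset.range (y.1 : ℕ), ν' m := by rw [he]
    omega

theorem block_monotone {ν : Fin r → ℕ} {n : ℕ} (h : ∑ i, ν i = n) :
    Monotone fun j => ((block h).symm j).1 := by
  intro j j' hj
  by_contra hlt
  have := block_lt h (x := (block h).symm j') (y := (block h).symm j) (Or.inl (not_le.mp hlt))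
  simp only [Equiv.apply_symm_apply] at this
  exact absurd hj (not_le.mpr this)

theorem mem_Sh {ν : Fin r → ℕ} {n : ℕ} (h : ∑ i, ν i = n) (σ : Equiv.Perm (Fin n)) :
    σ ∈ Sh h ↔ IsSh (fun j => ((block h).symm j).1) σ := by
  simp only [Sh, Finset.mem_filter, Finset.mem_univ, true_and]
  constructor
  · intro H j j' hj hl
    obtain ⟨⟨i, x⟩, rfl⟩ := (block h).surjective j
    obtain ⟨⟨i', x'⟩, rfl⟩ := (block h).surjective j'
    simp only [Equiv.symm_apply_apply] at hl
    subst hl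
    refine H i x x' ?_
    by_contra hx
    rcases (not_lt.mp hx).lt_or_eq with hx | hx
    · exact absurd (block_lt h (x := ⟨i, x'⟩) (y := ⟨i, x⟩) (Or.inr ⟨rfl, hx⟩)) hj.asymm
    · subst hx; exact absurd hj (lt_irrefl _)
  · intro H i j j' hj
    exact H _ _ (block_lt h (Or.inr ⟨rfl, hj⟩)) (by simp)

theorem fibreList_concat (s : Fin r → G) {ν : Fin r → ℕ} {n : ℕ} (h : ∑ i, ν i = n)
    (q : (i : Fin r) → Fin (ν i / 2) → ℕ) (i : Fin r) :
    fibreList (fun j => ((block h).symm j).1) (concat s h q) i =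
      List.ofFn (sTuple (s i) (ν i) (q i)) := by
  rw [fibreList_eq (m := ν i) (e := fun j => block h ⟨i, j⟩)]
  · congr 1
    funext j
    simp only [concat]
    rw [Equiv.symm_apply_apply]
  · intro j j' hj
    exact block_lt h (Or.inr ⟨rfl, hj⟩)
  · intro k
    constructor
    · rintro rfl
      exact ⟨((block h).symm k).2, by simp⟩
    · rintro ⟨j, rfl⟩
      simp

/-- The sign of the coefficient. -/
def numSign (ν : Fin r → ℕ) : ZMod p := (-1) ^ (numOdd ν * (numOdd ν - 1) / 2)

theorem coeff_eq_sum (s : Fin r → G) {ν : Fin r → ℕ} {n : ℕ} (h : ∑ i, ν i = n)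
    (a : (Fin n → G) → ZMod p) : coeff s h a = numSign ν *
      ∑ q ∈ Fintype.piFinset fun i : Fin r =>
        Fintype.piFinset fun _ : Fin (ν i / 2) => Finset.Icc 1 (p - 1),
        itsh (fun i => List.ofFn (sTuple (s i) (ν i) (q i))) (toL a) := by
  classical
  rw [coeff, numSign, Finset.sum_comm]
  congr 1
  refine Finset.sum_congr rfl fun q _ => ?_
  have e : (fun i => List.ofFn (sTuple (s i) (ν i) (q i))) =
      fibreList (fun j => ((block h).symm j).1) (concat s h q) :=
    funext fun i => (fibreList_concat s h q i).symm
  rw [e, ← permSum_eq_itsh (block_monotone h), permSum, ← Finset.sum_filter]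
  have e2 : Sh h = Finset.univ.filter fun σ => IsSh (fun j => ((block h).symm j).1) σ := by
    ext σ
    simp [mem_Sh]
  rw [e2]
  refine Finset.sum_congr rfl fun σ _ => ?_
  rw [toL_ofFn, permAct]

/-- Multilinearity of the iterated slant product moves the sums over the `q_{i,j}` into the separate
blocks, where the cycle property is available. -/
theorem coeff_eq_itT (s : Fin r → G) {ν : Fin r → ℕ} {n : ℕ} (h : ∑ i, ν i = n)
    (a : (Fin n → G) → ZMod p) : coeff s h a = numSign ν *
      itT (fun i => blockChain p (ZMod p) (s i) (ν i)) (toL a) := by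
  rw [coeff_eq_sum]
  have : ∀ i, blockChain p (ZMod p) (s i) (ν i) = ∑ q ∈ Fintype.piFinset
      fun _ : Fin (ν i / 2) => Finset.Icc 1 (p - 1),
      LinearMap.proj (List.ofFn (sTuple (s i) (ν i) q)) := by
    intro i
    ext1 a
    rw [blockChain_eq_sum]
    simp
  simp only [this]
  rw [itT_sum]
  rfl

theorem coeff_eq_zero_of_mem_B (hp : 1 < p) {s : Fin r → G} (hs : ∀ i, s i ^ p = 1)
    {ν : Fin r → ℕ} {n : ℕ} (h : ∑ i, ν i = n) {a : (Fin n → G) → ZMod p}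
    (ha : a ∈ B (ZMod p) G n) : coeff s h a = 0 := by
  cases n with
  | zero =>
    have : a = 0 := ha
    subst this
    simp [coeff, permAct]
  | succ n =>
    obtain ⟨c, hc, rfl⟩ := ha
    rw [coeff_eq_itT, toL_d, itT_dL (fun i => isCycle_blockChain hp (hs i) (ν i)) (toL_kills hc),
      mul_zero]

/-- The coefficient as a linear functional. -/
def coeffL (s : Fin r → G) {ν : Fin r → ℕ} {n : ℕ} (h : ∑ i, ν i = n) :
    ((Fin n → G) → ZMod p) →ₗ[ZMod p] ZMod p where
  toFun a := coeff s h a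
  map_add' a b := by
    simp [coeff, permAct, mul_add, Finset.sum_add_distrib]
  map_smul' c a := by
    simp only [coeff, permAct, Pi.smul_apply, smul_eq_mul, RingHom.id_apply, Finset.mul_sum]
    refine Finset.sum_congr rfl fun _ _ => Finset.sum_congr rfl fun _ _ => ?_
    ring

end Coefficient

/-! ### The acyclic complex of cochains with values in the functions on the group -/

section Coinduced

variable {R : Type v} [CommRing R] {G : Type u} [CommGroup G]

/-- The coboundary on the cochains with values in the functions `G → R`. -/
def coD (n : ℕ) : (G → (Fin n → G) → R) →ₗ[R] (G → (Fin (n + 1) → G) → R) where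
  toFun F g u := F (g * u 0) (fun i => u i.succ) +
    ∑ j : Fin (n + 1), (-1 : R) ^ ((j : ℕ) + 1) * F g (Fin.contractNth j (· * ·) u)
  map_add' F F' := by
    funext g u
    simp only [Pi.add_apply, mul_add, Finset.sum_add_distrib]
    ring
  map_smul' c F := by
    funext g u
    simp only [Pi.smul_apply, smul_eq_mul, RingHom.id_apply, mul_add, Finset.mul_sum]
    congr 1
    exact Finset.sum_congr rfl fun j _ => by ring

theorem coD_apply {n : ℕ} (F : G → (Fin n → G) → R) (g : G) (u : Fin (n + 1) → G) :
    coD n F g u = F (g * u 0) (fun i => u i.succ) +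
      ∑ j : Fin (n + 1), (-1 : R) ^ ((j : ℕ) + 1) * F g (Fin.contractNth j (· * ·) u) := rfl

/-- The contracting homotopy. -/
def coH {n : ℕ} (F : G → (Fin (n + 1) → G) → R) : G → (Fin n → G) → R :=
  fun g u => F 1 (Fin.cons g u)

/-- Prepending `g` raises the index of every inner face by one, so these faces cancel in the two
terms. What remains is the face multiplying `1` by `g`, which gives back `F`. -/
theorem coD_coH {n : ℕ} (F : G → (Fin (n + 1) → G) → R) :
    coD n (coH F) + coH (coD (n + 1) F) = F := by
  funext g u
  have e1 : coH (coD (n + 1) F) g u = coD (n + 1) F 1 (Fin.cons g u) := rfl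
  rw [Pi.add_apply, Pi.add_apply, coD_apply, e1, coD_apply F, Fin.sum_univ_succ (n := n + 1)]
  simp only [contractNth_zero_cons, contractNth_succ_cons, Fin.cons_zero, Fin.cons_succ, one_mul,
    coH, Fin.val_zero, Fin.val_succ]
  have e : ∑ j : Fin (n + 1), (-1 : R) ^ ((j : ℕ) + 1 + 1) *
      F 1 (Fin.cons g (Fin.contractNth j (· * ·) u)) = - ∑ j : Fin (n + 1),
      (-1 : R) ^ ((j : ℕ) + 1) * F 1 (Fin.cons g (Fin.contractNth j (· * ·) u)) := by
    rw [← Finset.sum_neg_distrib]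
    refine Finset.sum_congr rfl fun j _ => ?_
    rw [pow_succ _ ((j : ℕ) + 1)]
    ring
  rw [e]
  ring

variable (R) in
/-- Translation by `h`. -/
def trans (n : ℕ) (h : G) : (G → (Fin n → G) → R) →ₗ[R] (G → (Fin n → G) → R) :=
  LinearMap.funLeft R _ fun g => h * g

theorem trans_apply {n : ℕ} (h : G) (F : G → (Fin n → G) → R) (g : G) :
    trans R n h F g = F (h * g) := rfl

theorem coD_trans {n : ℕ} (h : G) (F : G → (Fin n → G) → R) :
    coD n (trans R n h F) = trans R (n + 1) h (coD n F) := by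
  funext g u
  simp only [coD_apply, trans_apply, mul_assoc]

theorem coD_zero_apply (F : G → (Fin 0 → G) → R) (g : G) (u : Fin 1 → G) :
    coD 0 F g u = F (g * u 0) Fin.elim0 - F g Fin.elim0 := by
  rw [coD_apply, Fin.sum_univ_one, Subsingleton.elim (Fin.contractNth 0 _ u) Fin.elim0,
    Subsingleton.elim (fun i : Fin 0 => u i.succ) Fin.elim0]
  simp
  ring

/-- Writing `D` for `coD` and `H` for `coH`, substituting `H D F = F - D H F` into `D H (D F) + H D
(D F) = D F` and using induction for `D D (H F)` gives `H D D F = 0`. Thus `D D F` vanishes at `1`,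
and at all other points by translation. -/
theorem coD_coD {n : ℕ} (F : G → (Fin n → G) → R) : coD (n + 1) (coD n F) = 0 := by
  induction n with
  | zero =>
    funext g u
    rw [coD_apply, Fin.sum_univ_two]
    simp only [coD_zero_apply]
    simp [Fin.contractNth, mul_assoc]
  | succ n ih =>
    have key : ∀ F : G → (Fin (n + 1) → G) → R, ∀ v, coD (n + 2) (coD (n + 1) F) 1 v = 0 := by
      intro F v
      have h1 := coD_coH (coD (n + 1) F)
      have h2 := coD_coH F
      have h3 : coH (coD (n + 1) F) = F - coD n (coH F) := eq_sub_of_add_eq' h2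
      rw [h3, map_sub, ih, sub_zero] at h1
      have h4 : coH (coD (n + 2) (coD (n + 1) F)) = 0 := by simpa using h1
      have := congrFun (congrFun h4 (v 0)) fun i => v i.succ
      rwa [coH, show Fin.cons (v 0) (fun i => v i.succ) = v from Fin.cons_self_tail v] at this
    funext g v
    have := key (trans R _ g F) v
    rwa [coD_trans, coD_trans, trans_apply, mul_one] at this

/-- On cochains that are constant in the variable `g`, `coD` is `d`. -/
theorem d_d {n : ℕ} (a : (Fin n → G) → R) : d R G (n + 1) (d R G n a) = 0 := by
  have h := coD_coD (G := G) fun _ => a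
  funext u
  exact congrFun (congrFun h 1) u

variable (R G) in
/-- The normalized cochains with values in the functions `G → R`. -/
def coC (n : ℕ) : Submodule R (G → (Fin n → G) → R) where
  carrier := {F | ∀ g u, (∃ i, u i = 1) → F g u = 0}
  add_mem' ha hb g u hu := by simp [ha g u hu, hb g u hu]
  zero_mem' _ _ _ := rfl
  smul_mem' c a ha g u hu := by simp [ha g u hu]

theorem coH_mem {n : ℕ} {F : G → (Fin (n + 1) → G) → R} (hF : F ∈ coC R G (n + 1)) :
    coH F ∈ coC R G n :=
  fun _ _ ⟨i, hi⟩ => hF _ _ ⟨i.succ, by simpa using hi⟩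

theorem trans_mem {n : ℕ} {F : G → (Fin n → G) → R} (hF : F ∈ coC R G n) (h : G) :
    trans R n h F ∈ coC R G n :=
  fun _ _ hu => hF _ _ hu

theorem coD_mem {n : ℕ} {F : G → (Fin n → G) → R} (hF : F ∈ coC R G n) :
    coD n F ∈ coC R G (n + 1) := by
  induction n with
  | zero =>
    rintro g u ⟨i, hi⟩
    rw [coD_zero_apply]
    rw [Fin.fin_one_eq_zero i] at hi
    rw [hi, mul_one, sub_self]
  | succ n ih =>
    have key : ∀ F ∈ coC R G (n + 1), ∀ v : Fin (n + 2) → G, (∃ i, v i = 1) →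
        coD (n + 1) F 1 v = 0 := by
      intro F hF v hv
      obtain ⟨x, w, rfl⟩ : ∃ x w, v = Fin.cons x w := ⟨v 0, fun i => v i.succ,
        (Fin.cons_self_tail v).symm⟩
      have e : coD (n + 1) F 1 (Fin.cons x w) = F x w - coD n (coH F) x w :=
        eq_sub_of_add_eq' (congrFun (congrFun (coD_coH F) x) w)
      rw [e]
      obtain ⟨i, hi⟩ := hv
      induction i using Fin.cases with
      | zero =>
        have hx : x = 1 := by simpa using hi
        subst hx
        -- For `x = 1` the first face of `coH F` returns `F 1 w`, and every other face has the entry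
        -- `1` in front, hence vanishes by normalization.
        rw [coD_apply, Finset.sum_eq_zero, add_zero, one_mul, coH,
          show Fin.cons (w 0) (fun i => w i.succ) = w from Fin.cons_self_tail w, sub_self]
        intro j _
        rw [coH, hF _ _ ⟨0, rfl⟩, mul_zero]
      | succ i =>
        have hw : ∃ i, w i = 1 := ⟨i, by simpa using hi⟩
        rw [hF _ _ hw, ih (coH_mem hF) _ _ hw, sub_zero]
    intro g v hv
    have := key _ (trans_mem hF g) v hv
    rwa [coD_trans, trans_apply, mul_one] at this

end Coinduced

/-! ### Upper bounds for cohomology through long exact sequences -/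

section Detection

variable {k : Type v} [Field k] {G : Type u} [CommGroup G]

/-- A family of submodules of the cochains with values in the functions `G → k`. -/
abbrev Fam (k : Type v) [Field k] (G : Type u) : Type (max u v) :=
  ∀ n, Submodule k (G → (Fin n → G) → k)

/-- The coboundaries of a family. -/
def IsCob (Y : Fam k G) : (n : ℕ) → (G → (Fin n → G) → k) → Prop
  | 0, F => F = 0
  | n + 1, F => ∃ E ∈ Y n, coD n E = F

/-- The cohomology in degree `n` is detected by `m` linear functionals. -/
def Det (Y : Fam k G) (n m : ℕ) : Prop :=
  ∃ φ : (G → (Fin n → G) → k) →ₗ[k] (Fin m → k),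
    ∀ F ∈ Y n, coD n F = 0 → φ F = 0 → IsCob Y n F

/-- The kernel of `A` on a family. -/
def kerFam (Y : Fam k G) (A : ∀ n, (G → (Fin n → G) → k) →ₗ[k] (G → (Fin n → G) → k)) :
    Fam k G := fun n => Y n ⊓ LinearMap.ker (A n)

/-- Linear choices of preimages inside `Y`; the values of `σ` outside `f(Y)` are irrelevant. -/
theorem exists_section {V W : Type*} [AddCommGroup V] [Module k V] [AddCommGroup W] [Module k W]
    (f : V →ₗ[k] W) (Y : Submodule k V) :
    ∃ σ : W →ₗ[k] V, ∀ y ∈ Y, σ (f y) ∈ Y ∧ f (σ (f y)) = f y := by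
  let f' := f.domRestrict Y
  obtain ⟨g, hg⟩ := f'.rangeRestrict.exists_rightInverse_of_surjective
    (LinearMap.range_eq_top.mpr f'.surjective_rangeRestrict)
  obtain ⟨g', hg'⟩ := g.exists_extend
  refine ⟨Y.subtype.comp g', fun y hy => ?_⟩
  have h1 : f y ∈ LinearMap.range f' := ⟨⟨y, hy⟩, rfl⟩
  have h2 : g' (f y) = g ⟨f y, h1⟩ := LinearMap.congr_fun hg' ⟨f y, h1⟩
  refine ⟨(g' (f y)).2, ?_⟩
  have h3 := LinearMap.congr_fun hg ⟨f y, h1⟩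
  have h4 := congrArg Subtype.val h3
  rw [LinearMap.comp_apply, h2]
  exact h4

theorem det_kerFam_zero {Y : Fam k G}
    (A : ∀ n, (G → (Fin n → G) → k) →ₗ[k] (G → (Fin n → G) → k)) {m : ℕ} (h : Det Y 0 m) :
    Det (kerFam Y A) 0 m := by
  obtain ⟨φ, hφ⟩ := h
  exact ⟨φ, fun F hF => hφ F hF.1⟩

/-- This is the exactness of `H^n(ker B) → H^{n+1}(ker A) → H^{n+1}(Y)` for the short exact sequence
`0 → ker A → Y → ker B → 0` whose second map is `A`. -/
theorem det_kerFam_succ {Y : Fam k G}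
    (hY : ∀ n, ∀ F ∈ Y n, coD n F ∈ Y (n + 1))
    {A B : ∀ n, (G → (Fin n → G) → k) →ₗ[k] (G → (Fin n → G) → k)}
    (hAY : ∀ n, ∀ F ∈ Y n, A n F ∈ Y n)
    (hAD : ∀ n F, coD n (A n F) = A (n + 1) (coD n F))
    (hBA : ∀ n F, B n (A n F) = 0)
    (hex : ∀ n, ∀ F ∈ Y n, B n F = 0 → ∃ E ∈ Y n, A n E = F)
    {n m m' : ℕ} (h : Det Y (n + 1) m) (h' : Det (kerFam Y B) n m') :
    Det (kerFam Y A) (n + 1) (m + m') := by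
  obtain ⟨φ, hφ⟩ := h
  obtain ⟨ψ, hψ⟩ := h'
  obtain ⟨σ, hσ⟩ := exists_section (coD n) (Y n)
  let e : ((Fin m → k) × (Fin m' → k)) ≃ₗ[k] (Fin (m + m') → k) :=
    LinearEquiv.ofFinrankEq _ _ (by simp)
  -- The second component inverts the connecting map: a primitive `σ F` of `F` in `Y` is sent by `A`
  -- to a cocycle of `ker B`. If that is the coboundary of `A E'`, subtracting the coboundary of
  -- `E'` moves the primitive into `ker A`.
  refine ⟨e.toLinearMap.comp (φ.prod (ψ.comp ((A n).comp σ))), fun F hF hDF h0 => ?_⟩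
  have h0' : (φ F, ψ (A n (σ F))) = 0 := e.map_eq_zero_iff.mp h0
  obtain ⟨h1, h2⟩ := Prod.mk_eq_zero.mp h0'
  obtain ⟨E, hE, rfl⟩ := hφ F hF.1 hDF h1
  obtain ⟨hs1, hs2⟩ := hσ E hE
  have hA0 : A (n + 1) (coD n E) = 0 := hF.2
  have hc := hψ (A n (σ (coD n E))) ⟨hAY _ _ hs1, hBA _ _⟩ (by rw [hAD, hs2, hA0]) h2
  cases n with
  | zero => exact ⟨_, ⟨hs1, hc⟩, hs2⟩
  | succ n =>
    obtain ⟨J, hJ, hJA⟩ := hc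
    obtain ⟨E', hE', rfl⟩ := hex _ J hJ.1 hJ.2
    refine ⟨σ (coD (n + 1) E) - coD n E', ⟨Submodule.sub_mem _ hs1 (hY _ _ hE'), ?_⟩, ?_⟩
    · change A (n + 1) _ = 0
      rw [map_sub, ← hJA, hAD, sub_self]
    · rw [map_sub, hs2, coD_coD, sub_zero]

/-- The two short exact sequences, with `A` and `B` exchanged, feed each other: each step lowers the
degree by one and adds one value of `N`, until degree zero, where the kernel inherits detection from
`Y`. -/
theorem det_kerFam {Y : Fam k G}
    (hY : ∀ n, ∀ F ∈ Y n, coD n F ∈ Y (n + 1))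
    {A B : ∀ n, (G → (Fin n → G) → k) →ₗ[k] (G → (Fin n → G) → k)}
    (hAY : ∀ n, ∀ F ∈ Y n, A n F ∈ Y n) (hBY : ∀ n, ∀ F ∈ Y n, B n F ∈ Y n)
    (hAD : ∀ n F, coD n (A n F) = A (n + 1) (coD n F))
    (hBD : ∀ n F, coD n (B n F) = B (n + 1) (coD n F))
    (hBA : ∀ n F, B n (A n F) = 0) (hAB : ∀ n F, A n (B n F) = 0)
    (hA : ∀ n, ∀ F ∈ Y n, A n F = 0 → ∃ E ∈ Y n, B n E = F)
    (hB : ∀ n, ∀ F ∈ Y n, B n F = 0 → ∃ E ∈ Y n, A n E = F)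
    {N : ℕ → ℕ} (h : ∀ n, Det Y n (N n)) (n : ℕ) :
    Det (kerFam Y A) n (∑ m ∈ Finset.range (n + 1), N m) ∧
      Det (kerFam Y B) n (∑ m ∈ Finset.range (n + 1), N m) := by
  induction n with
  | zero =>
    rw [Finset.sum_range_one]
    exact ⟨det_kerFam_zero A (h 0), det_kerFam_zero B (h 0)⟩
  | succ n ih =>
    rw [Finset.sum_range_succ, add_comm (∑ m ∈ _, _)]
    exact ⟨det_kerFam_succ hY hAY hAD hBA hB (h _) ih.2,
      det_kerFam_succ hY hBY hBD hAB hA (h _) ih.1⟩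

/-- The homotopy kills positive degrees, and a cocycle of degree zero is determined by its value at
`1`. -/
theorem det_coC (n : ℕ) : Det (fun n => coC k G n) n (if n = 0 then 1 else 0) := by
  cases n with
  | zero =>
    refine ⟨LinearMap.pi fun _ =>
      (LinearMap.proj (Fin.elim0 : Fin 0 → G) : ((Fin 0 → G) → k) →ₗ[k] k).comp
        (LinearMap.proj (1 : G)), fun F _ hD h0 => ?_⟩
    funext g u
    have h1 := congrFun (congrFun hD 1) fun _ => g
    rw [coD_zero_apply, one_mul] at h1
    have h2 : F 1 Fin.elim0 = 0 := congrFun h0 (0 : Fin 1)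
    rw [h2, sub_zero] at h1
    rw [Subsingleton.elim u Fin.elim0]
    exact h1
  | succ n =>
    refine ⟨0, fun F hF hD _ => ⟨coH F, coH_mem hF, ?_⟩⟩
    have h := coD_coH F
    have e : coH (coD (n + 1) F) = 0 := by rw [hD]; rfl
    rwa [e, add_zero] at h

end Detection

/-! ### Imposing invariance under the basis elements one at a time -/

section Invariants

variable {p : ℕ} [Fact p.Prime] {k : Type v} [Field k] {G : Type u} [CommGroup G]

/-- The operator `s - 1`. -/
def opT (k : Type v) [Field k] (s : G) (n : ℕ) :
    (G → (Fin n → G) → k) →ₗ[k] (G → (Fin n → G) → k) := trans k n s - LinearMap.id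

/-- The norm operator `1 + s + ⋯ + s ^ (p - 1)`. -/
def opN (p : ℕ) (k : Type v) [Field k] (s : G) (n : ℕ) :
    (G → (Fin n → G) → k) →ₗ[k] (G → (Fin n → G) → k) :=
  ∑ q ∈ Finset.range p, trans k n (s ^ q)

theorem opT_apply (s : G) {n : ℕ} (F : G → (Fin n → G) → k) (g : G) (u : Fin n → G) :
    opT k s n F g u = F (s * g) u - F g u := rfl

theorem opN_apply (s : G) {n : ℕ} (F : G → (Fin n → G) → k) (g : G) (u : Fin n → G) :
    opN p k s n F g u = ∑ q ∈ Finset.range p, F (s ^ q * g) u := by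
  simp [opN, trans_apply]

theorem coD_opT (s : G) (n : ℕ) (F : G → (Fin n → G) → k) :
    coD n (opT k s n F) = opT k s (n + 1) (coD n F) := by
  simp [opT, coD_trans]

theorem coD_opN (s : G) (n : ℕ) (F : G → (Fin n → G) → k) :
    coD n (opN p k s n F) = opN p k s (n + 1) (coD n F) := by
  simp [opN, coD_trans]

theorem sum_range_shift {M : Type*} [AddCommGroup M] {s : G} (hs : s ^ p = 1) (f : G → M) (g : G) :
    ∑ q ∈ Finset.range p, f (s ^ q * (s * g)) = ∑ q ∈ Finset.range p, f (s ^ q * g) := by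
  have h1 := Finset.sum_range_succ (fun q => f (s ^ q * g)) p
  have h2 := Finset.sum_range_succ' (fun q => f (s ^ q * g)) p
  rw [h1] at h2
  simp only [hs, pow_zero, one_mul, add_left_inj] at h2
  rw [h2]
  exact Finset.sum_congr rfl fun q _ => by rw [pow_succ, mul_assoc]

theorem opN_opT {s : G} (hs : s ^ p = 1) (n : ℕ) (F : G → (Fin n → G) → k) :
    opN p k s n (opT k s n F) = 0 := by
  funext g u
  simp only [opN_apply, opT_apply, Finset.sum_sub_distrib]
  have := sum_range_shift hs (fun x => F x u) g
  simp only [mul_left_comm _ s g] at this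
  rw [this, sub_self]
  rfl

theorem opT_opN {s : G} (hs : s ^ p = 1) (n : ℕ) (F : G → (Fin n → G) → k) :
    opT k s n (opN p k s n F) = 0 := by
  funext g u
  simp only [opN_apply, opT_apply]
  rw [sum_range_shift hs (fun x => F x u) g, sub_self]
  rfl

variable (k) in
/-- The normalized cochains that are invariant under the elements of `S`. -/
def inv (S : Set G) : Fam k G := fun n =>
  coC k G n ⊓ ⨅ h ∈ S, LinearMap.ker (opT k h n)

theorem mem_inv {S : Set G} {n : ℕ} {F : G → (Fin n → G) → k} :
    F ∈ inv k S n ↔ F ∈ coC k G n ∧ ∀ h ∈ S, ∀ g u, F (h * g) u = F g u := by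
  simp only [inv, Submodule.mem_inf, Submodule.mem_iInf, LinearMap.mem_ker]
  refine and_congr_right fun _ => forall₂_congr fun h _ => ?_
  constructor
  · intro H g u
    exact sub_eq_zero.mp (congrFun (congrFun H g) u)
  · intro H
    funext g u
    exact sub_eq_zero.mpr (H g u)

theorem coD_mem_inv {S : Set G} {n : ℕ} {F : G → (Fin n → G) → k} (hF : F ∈ inv k S n) :
    coD n F ∈ inv k S (n + 1) := by
  rw [mem_inv] at hF ⊢
  refine ⟨coD_mem hF.1, fun h hh g u => ?_⟩
  simp only [coD_apply, mul_assoc, hF.2 h hh]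

theorem trans_mem_inv {S : Set G} {n : ℕ} {F : G → (Fin n → G) → k} (hF : F ∈ inv k S n) (s : G) :
    trans k n s F ∈ inv k S n := by
  rw [mem_inv] at hF ⊢
  refine ⟨trans_mem hF.1 s, fun h hh g u => ?_⟩
  rw [trans_apply, trans_apply, mul_left_comm, hF.2 h hh]

theorem opT_mem_inv {S : Set G} {n : ℕ} {F : G → (Fin n → G) → k} (hF : F ∈ inv k S n) (s : G) :
    opT k s n F ∈ inv k S n :=
  Submodule.sub_mem _ (trans_mem_inv hF s) hF

theorem opN_mem_inv {S : Set G} {n : ℕ} {F : G → (Fin n → G) → k} (hF : F ∈ inv k S n) (s : G) :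
    opN p k s n F ∈ inv k S n := by
  rw [opN, LinearMap.sum_apply]
  exact Submodule.sum_mem _ fun q _ => trans_mem_inv hF _

theorem kerFam_inv (S : Set G) (s : G) (n : ℕ) :
    kerFam (inv k S) (opT k s) n = inv k (insert s S) n := by
  simp only [kerFam, inv, iInf_insert]
  rw [inf_assoc, inf_comm (⨅ h ∈ S, _)]

/-- The function `c` is a coordinate along `s`. Cutting `F` off outside the slice `c = 0` gives `E`;
among the `p` translates in the norm exactly one meets the slice, and there `F` takes the value `F g
u` by invariance. -/
theorem exists_opN_eq {S : Set G} {s : G} {c : G → ZMod p}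
    (hcs : ∀ g, c (s * g) = c g + 1) (hcS : ∀ h ∈ S, ∀ g, c (h * g) = c g) {n : ℕ}
    {F : G → (Fin n → G) → k} (hF : F ∈ inv k S n) (h0 : opT k s n F = 0) :
    ∃ E ∈ inv k S n, opN p k s n E = F := by
  rw [mem_inv] at hF
  refine ⟨fun g u => if c g = 0 then F g u else 0, mem_inv.mpr ⟨fun g u hu => ?_,
    fun h hh g u => ?_⟩, ?_⟩
  · simp [hF.1 g u hu]
  · simp only [hcS h hh, hF.2 h hh]
  · funext g u
    rw [opN_apply]
    have hFs : ∀ q : ℕ, F (s ^ q * g) u = F g u := by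
      intro q
      induction q with
      | zero => simp
      | succ q ih =>
        rw [pow_succ', mul_assoc, ← ih]
        exact sub_eq_zero.mp (congrFun (congrFun h0 (s ^ q * g)) u)
    have hcq : ∀ q : ℕ, c (s ^ q * g) = c g + q := by
      intro q
      induction q with
      | zero => simp
      | succ q ih =>
        rw [pow_succ', mul_assoc, hcs, ih]
        push_cast
        ring
    simp only [hFs, hcq]
    rw [Finset.sum_eq_single (-(c g)).val]
    · simp
    · intro q hq hne
      rw [if_neg]
      intro h
      refine hne ?_
      rw [← eq_neg_of_add_eq_zero_right h, ZMod.val_cast_of_lt (Finset.mem_range.mp hq)]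
    · intro h
      exact absurd (Finset.mem_range.mpr (ZMod.val_lt _)) h

/-- The function `E` is a discrete integral of `F` along each `s`-orbit, starting at the slice `c =
0`. Its difference is `F` by telescoping, and the integral closes up around the orbit because the
norm of `F` is zero. -/
theorem exists_opT_eq {S : Set G} {s : G} {c : G → ZMod p}
    (hcs : ∀ g, c (s * g) = c g + 1) (hcS : ∀ h ∈ S, ∀ g, c (h * g) = c g) {n : ℕ}
    {F : G → (Fin n → G) → k} (hF : F ∈ inv k S n) (h0 : opN p k s n F = 0) :
    ∃ E ∈ inv k S n, opT k s n E = F := by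
  rw [mem_inv] at hF
  refine ⟨fun g u => ∑ q ∈ Finset.range (c g).val, F (s⁻¹ ^ (q + 1) * g) u, mem_inv.mpr
    ⟨fun g u hu => ?_, fun h hh g u => ?_⟩, ?_⟩
  · exact Finset.sum_eq_zero fun q _ => hF.1 _ u hu
  · simp only [hcS h hh, mul_left_comm _ h, hF.2 h hh]
  · funext g u
    rw [opT_apply]
    have e : ∀ q : ℕ, s⁻¹ ^ (q + 1) * (s * g) = s⁻¹ ^ q * g := by
      intro q
      rw [pow_succ]
      group
    simp only [hcs, e]
    by_cases h : (c g).val + 1 < p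
    · rw [ZMod.val_add_of_lt (by rwa [ZMod.val_one]), ZMod.val_one, Finset.sum_range_succ']
      simp
    -- The wrap-around: `s * g` lies in the slice, so its sum is empty, and the full orbit sum must
    -- be used.
    · have hv : (c g).val + 1 = p := by have := ZMod.val_lt (c g); omega
      have h1 : c g + 1 = 0 := by
        rw [← ZMod.natCast_zmod_val (c g), ← Nat.cast_one, ← Nat.cast_add, hv, ZMod.natCast_self]
      rw [h1, ZMod.val_zero, Finset.range_zero, Finset.sum_empty, zero_sub]
      have h2 : ∑ q ∈ Finset.range p, F (s⁻¹ ^ q * g) u = 0 := by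
        -- The norm is taken at `s⁻¹ ^ (p - 1) * g` and summed in reverse, which turns positive
        -- powers of `s` into the negative ones of `E`.
        have h3 := congrFun (congrFun h0 (s⁻¹ ^ (p - 1) * g)) u
        rw [opN_apply, ← Finset.sum_range_reflect] at h3
        have h4 : _ = (0 : k) := h3
        rw [← h4]
        refine Finset.sum_congr rfl fun q hq => ?_
        congr 1
        have hq' : q ≤ p - 1 := by have := Finset.mem_range.mp hq; omega
        obtain ⟨t, ht⟩ := Nat.exists_eq_add_of_le hq'
        rw [ht, Nat.add_sub_cancel_left, ← mul_assoc, pow_add, mul_left_comm, ← mul_pow]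
        simp
      rw [← hv, Finset.sum_range_succ'] at h2
      simp only [pow_zero, one_mul] at h2
      exact neg_eq_of_add_eq_zero_right h2

theorem det_inv_insert {S : Set G} {s : G} (hs : s ^ p = 1) {c : G → ZMod p}
    (hcs : ∀ g, c (s * g) = c g + 1) (hcS : ∀ h ∈ S, ∀ g, c (h * g) = c g)
    {N : ℕ → ℕ} (h : ∀ n, Det (inv k S) n (N n)) (n : ℕ) :
    Det (inv k (insert s S)) n (∑ m ∈ Finset.range (n + 1), N m) := by
  have e : inv k (insert s S) = kerFam (inv k S) (opT k s) :=
    funext fun n => (kerFam_inv S s n).symm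
  rw [e]
  exact (det_kerFam (B := opN p k s) (fun n F hF => coD_mem_inv hF)
    (fun n F hF => opT_mem_inv hF s) (fun n F hF => opN_mem_inv hF s) (coD_opT s) (coD_opN s)
    (opN_opT hs) (opT_opN hs) (fun n F hF h0 => exists_opN_eq hcs hcS hF h0)
    (fun n F hF h0 => exists_opT_eq hcs hcS hF h0) h n).1

/-- The number of monomials of degree `n` in `i` variables. -/
def cnt : ℕ → ℕ → ℕ
  | 0, n => if n = 0 then 1 else 0
  | i + 1, n => ∑ m ∈ Finset.range (n + 1), cnt i m

variable {r : ℕ} [Module (ZMod p) (Additive G)]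

theorem pow_eq_one (g : G) : g ^ p = 1 := by
  have h : (p : ZMod p) • Additive.ofMul g = 0 := by rw [ZMod.natCast_self, zero_smul]
  rw [Nat.cast_smul_eq_nsmul, ← ofMul_pow] at h
  exact ofMul_eq_zero.mp h

/-- The coordinate of the new basis element serves as `c`: it grows by one along that element and is
unchanged by the earlier ones. -/
theorem det_inv (b : Module.Basis (Fin r) (ZMod p) (Additive G)) (i : ℕ) (hi : i ≤ r) (n : ℕ) :
    Det (inv k {g : G | ∃ j : Fin r, (j : ℕ) < i ∧ g = (b j).toMul}) n (cnt i n) := by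
  induction i generalizing n with
  | zero =>
    have e : inv k {g : G | ∃ j : Fin r, (j : ℕ) < 0 ∧ g = (b j).toMul} = fun n => coC k G n := by
      funext n
      simp [inv]
    rw [e]
    exact det_coC n
  | succ i ih =>
    have e : {g : G | ∃ j : Fin r, (j : ℕ) < i + 1 ∧ g = (b j).toMul} =
        insert (b ⟨i, hi⟩).toMul {g : G | ∃ j : Fin r, (j : ℕ) < i ∧ g = (b j).toMul} := by
      ext g
      simp only [Set.mem_ofPred_eq, Set.mem_insert_iff]
      constructor
      · rintro ⟨j, hj, rfl⟩
        rcases Nat.lt_succ_iff_lt_or_eq.mp hj with h | h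
        · exact Or.inr ⟨j, h, rfl⟩
        · left
          congr 2
          exact Fin.ext h
      · rintro (rfl | ⟨j, hj, rfl⟩)
        · exact ⟨_, Nat.lt_succ_self i, rfl⟩
        · exact ⟨j, by omega, rfl⟩
    rw [e]
    refine det_inv_insert (pow_eq_one _) (c := fun g => b.coord ⟨i, hi⟩ (Additive.ofMul g))
      ?_ ?_ (ih (by omega)) n
    · intro g
      simp [ofMul_mul, add_comm]
    · rintro h ⟨j, hj, rfl⟩ g
      have : j ≠ ⟨i, hi⟩ := by rintro rfl; simp at hj
      simp [ofMul_mul, this]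

/-- The translations fixing `F` form a subgroup of an `𝔽_p`-module, hence a subspace, and it
contains the basis. -/
theorem eq_of_mem_inv (b : Module.Basis (Fin r) (ZMod p) (Additive G)) {n : ℕ}
    {F : G → (Fin n → G) → k}
    (hF : F ∈ inv k {g : G | ∃ j : Fin r, (j : ℕ) < r ∧ g = (b j).toMul} n) (g : G)
    (u : Fin n → G) : F g u = F 1 u := by
  rw [mem_inv] at hF
  let W : AddSubgroup (Additive G) :=
    { carrier := {h | ∀ g u, F (h.toMul * g) u = F g u}
      zero_mem' := fun g u => by simp
      add_mem' := fun {x y} hx hy g u => by rw [toMul_add, mul_assoc, hx, hy]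
      neg_mem' := fun {x} hx g u => by
        rw [← hx, toMul_neg, mul_inv_cancel_left] }
  have hW : (⊤ : Submodule (ZMod p) (Additive G)) ≤ AddSubgroup.toZModSubmodule p W := by
    rw [← b.span_eq, Submodule.span_le]
    rintro _ ⟨j, rfl⟩
    exact fun g u => hF.2 _ ⟨j, j.2, rfl⟩ g u
  have h := hW (Submodule.mem_top (x := Additive.ofMul g))
  have h' : ∀ g' u, F (g * g') u = F g' u := h
  simpa using h' 1 u

/-- The cohomology in degree `n` is detected by as many functionals as there are monomials. -/
theorem exists_detecting (b : Module.Basis (Fin r) (ZMod p) (Additive G)) (n : ℕ) :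
    ∃ φ : ((Fin n → G) → k) →ₗ[k] (Fin (cnt r n) → k),
      ∀ a ∈ Z k G n, φ a = 0 → a ∈ B k G n := by
  obtain ⟨φ, hφ⟩ := det_inv (k := k) b r le_rfl n
  refine ⟨φ.comp (LinearMap.pi fun _ => LinearMap.id), fun a ha h0 => ?_⟩
  have h := hφ (fun _ => a) (mem_inv.mpr ⟨fun g u hu => ha.1 u hu, fun _ _ _ _ => rfl⟩) (by
    funext g u
    exact congrFun (LinearMap.mem_ker.mp ha.2) u) h0
  cases n with
  | zero => exact congrFun h 1
  | succ n =>
    obtain ⟨E, hE, hD⟩ := h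
    -- The primitive `E` is invariant under all of `G`, so it is constant in its first variable and
    -- is an ordinary cochain.
    refine ⟨E 1, fun u hu => (mem_inv.mp hE).1 1 u hu, ?_⟩
    funext u
    have := congrFun (congrFun hD 1) u
    rw [coD_apply, eq_of_mem_inv b hE] at this
    exact this

end Invariants

/-! ### Products of representing cocycles and commutation in low degrees -/

section Representatives

variable {R : Type v} [CommRing R] {G : Type u} [CommGroup G]

theorem conv_append {f g : List G → R} : {w w' : List G} →
    (∀ l, l.length ≠ w.length → f l = 0) → conv f g (w ++ w') = f w * g w'
  | [], [], _ => rfl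
  | [], x :: w', hf => by
    have h : pre x f = 0 := funext fun l => hf _ (by simp)
    rw [List.nil_append, ← pre_apply x (conv f g), pre_conv, h, zero_conv]
    simp
  | x :: w, w', hf => by
    have h : f [] = 0 := hf _ (by simp)
    rw [List.cons_append, ← pre_apply x (conv f g), pre_conv, h, zero_smul, add_zero,
      conv_append (f := pre x f) fun l hl => hf _ (by simpa using hl)]
    rfl

theorem conv_eq_zero_of_length_lt {f g : List G → R} {w : List G}
    (hf : ∀ l, l.length ≤ w.length → f l = 0) : conv f g w = 0 := by
  induction w generalizing f with
  | nil => rw [conv_nil, hf _ le_rfl, zero_mul]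
  | cons x w ih =>
    rw [← pre_apply x (conv f g), pre_conv, hf [] (by simp), zero_smul, add_zero]
    exact ih fun l hl => hf _ (by simpa using hl)

theorem toL_prodC {m n : ℕ} (a : (Fin m → G) → R) (b : (Fin n → G) → R) :
    toL (prodC a b) = conv (toL a) (toL b) := by
  funext w
  by_cases hm : m ≤ w.length
  · rw [← List.take_append_drop m w, conv_append]
    swap
    · intro l hl
      exact toL_of_ne _ (by rwa [List.length_take_of_le hm] at hl)
    obtain ⟨u, hu⟩ := exists_ofFn (w.take m)
    obtain ⟨u', hu'⟩ := exists_ofFn (w.drop m)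
    have h1 : (w.take m).length = m := List.length_take_of_le hm
    generalize (w.take m).length = k at u hu h1
    generalize (w.drop m).length = k' at u' hu'
    subst h1
    rw [← hu, ← hu', toL_ofFn, ← List.ofFn_fin_append]
    by_cases hn : k' = n
    · subst hn
      rw [toL_ofFn, toL_ofFn]
      simp [prodC]
    · rw [toL_of_ne _ (by simpa using hn), toL_of_ne b (by simpa using hn), mul_zero]
  · rw [toL_of_ne _ (by omega), conv_eq_zero_of_length_lt]
    intro l hl
    exact toL_of_ne _ (by omega)

theorem toL_smul {n : ℕ} (c : R) (a : (Fin n → G) → R) : toL (c • a) = c • toL a := by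
  funext w
  by_cases h : w.length = n
  · simp [toL, h]
  · simp [toL_of_ne _ h]

/-- The class `ξ` of degree `n` is represented by a cocycle whose extension to lists is `f`. -/
def Rep (n : ℕ) (f : List G → R) (ξ : HStar R G) : Prop :=
  ∃ a : Z R G n, ξ = DirectSum.of (H R G) n (cls a) ∧ toL a.1 = f

theorem Rep.congr {n n' : ℕ} {f f' : List G → R} {ξ : HStar R G} (h : Rep n f ξ) (hn : n = n')
    (hf : f = f') : Rep n' f' ξ := by
  subst hn; subst hf; exact h

theorem Rep.eq_zero {n : ℕ} {f : List G → R} {ξ : HStar R G} (h : Rep n f ξ) {w : List G}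
    (hw : w.length ≠ n) : f w = 0 := by
  obtain ⟨a, -, rfl⟩ := h
  exact toL_of_ne _ hw

theorem Rep.mul {m n : ℕ} {f g : List G → R} {ξ ζ : HStar R G} (h : Rep m f ξ) (h' : Rep n g ζ) :
    Rep (m + n) (((-1 : R) ^ (m * n)) • conv f g) (ξ * ζ) := by
  obtain ⟨a, rfl, rfl⟩ := h
  obtain ⟨b, rfl, rfl⟩ := h'
  exact ⟨cupZ m n a b, DirectSum.of_mul_of _ _, by rw [← toL_prodC, ← toL_smul]; rfl⟩

theorem Rep.one : Rep 0 (fun w : List G => if w = [] then (1 : R) else 0) 1 := by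
  refine ⟨constZ 1, rfl, ?_⟩
  funext w
  cases w with
  | nil => rfl
  | cons x w => rw [toL_of_ne _ (by simp)]; simp

/-- The two products live in degrees `m + n` and `n + m`, so the cochains are compared after a cast.
-/
theorem of_mul_of_comm {m n : ℕ} (a : Z R G m) (b : Z R G n)
    (h : ∀ hmn : m + n = n + m, (fun u => (cupZ m n a b).1 u - (cupZ n m b a).1
      (fun i => u (i.cast hmn.symm))) ∈ B R G (m + n)) :
    Commute (DirectSum.of (H R G) m (cls a)) (DirectSum.of (H R G) n (cls b)) := by
  have hmn : n + m = m + n := Nat.add_comm n m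
  rw [Commute, SemiconjBy, DirectSum.of_mul_of, DirectSum.of_mul_of]
  have key : ∀ (N : ℕ) (e : N = m + n) (y : Z R G N),
      (fun u => (cupZ m n a b).1 u - y.1 (fun i => u (i.cast e))) ∈ B R G (m + n) →
      DirectSum.of (H R G) (m + n) (cls (cupZ m n a b)) = DirectSum.of (H R G) N (cls y) := by
    intro N e y hy
    subst e
    congr 1
    exact cls_eq.mpr hy
  exact key _ hmn _ (h hmn.symm)

theorem res_two (g : ℕ → G) : res 2 g = ![g 0, g 1] := by
  funext i
  fin_cases i <;> rfl

theorem res_one (g : ℕ → G) : res 1 g = ![g 0] := by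
  funext i
  fin_cases i; rfl

theorem Z.two_cocycle (b : Z R G 2) (x y z : G) :
    b.1 ![y, z] - b.1 ![x * y, z] + b.1 ![x, y * z] - b.1 ![x, y] = 0 := by
  have h := congrFun (Z.d_eq b) (res 3 fun k => if k = 0 then x else if k = 1 then y else z)
  rw [d_res] at h
  simp only [Finset.sum_range_succ, Finset.sum_range_zero, res_two] at h
  simp [ctr] at h
  linear_combination h

theorem Z.one_cocycle (a : Z R G 1) (x y : G) : a.1 ![x * y] = a.1 ![x] + a.1 ![y] := by
  have h := congrFun (Z.d_eq a) (res 2 fun k => if k = 0 then x else y)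
  rw [d_res] at h
  simp only [Finset.sum_range_succ, Finset.sum_range_zero, res_one] at h
  simp [ctr] at h
  linear_combination -h

theorem Z.two_one_left (b : Z R G 2) (x : G) : b.1 ![1, x] = 0 := b.2.1 _ ⟨0, rfl⟩

theorem Z.two_one_right (b : Z R G 2) (x : G) : b.1 ![x, 1] = 0 := b.2.1 _ ⟨1, rfl⟩

theorem commute_one_two (a : Z R G 1) (b : Z R G 2) :
    Commute (DirectSum.of (H R G) 1 (cls a)) (DirectSum.of (H R G) 2 (cls b)) := by
  refine of_mul_of_comm a b fun hmn => ?_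
  -- Up to sign this is the Steenrod product `a ∪₁ b`.
  refine mem_B (m := 2) rfl (c := fun u => -(b.1 ![u 0, u 1] * (a.1 ![u 0 * u 1]))) ?_ ?_
  · rintro u ⟨i, hi⟩
    fin_cases i
    · have h : u 0 = 1 := hi
      simp [h, Z.two_one_left b]
    · have h : u 1 = 1 := hi
      simp [h, Z.two_one_right b]
  · intro g
    rw [d_res, cupZ_res]
    have e : (fun i => res (1 + 2) g (i.cast hmn.symm)) = res (2 + 1) g := rfl
    rw [e, cupZ_res]
    simp only [res_one, res_two, Finset.sum_range_succ, Finset.sum_range_zero]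
    simp only [ctr]
    simp [Z.one_cocycle a]
    have h := Z.two_cocycle b (g 0) (g 1) (g 2)
    linear_combination (a.1 ![g 0] + a.1 ![g 1] + a.1 ![g 2]) * h

theorem commute_two_two (b b' : Z R G 2) :
    Commute (DirectSum.of (H R G) 2 (cls b)) (DirectSum.of (H R G) 2 (cls b')) := by
  refine of_mul_of_comm b b' fun hmn => ?_
  -- Up to sign this is the Steenrod product `b ∪₁ b'`; the check is a combination of five instances
  -- of the cocycle identity.
  refine mem_B (m := 3) rfl (c := fun u => b.1 ![u 0, u 1 * u 2] * b'.1 ![u 1, u 2] -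
    b.1 ![u 0 * u 1, u 2] * b'.1 ![u 0, u 1]) ?_ ?_
  · rintro u ⟨i, hi⟩
    fin_cases i
    · have h : u 0 = 1 := hi
      simp [h, Z.two_one_left b, Z.two_one_left b']
    · have h : u 1 = 1 := hi
      simp [h, Z.two_one_left b', Z.two_one_right b']
    · have h : u 2 = 1 := hi
      simp [h, Z.two_one_right b, Z.two_one_right b']
  · intro g
    rw [d_res, cupZ_res]
    have e : (fun i => res (2 + 2) g (i.cast hmn.symm)) = res (2 + 2) g := rfl
    rw [e, cupZ_res]
    simp only [res_two, Finset.sum_range_succ, Finset.sum_range_zero]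
    simp only [res, ctr]
    simp [mul_assoc]
    have h1 := Z.two_cocycle b (g 0 * g 1) (g 2) (g 3)
    have h2 := Z.two_cocycle b (g 0) (g 1) (g 2 * g 3)
    have h3 := Z.two_cocycle b (g 0) (g 1 * g 2) (g 3)
    have h4 := Z.two_cocycle b' (g 0) (g 1) (g 2)
    have h5 := Z.two_cocycle b' (g 1) (g 2) (g 3)
    simp only [mul_assoc] at h1 h2 h3
    linear_combination -(b'.1 ![g 0, g 1]) * h1 - (b'.1 ![g 2, g 3]) * h2
      + (b'.1 ![g 1, g 2]) * h3 + (b.1 ![g 0 * (g 1 * g 2), g 3]) * h4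
      + (b.1 ![g 0, g 1 * (g 2 * g 3)]) * h5

end Representatives

/-! ### Representatives of the generators: linear forms and carry cocycles -/

section Generators

variable {p : ℕ} [Fact p.Prime] {G : Type u} [CommGroup G] [Module (ZMod p) (Additive G)]

/-- The cocycle of degree one given by a linear form. -/
def xZ (v : Module.Dual (ZMod p) (Additive G)) : Z (ZMod p) G 1 :=
  ⟨fun u => v (Additive.ofMul (u 0)), by
    rintro u ⟨i, hi⟩
    rw [Subsingleton.elim i 0] at hi
    simp [hi], by
    refine LinearMap.mem_ker.mpr (funext fun u => ?_)
    simp [d, Fin.sum_univ_two, Fin.contractNth]⟩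

theorem ofDual_eq (v : Module.Dual (ZMod p) (Additive G)) : ofDual v = cls (xZ v) := rfl

/-- The identification of `V` with `H^1(G, 𝔽_p)` as a linear map. -/
def ofDualL : Module.Dual (ZMod p) (Additive G) →ₗ[ZMod p] H (ZMod p) G 1 where
  toFun := ofDual
  map_add' v w := by
    rw [ofDual_eq, ofDual_eq, ofDual_eq, ← map_add]
    rfl
  map_smul' c v := by
    rw [ofDual_eq, ofDual_eq, ← map_smul]
    rfl

/-- The identification of `V` with the part of degree one of the cohomology algebra. -/
def degOne : Module.Dual (ZMod p) (Additive G) →ₗ[ZMod p] HStar (ZMod p) G :=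
  (DirectSum.lof (ZMod p) ℕ (H (ZMod p) G) 1).comp ofDualL

theorem degOne_apply (v : Module.Dual (ZMod p) (Additive G)) :
    degOne v = DirectSum.of (H (ZMod p) G) 1 (ofDual v) := rfl

theorem degOne_mul_self (hp : 2 < p) (v : Module.Dual (ZMod p) (Additive G)) :
    degOne v * degOne v = 0 := by
  rw [degOne_apply, DirectSum.of_mul_of]
  have h2 : (2 : ZMod p) ≠ 0 := by
    intro h
    have : ((2 : ℕ) : ZMod p) = 0 := by exact_mod_cast h
    rw [ZMod.natCast_eq_zero_iff] at this
    exact absurd (Nat.le_of_dvd (by norm_num) this) (by omega)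
  have e : cls (cupZ 1 1 (xZ v) (xZ v)) = 0 := by
    rw [cls_eq_zero]
    -- Half the square of `v` has coboundary `-v(u_1) v(u_2)`, which is `v ∪ v` with its sign; this
    -- needs `p` odd.
    refine mem_B (m := 1) rfl (c := fun u => 2⁻¹ * v (Additive.ofMul (u 0)) ^ 2) ?_ ?_
    · rintro u ⟨i, hi⟩
      rw [Subsingleton.elim i 0] at hi
      simp [hi]
    · intro g
      rw [d_res, cupZ_res]
      simp only [Finset.sum_range_succ, Finset.sum_range_zero, xZ]
      simp only [res, ctr]
      simp
      field_simp
      ring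
  have e' : GradedMonoid.GMul.mul (ofDual v) (ofDual v) = (0 : H (ZMod p) G (1 + 1)) := e
  rw [e', map_zero]

/-- The standard lift of a linear form to `ℤ/p²`. -/
def liftV (v : Module.Dual (ZMod p) (Additive G)) : (Fin 1 → G) → ZMod (p ^ 2) :=
  fun u => ((v (Additive.ofMul (u 0))).val : ZMod (p ^ 2))

/-- The carry cocycle. -/
def carry (v : Module.Dual (ZMod p) (Additive G)) : (Fin 2 → G) → ZMod p := fun u =>
  if p ≤ (v (Additive.ofMul (u 0))).val + (v (Additive.ofMul (u 1))).val then 1 else 0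

/-- Adding representatives in `0, …, p - 1` exceeds the representative of the sum by `p` exactly
when there is a carry. -/
theorem d_liftV (v : Module.Dual (ZMod p) (Additive G)) (u : Fin 2 → G) :
    d (ZMod (p ^ 2)) G 1 (liftV v) u = mulP p (carry v u) := by
  have e : d (ZMod (p ^ 2)) G 1 (liftV v) u = (v (Additive.ofMul (u 1))).val -
      ((v (Additive.ofMul (u 0)) + v (Additive.ofMul (u 1))).val : ZMod (p ^ 2)) +
      (v (Additive.ofMul (u 0))).val := by
    simp [d, Fin.sum_univ_two, Fin.contractNth, liftV]
    ring
  rw [e, carry]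
  set x := v (Additive.ofMul (u 0))
  set y := v (Additive.ofMul (u 1))
  split_ifs with h
  · have h1 := ZMod.val_add_val_of_le h
    have h2 : ((x.val : ZMod (p ^ 2)) + y.val) = (x + y).val + p := by
      exact_mod_cast congrArg (Nat.cast : ℕ → ZMod (p ^ 2)) h1
    have h3 := mulP_intCast p 1
    simp only [Int.cast_one, mul_one] at h3
    rw [h3]
    linear_combination h2
  · rw [ZMod.val_add_of_lt (not_le.mp h), map_zero]
    push_cast
    ring

/-- The carry cocycle of a linear form, which represents its image under the Bockstein map. -/
def yZ (v : Module.Dual (ZMod p) (Additive G)) : Z (ZMod p) G 2 :=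
  ⟨carry v, by
    rintro u ⟨i, hi⟩
    fin_cases i
    · have h : u 0 = 1 := hi
      have := ZMod.val_lt (v (Additive.ofMul (u 1)))
      simp [carry, h, this]
    · have h : u 1 = 1 := hi
      have := ZMod.val_lt (v (Additive.ofMul (u 0)))
      simp [carry, h, this], by
    refine LinearMap.mem_ker.mpr (funext fun u => mulP_injective p ?_)
    rw [← d_map]
    have : (fun w => mulP p (carry v w)) = d (ZMod (p ^ 2)) G 1 (liftV v) :=
      funext fun w => (d_liftV v w).symm
    rw [this, d_d]
    simp⟩

theorem bockstein_ofDual (v : Module.Dual (ZMod p) (Additive G)) :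
    bockstein p (ofDual v) = cls (yZ v) := by
  refine (existsUnique_isConnecting p (ofDual v)).unique (bockstein_spec p _) ?_
  refine ⟨xZ v, yZ v, ⟨liftV v, ?_⟩, rfl, rfl, fun u => ?_, d_liftV v⟩
  · rintro u ⟨i, hi⟩
    rw [Subsingleton.elim i 0] at hi
    simp [liftV, hi]
  · have : NeZero p := ⟨(Fact.out : p.Prime).ne_zero⟩
    change redP p (((v (Additive.ofMul (u 0))).val : ℕ) : ZMod (p ^ 2)) = _
    rw [map_natCast]
    exact ZMod.natCast_zmod_val _

end Generators

/-! ### Evaluation of polynomials in a noncommutative algebra -/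

section AlgebraMap

variable {A ι : Type*} {k : Type*} [CommRing k] [Ring A] [Algebra k A]

/-- Evaluation of polynomials at pairwise commuting elements. -/
noncomputable def commAeval (y : ι → A) (h : ∀ i j, Commute (y i) (y j)) :
    MvPolynomial ι k →ₐ[k] A :=
  -- Polynomial evaluation needs a commutative target, so it takes place in the subalgebra generated
  -- by the commuting elements.
  letI : CommSemiring (Algebra.adjoin k (Set.range y)) :=
    { (inferInstance : Semiring (Algebra.adjoin k (Set.range y))) with
      mul_comm := (Algebra.isMulCommutative_adjoin k (s := Set.range y)
        (by rintro _ ⟨i, rfl⟩ _ ⟨j, rfl⟩; exact h i j)).is_comm.comm }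
  (Algebra.adjoin k (Set.range y)).val.comp
    (MvPolynomial.aeval fun i => ⟨y i, Algebra.subset_adjoin ⟨i, rfl⟩⟩)

theorem commAeval_X (y : ι → A) (h : ∀ i j, Commute (y i) (y j)) (i : ι) :
    commAeval (k := k) y h (MvPolynomial.X i) = y i := by
  simp [commAeval]

theorem commute_of_generators {M : Type*} [AddCommGroup M] [Module k M]
    (f : ExteriorAlgebra k M →ₐ[k] A) (g : MvPolynomial ι k →ₐ[k] A)
    (h : ∀ v i, Commute (f (ExteriorAlgebra.ι k v)) (g (MvPolynomial.X i))) (x : ExteriorAlgebra k M)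
    (y : MvPolynomial ι k) : Commute (f x) (g y) := by
  induction x using ExteriorAlgebra.induction with
  | algebraMap c => rw [AlgHom.commutes]; exact Algebra.commutes _ _
  | ι v =>
    induction y using MvPolynomial.induction_on with
    | C c => exact (AlgHom.commutes g c).symm ▸ (Algebra.commutes _ _).symm
    | add y y' hy hy' => rw [map_add]; exact hy.add_right hy'
    | mul_X y i hy => rw [map_mul]; exact hy.mul_right (h v i)
  | mul x x' hx hx' => rw [map_mul]; exact hx.mul_left hx'
  | add x x' hx hx' => rw [map_add]; exact hx.add_left hx'

end AlgebraMap

/-! ### Construction of the algebra homomorphism -/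

section Tau

variable {p r : ℕ} [Fact p.Prime] {G : Type u} [CommGroup G] [Module (ZMod p) (Additive G)]

/-- The homomorphism of algebras `τ`. -/
noncomputable def tau (hp : 2 < p) (b : Module.Basis (Fin r) (ZMod p) (Additive G)) :
    ExtPoly p r G →ₐ[ZMod p] HStar (ZMod p) G :=
  Algebra.TensorProduct.lift
    (ExteriorAlgebra.lift (ZMod p) ⟨degOne, degOne_mul_self hp⟩)
    (commAeval (fun i => DirectSum.of (H (ZMod p) G) 2 (bockstein p (ofDual (b.coord i))))
      fun i j => by
        rw [bockstein_ofDual, bockstein_ofDual]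
        exact commute_two_two _ _)
    (commute_of_generators _ _ fun v i => by
      rw [ExteriorAlgebra.lift_ι_apply, commAeval_X, bockstein_ofDual]
      exact commute_one_two (xZ v) _)

theorem tau_ι (hp : 2 < p) (b : Module.Basis (Fin r) (ZMod p) (Additive G))
    (v : Module.Dual (ZMod p) (Additive G)) : tau hp b (ExteriorAlgebra.ι (ZMod p) v ⊗ₜ 1) =
      DirectSum.of (H (ZMod p) G) 1 (ofDual v) := by
  rw [tau, Algebra.TensorProduct.lift_tmul, map_one, mul_one, ExteriorAlgebra.lift_ι_apply]
  rfl

theorem tau_X (hp : 2 < p) (b : Module.Basis (Fin r) (ZMod p) (Additive G)) (i : Fin r) :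
    tau hp b (1 ⊗ₜ MvPolynomial.X i) =
      DirectSum.of (H (ZMod p) G) 2 (bockstein p (ofDual (b.coord i))) := by
  rw [tau, Algebra.TensorProduct.lift_tmul, map_one, one_mul, commAeval_X]

end Tau

/-! ### Evaluation of the coefficients on the monomials -/

section Monomials

variable {p r : ℕ} [Fact p.Prime] {G : Type u} [CommGroup G] [Module (ZMod p) (Additive G)]

theorem conv_of_support_nil {R : Type v} [CommRing R] {f g : List G → R}
    (hf : ∀ w, w ≠ [] → f w = 0) : conv f g = f [] • g := by
  funext w
  cases w with
  | nil => rfl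
  | cons x w =>
    have h : pre x f = 0 := funext fun w => hf _ (by simp)
    rw [← pre_apply x (conv f g), pre_conv, h, zero_conv, zero_add]
    rfl

theorem conv_smul {R : Type v} [CommRing R] (f g : List G → R) (c : R) :
    conv f (c • g) = c • conv f g := by
  funext w
  induction w generalizing f with
  | nil =>
    simp only [conv_nil, Pi.smul_apply, smul_eq_mul]
    ring
  | cons x w ih =>
    have := ih (pre x f)
    rw [← pre_apply x (conv f (c • g)), pre_conv, Pi.add_apply, this, Pi.smul_apply (c) (conv f g),
      ← pre_apply x (conv f g), pre_conv]
    simp only [Pi.add_apply, Pi.smul_apply, smul_eq_mul, pre_apply]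
    ring

/-- The powers of the carry cocycle. -/
def yPowL (v : Module.Dual (ZMod p) (Additive G)) : ℕ → List G → ZMod p
  | 0 => fun w => if w = [] then 1 else 0
  | k + 1 => conv (toL (yZ v).1) (yPowL v k)

/-- The cochain that represents the power of degree `m`. -/
def xPowL (v : Module.Dual (ZMod p) (Additive G)) (m : ℕ) : List G → ZMod p :=
  if Even m then yPowL v (m / 2) else conv (toL (xZ v).1) (yPowL v (m / 2))

theorem rep_yPowL (v : Module.Dual (ZMod p) (Additive G)) (k : ℕ) :
    Rep (2 * k) (yPowL v k) (DirectSum.of (H (ZMod p) G) 2 (bockstein p (ofDual v)) ^ k) := by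
  induction k with
  | zero =>
    rw [pow_zero]
    exact Rep.one
  | succ k ih =>
    rw [pow_succ']
    have h : Rep 2 (toL (yZ v).1) (DirectSum.of (H (ZMod p) G) 2 (bockstein p (ofDual v))) :=
      ⟨yZ v, by rw [bockstein_ofDual], rfl⟩
    refine (h.mul ih).congr (by ring) ?_
    rw [pow_mul, neg_one_sq, one_pow, one_smul]
    rfl

theorem rep_xPowL (v : Module.Dual (ZMod p) (Additive G)) (m : ℕ) :
    Rep m (xPowL v m) (DirectSum.of (H (ZMod p) G) 1 (ofDual v) ^ (m % 2) *
      DirectSum.of (H (ZMod p) G) 2 (bockstein p (ofDual v)) ^ (m / 2)) := by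
  have h := rep_yPowL v (m / 2)
  unfold xPowL
  split_ifs with hm
  · rw [Nat.even_iff.mp hm, pow_zero, one_mul]
    exact h.congr (by obtain ⟨k, hk⟩ := hm; omega) rfl
  · rw [Nat.not_even_iff_odd] at hm
    rw [Nat.odd_iff.mp hm, pow_one]
    have h1 : Rep 1 (toL (xZ v).1) (DirectSum.of (H (ZMod p) G) 1 (ofDual v)) := ⟨xZ v, rfl, rfl⟩
    refine (h1.mul h).congr (by obtain ⟨k, hk⟩ := hm; omega) ?_
    rw [one_mul, pow_mul, neg_one_sq, one_pow, one_smul]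

theorem toL_kills_of {n : ℕ} {S : Set G} {a : (Fin n → G) → ZMod p}
    (ha : ∀ u, (∃ i, u i ∈ S) → a u = 0) : Kills S (toL a) := by
  rintro l ⟨z, hz, hS⟩
  obtain ⟨u, hu⟩ := exists_ofFn l
  generalize l.length = k at u hu
  subst hu
  by_cases h : k = n
  · subst h
    rw [toL_ofFn]
    obtain ⟨i, rfl⟩ := List.mem_ofFn.mp hz
    exact ha u ⟨i, hS⟩
  · exact toL_of_ne _ (by simpa using h)

/-- The linear form vanishes on its kernel, and adding zero never produces a carry. This makes a
factor attached to `x_j` ignore the entries of every other block. -/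
theorem kills_xPowL (v : Module.Dual (ZMod p) (Additive G)) (m : ℕ) :
    Kills {z : G | v (Additive.ofMul z) = 0} (xPowL v m) := by
  have hx : Kills {z : G | v (Additive.ofMul z) = 0} (toL (xZ v).1) := by
    refine toL_kills_of ?_
    rintro u ⟨i, hi⟩
    rw [Subsingleton.elim i 0] at hi
    exact hi
  have hy : Kills {z : G | v (Additive.ofMul z) = 0} (toL (yZ v).1) := by
    refine toL_kills_of ?_
    rintro u ⟨i, hi⟩
    change carry v u = 0
    fin_cases i
    · have h : v (Additive.ofMul (u 0)) = 0 := hi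
      have := ZMod.val_lt (v (Additive.ofMul (u 1)))
      simp [carry, h, this]
    · have h : v (Additive.ofMul (u 1)) = 0 := hi
      have := ZMod.val_lt (v (Additive.ofMul (u 0)))
      simp [carry, h, this]
  have hk : ∀ k, Kills {z : G | v (Additive.ofMul z) = 0} (yPowL v k) := by
    intro k
    induction k with
    | zero =>
      rintro w ⟨z, hz, -⟩
      exact if_neg (by rintro rfl; simp at hz)
    | succ k ih => exact hy.conv ih
  unfold xPowL
  split_ifs
  · exact hk _
  · exact hx.conv (hk _)

/-- The pair `(s ^ q, s)` produces a carry only for `q = p - 1`, so a single choice of exponents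
contributes, with value `1`. -/
theorem evenChain_yPowL {v : Module.Dual (ZMod p) (Additive G)} {s : G}
    (hv : v (Additive.ofMul s) = 1) (k : ℕ) : evenChain p (ZMod p) s k (yPowL v k) = 1 := by
  have hp := (Fact.out : p.Prime).one_lt
  induction k with
  | zero =>
    change yPowL v 0 [] = 1
    simp [yPowL]
  | succ k ih =>
    rw [evenChain_succ]
    have e : ∀ q ∈ Finset.Icc 1 (p - 1), pre s (pre (s ^ q) (yPowL v (k + 1))) =
        (if q = p - 1 then (1 : ZMod p) else 0) • yPowL v k := by
      intro q hq
      have hq' := Finset.mem_Icc.mp hq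
      have h1 : toL (yZ v).1 ([] : List G) = 0 := toL_of_ne _ (by simp)
      have h2 : toL (yZ v).1 [s ^ q] = 0 := toL_of_ne _ (by simp)
      rw [yPowL, pre_conv, h1, zero_smul, add_zero, pre_conv]
      simp only [pre_apply]
      rw [h2, zero_smul, add_zero, conv_of_support_nil]
      · congr 1
        change toL (yZ v).1 (List.ofFn ![s ^ q, s]) = _
        rw [toL_ofFn]
        change carry v _ = _
        have h3 : (v (Additive.ofMul (s ^ q))).val = q := by
          rw [ofMul_pow, map_nsmul, hv, nsmul_one, ZMod.val_cast_of_lt (by omega)]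
        simp only [carry, Matrix.cons_val_zero, Matrix.cons_val_one, h3, hv, ZMod.val_one]
        congr 1
        apply propext
        omega
      · intro w hw
        refine toL_of_ne _ ?_
        have := List.length_pos_iff.mpr hw
        simp; omega
    rw [Finset.sum_congr rfl fun q hq => congrArg _ (e q hq)]
    simp only [map_smul, ih, smul_eq_mul, mul_one]
    rw [Finset.sum_ite_eq', if_pos (Finset.mem_Icc.mpr ⟨by omega, le_rfl⟩)]

theorem blockChain_xPowL {v : Module.Dual (ZMod p) (Additive G)} {s : G}
    (hv : v (Additive.ofMul s) = 1) (m m' : ℕ) :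
    blockChain p (ZMod p) s m (xPowL v m') = if m = m' then 1 else 0 := by
  have hp := (Fact.out : p.Prime).one_lt
  split_ifs with h
  · subst h
    unfold blockChain xPowL
    split_ifs with hm
    · exact evenChain_yPowL hv _
    · rw [LinearMap.comp_apply, pre_conv, conv_of_support_nil]
      · have h1 : toL (xZ v).1 ([] : List G) = 0 := toL_of_ne _ (by simp)
        have h2 : toL (xZ v).1 [s] = 1 := by
          change toL (xZ v).1 (List.ofFn ![s]) = 1
          rw [toL_ofFn]
          exact hv
        rw [pre_apply, h1, h2, zero_smul, add_zero, one_smul, evenChain_yPowL hv]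
      · intro w hw
        refine toL_of_ne _ ?_
        have := List.length_pos_iff.mpr hw
        simp; omega
  · rw [(isCycle_blockChain hp (pow_eq_one s) m).congr _ 0, map_zero]
    intro l hl
    exact (rep_xPowL v m').eq_zero (by omega)

/-- All entries of the `i`-th block are powers of `s i`, so `itsh_convs` applies to each choice of
exponents, and the sum of products is a product of sums. -/
theorem itT_blockChain_convs {s : Fin r → G} {ν : Fin r → ℕ} {f : Fin r → List G → ZMod p}
    (h : ∀ i j, i ≠ j → ∀ w : List G, (∃ z ∈ w, ∃ q : ℕ, z = s i ^ q) → f j w = 0) :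
    itT (fun i => blockChain p (ZMod p) (s i) (ν i)) (convs f) =
      ∏ i, blockChain p (ZMod p) (s i) (ν i) (f i) := by
  have e : ∀ i, blockChain p (ZMod p) (s i) (ν i) = ∑ q ∈ Fintype.piFinset
      fun _ : Fin (ν i / 2) => Finset.Icc 1 (p - 1),
      LinearMap.proj (List.ofFn (sTuple (s i) (ν i) q)) := by
    intro i
    ext1 a
    rw [blockChain_eq_sum]
    simp
  simp only [e]
  rw [itT_sum]
  simp only [LinearMap.sum_apply, LinearMap.proj_apply]
  rw [Finset.prod_univ_sum]
  refine Finset.sum_congr rfl fun q _ => itsh_convs fun i j hij => ?_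
  rintro w ⟨z, hz, hzi⟩
  refine h i j hij w ⟨z, hz, ?_⟩
  obtain ⟨t, rfl⟩ := List.mem_ofFn.mp hzi
  unfold sTuple
  split_ifs
  · exact ⟨_, rfl⟩
  · exact ⟨1, (pow_one _).symm⟩

theorem numOdd_succ (ν : Fin (r + 1) → ℕ) :
    numOdd ν = (if Odd (ν 0) then 1 else 0) + numOdd fun i => ν i.succ := by
  simp only [numOdd, Finset.card_filter, Fin.sum_univ_succ]

theorem neg_one_pow_sum (ν : Fin r → ℕ) :
    (-1 : ZMod p) ^ (∑ i, ν i) = (-1) ^ numOdd ν := by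
  induction r with
  | zero => simp [numOdd]
  | succ r ih =>
    rw [Fin.sum_univ_succ, pow_add, ih, numOdd_succ, pow_add]
    congr 1
    split_ifs with h
    · rw [h.neg_one_pow, pow_one]
    · rw [(Nat.not_odd_iff_even.mp h).neg_one_pow, pow_zero]

/-- Modulo 2 the sum of the later `n_i` is their number `l` of odd entries. For odd `n_1` the sign
of the cup product is therefore `(-1) ^ l`, and `l(l+1)/2 = l(l-1)/2 + l`. -/
theorem numSign_succ (ν : Fin (r + 1) → ℕ) : (numSign ν : ZMod p) =
    (-1) ^ (ν 0 * ∑ i : Fin r, ν i.succ) * numSign fun i => ν i.succ := by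
  rw [pow_mul', neg_one_pow_sum, ← pow_mul']
  unfold numSign
  rw [numOdd_succ]
  generalize (numOdd fun i => ν i.succ) = l
  split_ifs with h
  · rw [pow_mul, h.neg_one_pow, ← pow_add, add_comm 1 l]
    congr 1
    have h1 : (l + 1) * (l + 1 - 1) / 2 = l * (l - 1) / 2 + l := by
      have := Nat.triangle_succ l
      simpa using this
    rw [h1, add_comm]
  · rw [pow_mul, (Nat.not_odd_iff_even.mp h).neg_one_pow, one_pow, one_mul, zero_add]

theorem numSign_mul_self (ν : Fin r → ℕ) : (numSign ν : ZMod p) * numSign ν = 1 := by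
  rw [numSign, ← mul_pow]
  simp

/-- The signs `(-1)^{mn}` of the successive cup products accumulate to `numSign`. -/
theorem rep_prod_ofFn {ν : Fin r → ℕ} {f : Fin r → List G → ZMod p}
    {e : Fin r → HStar (ZMod p) G} (h : ∀ i, Rep (ν i) (f i) (e i)) :
    Rep (∑ i, ν i) ((numSign ν : ZMod p) • convs f) (List.ofFn e).prod := by
  induction r with
  | zero =>
    refine Rep.one.congr (by simp) ?_
    simp [numSign, numOdd, convs]
  | succ r ih =>
    rw [List.ofFn_succ, List.prod_cons]
    refine ((h 0).mul (ih fun i => h i.succ)).congr (Fin.sum_univ_succ ν).symm ?_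
    rw [conv_smul, smul_smul, numSign_succ]
    rfl

theorem tau_xPow (hp : 2 < p) (b : Module.Basis (Fin r) (ZMod p) (Additive G)) (i : Fin r)
    (m : ℕ) : tau hp b (xPow b i m) =
      DirectSum.of (H (ZMod p) G) 1 (ofDual (b.coord i)) ^ (m % 2) *
      DirectSum.of (H (ZMod p) G) 2 (bockstein p (ofDual (b.coord i))) ^ (m / 2) := by
  have e : xPow b i m = (ExteriorAlgebra.ι (ZMod p) (b.coord i) ⊗ₜ 1) ^ (m % 2) *
      (1 ⊗ₜ MvPolynomial.X i) ^ (m / 2) := by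
    rw [Algebra.TensorProduct.tmul_pow, Algebra.TensorProduct.tmul_pow,
      Algebra.TensorProduct.tmul_mul_tmul, one_pow, one_pow, mul_one, one_mul]
    rfl
  rw [e, map_mul, map_pow, map_pow, tau_ι, tau_X]

theorem rep_tau_xMon (hp : 2 < p) (b : Module.Basis (Fin r) (ZMod p) (Additive G))
    (ν : Fin r → ℕ) : Rep (∑ i, ν i)
      ((numSign ν : ZMod p) • convs fun i => xPowL (b.coord i) (ν i)) (tau hp b (xMon b ν)) := by
  have e : tau hp b (xMon b ν) = (List.ofFn fun i => tau hp b (xPow b i (ν i))).prod := by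
    rw [xMon, map_list_prod, List.map_ofFn]
    rfl
  rw [e]
  refine rep_prod_ofFn fun i => ?_
  rw [tau_xPow]
  exact rep_xPowL _ _

/-- The duality of coefficients and monomials. The sign of the product and the sign of the
coefficient cancel by `numSign_mul_self`. -/
theorem exists_cocycle_xMon (hp : 2 < p) (b : Module.Basis (Fin r) (ZMod p) (Additive G)) {n : ℕ}
    {ν : Fin r → ℕ} (h : ∑ i, ν i = n) : ∃ a : Z (ZMod p) G n,
      tau hp b (xMon b ν) = DirectSum.of (H (ZMod p) G) n (cls a) ∧
      ∀ {ν' : Fin r → ℕ} (h' : ∑ i, ν' i = n),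
        coeff (fun i => (b i).toMul) h' a.1 = if ν' = ν then 1 else 0 := by
  subst h
  obtain ⟨a, ha, hf⟩ := rep_tau_xMon hp b ν
  refine ⟨a, ha, fun {ν'} h' => ?_⟩
  rw [coeff_eq_itT, hf, map_smul, itT_blockChain_convs]
  · have hv : ∀ i, b.coord i (Additive.ofMul (b i).toMul) = 1 := fun i => by simp
    simp only [blockChain_xPowL (hv _)]
    rw [Finset.prod_ite_zero]
    by_cases hν : ν' = ν
    · subst hν
      simp [numSign_mul_self]
    · have : ¬ ∀ i ∈ Finset.univ, ν' i = ν i := fun h => hν (funext fun i => h i (Finset.mem_univ i))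
      rw [if_neg this, if_neg hν]
      simp
  · rintro i j hij w ⟨z, hz, q, rfl⟩
    refine kills_xPowL _ _ w ⟨_, hz, ?_⟩
    simp [ofMul_pow, hij]

end Monomials

/-! ### Absorbing a factor into an ordered product -/

section Span

variable {k A : Type*} [CommRing k] [Ring A] [Algebra k A]

/-- The factor `z` is moved past the earlier slots at the cost of scalars and absorbed in slot `i`.
-/
theorem mul_prod_ofFn {r : ℕ} {e : Fin r → ℕ → A} {z : A} (i : Fin r)
    (h1 : ∀ j, j ≠ i → ∀ m, ∃ c : k, z * e j m = c • (e j m * z))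
    (h2 : ∀ m, ∃ (c : k) (m' : ℕ), z * e i m = c • e i m') (ν : Fin r → ℕ) :
    ∃ (c : k) (ν' : Fin r → ℕ), z * (List.ofFn fun j => e j (ν j)).prod =
      c • (List.ofFn fun j => e j (ν' j)).prod := by
  induction r with
  | zero => exact i.elim0
  | succ r ih =>
    simp only [List.ofFn_succ, List.prod_cons]
    induction i using Fin.cases with
    | zero =>
      obtain ⟨c, m', h⟩ := h2 (ν 0)
      refine ⟨c, Fin.cons m' fun i => ν i.succ, ?_⟩
      rw [← mul_assoc, h]
      simp
    | succ i =>
      obtain ⟨c, h⟩ := h1 0 (Fin.succ_ne_zero i).symm (ν 0)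
      obtain ⟨c', ν', h'⟩ := ih (e := fun j => e j.succ) i
        (fun j hj => h1 _ fun e => hj (Fin.succ_injective _ e)) h2 fun j => ν j.succ
      refine ⟨c * c', Fin.cons (ν 0) ν', ?_⟩
      rw [← mul_assoc, h, smul_mul_assoc, mul_assoc, h']
      simp [smul_smul]

end Span

/-! ### The monomials span the domain -/

section SpanTop

variable {p r : ℕ} [Fact p.Prime] {G : Type u} [CommGroup G] [Module (ZMod p) (Additive G)]

theorem ι_mul_xMon (b : Module.Basis (Fin r) (ZMod p) (Additive G)) (i : Fin r) (ν : Fin r → ℕ) :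
    ∃ (c : ZMod p) (ν' : Fin r → ℕ),
      (ExteriorAlgebra.ι (ZMod p) (b.coord i) ⊗ₜ 1 : ExtPoly p r G) * xMon b ν = c • xMon b ν' := by
  refine mul_prod_ofFn (e := fun i m => xPow b i m) i (fun j _ m => ?_) (fun m => ?_) ν
  · rcases Nat.mod_two_eq_zero_or_one m with h | h
    · refine ⟨1, ?_⟩
      simp [xPow, h]
    · refine ⟨-1, ?_⟩
      simp only [xPow, h, pow_one, Algebra.TensorProduct.tmul_mul_tmul, one_mul, mul_one]
      have := ExteriorAlgebra.ι_add_mul_swap (R := ZMod p) (b.coord i) (b.coord j)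
      rw [eq_neg_of_add_eq_zero_left this, TensorProduct.neg_tmul]
      exact (neg_one_smul (ZMod p) _).symm
  · rcases Nat.mod_two_eq_zero_or_one m with h | h
    · refine ⟨1, m + 1, ?_⟩
      have h1 : (m + 1) % 2 = 1 := by omega
      have h2 : (m + 1) / 2 = m / 2 := by omega
      simp [xPow, h, h1, h2]
    -- Here `x_i` occurs already and its square is zero; the exponent is a dummy.
    · refine ⟨0, 0, ?_⟩
      simp [xPow, h]

theorem X_mul_xMon (b : Module.Basis (Fin r) (ZMod p) (Additive G)) (i : Fin r) (ν : Fin r → ℕ) :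
    ∃ (c : ZMod p) (ν' : Fin r → ℕ),
      (1 ⊗ₜ MvPolynomial.X i : ExtPoly p r G) * xMon b ν = c • xMon b ν' := by
  refine mul_prod_ofFn (e := fun i m => xPow b i m) i (fun j _ m => ⟨1, ?_⟩)
    (fun m => ⟨1, m + 2, ?_⟩) ν
  · simp [xPow, mul_comm]
  · have h1 : (m + 2) % 2 = m % 2 := by omega
    have h2 : (m + 2) / 2 = m / 2 + 1 := by omega
    simp [xPow, h1, h2, pow_succ']

/-- The span contains `1` and is stable under left multiplication by the generators, hence by all
elements. -/
theorem span_xMon (b : Module.Basis (Fin r) (ZMod p) (Additive G)) :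
    Submodule.span (ZMod p) (Set.range (xMon b)) = ⊤ := by
  set S := Submodule.span (ZMod p) (Set.range (xMon b)) with hS
  have step : ∀ z : ExtPoly p r G,
      (∀ ν, ∃ (c : ZMod p) (ν' : Fin r → ℕ), z * xMon b ν = c • xMon b ν') →
      ∀ t ∈ S, z * t ∈ S := by
    intro z hz t ht
    induction ht using Submodule.span_induction with
    | mem t ht =>
      obtain ⟨ν, rfl⟩ := ht
      obtain ⟨c, ν', h⟩ := hz ν
      rw [h]
      exact S.smul_mem _ (Submodule.subset_span ⟨ν', rfl⟩)
    | zero => rw [mul_zero]; exact S.zero_mem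
    | add t t' _ _ h h' => rw [mul_add]; exact S.add_mem h h'
    | smul c t _ h => rw [mul_smul_comm]; exact S.smul_mem _ h
  have hι : ∀ v : Module.Dual (ZMod p) (Additive G), ∀ t ∈ S,
      (ExteriorAlgebra.ι (ZMod p) v ⊗ₜ 1 : ExtPoly p r G) * t ∈ S := by
    intro v t ht
    have hv : v ∈ Submodule.span (ZMod p) (Set.range b.coord) := by
      rw [← b.coe_dualBasis, b.dualBasis.span_eq]
      exact Submodule.mem_top
    induction hv using Submodule.span_induction with
    | mem v hv =>
      obtain ⟨i, rfl⟩ := hv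
      exact step _ (ι_mul_xMon b i) t ht
    | zero => rw [map_zero, TensorProduct.zero_tmul, zero_mul]; exact S.zero_mem
    | add v v' _ _ h h' =>
      rw [map_add, TensorProduct.add_tmul, add_mul]; exact S.add_mem h h'
    | smul c v _ h =>
      rw [map_smul, ← TensorProduct.smul_tmul', smul_mul_assoc]; exact S.smul_mem _ h
  have hl : ∀ x : ExteriorAlgebra (ZMod p) (Module.Dual (ZMod p) (Additive G)), ∀ t ∈ S,
      (x ⊗ₜ 1 : ExtPoly p r G) * t ∈ S := by
    intro x
    induction x using ExteriorAlgebra.induction with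
    | algebraMap c =>
      intro t ht
      rw [Algebra.algebraMap_eq_smul_one, ← TensorProduct.smul_tmul', smul_mul_assoc,
        ← Algebra.TensorProduct.one_def, one_mul]
      exact S.smul_mem _ ht
    | ι v => exact hι v
    | mul x x' hx hx' =>
      intro t ht
      have e : ((x * x') ⊗ₜ 1 : ExtPoly p r G) = (x ⊗ₜ 1) * (x' ⊗ₜ 1) := by simp
      rw [e, mul_assoc]
      exact hx _ (hx' _ ht)
    | add x x' hx hx' =>
      intro t ht
      rw [TensorProduct.add_tmul, add_mul]
      exact S.add_mem (hx t ht) (hx' t ht)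
  have hr : ∀ y : MvPolynomial (Fin r) (ZMod p), ∀ t ∈ S, (1 ⊗ₜ y : ExtPoly p r G) * t ∈ S := by
    intro y
    induction y using MvPolynomial.induction_on with
    | C c =>
      intro t ht
      rw [MvPolynomial.C_eq_smul_one, TensorProduct.tmul_smul, smul_mul_assoc,
        ← Algebra.TensorProduct.one_def, one_mul]
      exact S.smul_mem _ ht
    | add y y' hy hy' =>
      intro t ht
      rw [TensorProduct.tmul_add, add_mul]
      exact S.add_mem (hy t ht) (hy' t ht)
    | mul_X y i hy =>
      intro t ht
      have e : (1 ⊗ₜ (y * MvPolynomial.X i) : ExtPoly p r G) =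
          (1 ⊗ₜ y) * (1 ⊗ₜ MvPolynomial.X i) := by simp
      rw [e, mul_assoc]
      exact hy _ (step _ (X_mul_xMon b i) t ht)
  have h1 : (1 : ExtPoly p r G) ∈ S := by
    refine Submodule.subset_span ⟨0, ?_⟩
    have : ∀ i, xPow b i 0 = 1 := fun i => by simp [xPow, Algebra.TensorProduct.one_def]
    simp [xMon, this]
  refine eq_top_iff.mpr fun x _ => ?_
  induction x using TensorProduct.induction_on with
  | zero => exact S.zero_mem
  | tmul x y =>
    have e : (x ⊗ₜ y : ExtPoly p r G) = (x ⊗ₜ 1) * ((1 ⊗ₜ y) * 1) := by simp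
    rw [e]
    exact hl x _ (hr y _ h1)
  | add x y hx hy => exact S.add_mem (hx trivial) (hy trivial)

end SpanTop

/-! ### Dimension count and the inverse -/

section Conclusion

/-- Tuples are sorted by the sum `m` of all entries but the first, which is then `n - m`; this is
the recursion of `cnt`. -/
theorem card_antidiagonalTuple (r n : ℕ) :
    (Finset.Nat.antidiagonalTuple r n).card = cnt r n := by
  induction r generalizing n with
  | zero => cases n <;> simp [cnt]
  | succ r ih =>
    have e : Finset.Nat.antidiagonalTuple (r + 1) n = (Finset.range (n + 1)).biUnion fun m =>
        (Finset.Nat.antidiagonalTuple r m).image fun ν => (Fin.cons (n - m) ν : Fin (r + 1) → ℕ) := by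
      ext ν
      simp only [Finset.Nat.mem_antidiagonalTuple, Finset.mem_biUnion, Finset.mem_range,
        Finset.mem_image]
      rw [Fin.sum_univ_succ]
      constructor
      · intro h
        refine ⟨∑ i : Fin r, ν i.succ, by omega, fun i => ν i.succ, rfl, ?_⟩
        have : n - ∑ i : Fin r, ν i.succ = ν 0 := by omega
        rw [this]
        exact Fin.cons_self_tail ν
      · rintro ⟨m, hm, ν', h, rfl⟩
        simp only [Fin.cons_zero, Fin.cons_succ, h]
        omega
    rw [e, Finset.card_biUnion, cnt]
    · refine Finset.sum_congr rfl fun m _ => ?_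
      rw [Finset.card_image_of_injective _ (Fin.cons_right_injective _), ih]
    · intro m _ m' _ hne
      rw [Function.onFun, Finset.disjoint_left]
      intro ν h h'
      obtain ⟨ν₁, h1, rfl⟩ := Finset.mem_image.mp h
      obtain ⟨ν₂, h2, h3⟩ := Finset.mem_image.mp h'
      rw [Finset.Nat.mem_antidiagonalTuple] at h1 h2
      have : ν₂ = ν₁ := by
        funext i
        have := congrFun h3 i.succ
        simpa using this
      subst this
      exact hne (h1.symm.trans h2)

/-- By the inclusion of kernels `c` factors through `φ` as `c ∘ σ`, a surjection between spaces of
equal finite dimension, hence injective. -/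
theorem ker_le_ker_of_surjective {k V W W' : Type*} [Field k] [AddCommGroup V] [Module k V]
    [AddCommGroup W] [Module k W] [AddCommGroup W'] [Module k W'] [FiniteDimensional k W]
    [FiniteDimensional k W'] {φ : V →ₗ[k] W} {c : V →ₗ[k] W'}
    (hd : Module.finrank k W = Module.finrank k W') (hc : Function.Surjective c)
    (h : LinearMap.ker φ ≤ LinearMap.ker c) : LinearMap.ker c ≤ LinearMap.ker φ := by
  obtain ⟨σ, hσ⟩ := exists_section φ ⊤
  have hg : ∀ x, c (σ (φ x)) = c x := by
    intro x
    have h1 : σ (φ x) - x ∈ LinearMap.ker φ := by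
      rw [LinearMap.mem_ker, map_sub, (hσ x trivial).2, sub_self]
    exact sub_eq_zero.mp (by rw [← map_sub]; exact h h1)
  have hs : Function.Surjective (c.comp σ) := fun y => by
    obtain ⟨x, rfl⟩ := hc y
    exact ⟨φ x, hg x⟩
  have hi : Function.Injective (c.comp σ) :=
    (LinearMap.injective_iff_surjective_of_finrank_eq_finrank hd).mpr hs
  intro x hx
  refine LinearMap.mem_ker.mpr (hi ?_)
  rw [map_zero, LinearMap.comp_apply, hg]
  exact hx

variable {p r : ℕ} [Fact p.Prime] {G : Type u} [CommGroup G] [Module (ZMod p) (Additive G)]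

/-- The detecting functionals bound the dimension from above, and the coefficients, jointly
surjective by duality with the monomials, attain the bound; hence the coefficients detect as well.
-/
theorem mem_B_of_coeff_eq_zero (hp : 2 < p) (b : Module.Basis (Fin r) (ZMod p) (Additive G))
    {n : ℕ} (a : Z (ZMod p) G n) (ha : ∀ {ν : Fin r → ℕ} (h : ∑ i, ν i = n),
      coeff (fun i => (b i).toMul) h a.1 = 0) : a.1 ∈ B (ZMod p) G n := by
  classical
  obtain ⟨φ, hφ⟩ := exists_detecting (k := ZMod p) b n
  let A := Finset.Nat.antidiagonalTuple r n
  let c : Z (ZMod p) G n →ₗ[ZMod p] (A → ZMod p) := LinearMap.pi fun ν =>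
    (coeffL (fun i => (b i).toMul) (Finset.Nat.mem_antidiagonalTuple.mp ν.2)).comp
      (Z (ZMod p) G n).subtype
  have hc : Function.Surjective c := by
    intro y
    choose m hm using fun ν : A =>
      exists_cocycle_xMon hp b (Finset.Nat.mem_antidiagonalTuple.mp ν.2)
    refine ⟨∑ ν, y ν • m ν, ?_⟩
    funext ν'
    rw [map_sum, Finset.sum_apply, Finset.sum_eq_single ν']
    · rw [map_smul, Pi.smul_apply]
      change y ν' • coeff _ _ (m ν').1 = _
      rw [(hm ν').2, if_pos rfl, smul_eq_mul, mul_one]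
    · intro ν _ hν
      rw [map_smul, Pi.smul_apply]
      change y ν • coeff _ _ (m ν).1 = _
      rw [(hm ν).2, if_neg fun h => hν (Subtype.ext h.symm), smul_zero]
    · simp
  -- A cocycle killed by `φ` is a coboundary, and coefficients vanish on coboundaries.
  have hker : LinearMap.ker (φ.comp (Z (ZMod p) G n).subtype) ≤ LinearMap.ker c := by
    intro x hx
    have hxB := hφ x.1 x.2 hx
    refine LinearMap.mem_ker.mpr (funext fun ν => ?_)
    exact coeff_eq_zero_of_mem_B (by omega) (fun i => pow_eq_one _) _ hxB
  have hd : Module.finrank (ZMod p) (Fin (cnt r n) → ZMod p) =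
      Module.finrank (ZMod p) (A → ZMod p) := by
    simp [A, card_antidiagonalTuple]
  refine hφ a.1 a.2 (ker_le_ker_of_surjective hd hc hker ?_)
  exact LinearMap.mem_ker.mpr (funext fun ν => ha _)

/-- The inverse of `τ` in degree `n`. -/
noncomputable def rhoDeg (hp : 2 < p) (b : Module.Basis (Fin r) (ZMod p) (Additive G)) (n : ℕ) :
    H (ZMod p) G n →ₗ[ZMod p] ExtPoly p r G :=
  liftH (∑ ν ∈ (Finset.Nat.antidiagonalTuple r n).attach,
    ((coeffL (fun i => (b i).toMul) (Finset.Nat.mem_antidiagonalTuple.mp ν.2)).comp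
      (Z (ZMod p) G n).subtype).smulRight (xMon b ν.1)) fun a ha => by
    rw [LinearMap.sum_apply]
    refine Finset.sum_eq_zero fun ν _ => ?_
    have h : coeff (fun i => (b i).toMul) (Finset.Nat.mem_antidiagonalTuple.mp ν.2) a.1 = 0 :=
      coeff_eq_zero_of_mem_B (by omega) (fun i => pow_eq_one _) _ ha
    change coeff _ _ a.1 • xMon b ν.1 = 0
    rw [h, zero_smul]

theorem rhoDeg_cls (hp : 2 < p) (b : Module.Basis (Fin r) (ZMod p) (Additive G)) {n : ℕ}
    (a : Z (ZMod p) G n) : rhoDeg hp b n (cls a) =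
      ∑ ν ∈ (Finset.Nat.antidiagonalTuple r n).attach,
        coeff (fun i => (b i).toMul) (Finset.Nat.mem_antidiagonalTuple.mp ν.2) a.1 •
          xMon b ν.1 := by
  rw [rhoDeg, liftH_cls, LinearMap.sum_apply]
  rfl

/-- The inverse of `τ`. -/
noncomputable def rho (hp : 2 < p) (b : Module.Basis (Fin r) (ZMod p) (Additive G)) :
    HStar (ZMod p) G →ₗ[ZMod p] ExtPoly p r G :=
  DirectSum.toModule (ZMod p) ℕ _ (rhoDeg hp b)

theorem rho_of (hp : 2 < p) (b : Module.Basis (Fin r) (ZMod p) (Additive G)) {n : ℕ}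
    (x : H (ZMod p) G n) : rho hp b (DirectSum.of (H (ZMod p) G) n x) = rhoDeg hp b n x :=
  DirectSum.toModule_lof (ZMod p) n x

theorem rho_tau (hp : 2 < p) (b : Module.Basis (Fin r) (ZMod p) (Additive G))
    (x : ExtPoly p r G) : rho hp b (tau hp b x) = x := by
  have h : (rho hp b).comp (tau hp b).toLinearMap = LinearMap.id := by
    refine LinearMap.ext_on (span_xMon b) ?_
    rintro _ ⟨ν, rfl⟩
    obtain ⟨a, ha, hc⟩ := exists_cocycle_xMon hp b (ν := ν) rfl
    change rho hp b (tau hp b (xMon b ν)) = xMon b ν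
    rw [ha, rho_of, rhoDeg_cls]
    simp only [hc]
    rw [Finset.sum_eq_single ⟨ν, Finset.Nat.mem_antidiagonalTuple.mpr rfl⟩]
    · simp
    · intro ν' _ hν
      rw [if_neg fun h => hν (Subtype.ext h), zero_smul]
    · simp
  exact LinearMap.congr_fun h x

/-- The cocycle `a` and the combination of monomial cocycles prescribed by the formula have the same
coefficients, so they differ by a coboundary. -/
theorem tau_rho_of (hp : 2 < p) (b : Module.Basis (Fin r) (ZMod p) (Additive G)) {n : ℕ}
    (a : Z (ZMod p) G n) : tau hp b (rho hp b (DirectSum.of (H (ZMod p) G) n (cls a))) =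
      DirectSum.of (H (ZMod p) G) n (cls a) := by
  rw [rho_of, rhoDeg_cls, map_sum]
  choose m hm using fun ν : Finset.Nat.antidiagonalTuple r n =>
    exists_cocycle_xMon hp b (Finset.Nat.mem_antidiagonalTuple.mp ν.2)
  have e : cls a = cls (∑ ν ∈ (Finset.Nat.antidiagonalTuple r n).attach,
      coeff (fun i => (b i).toMul) (Finset.Nat.mem_antidiagonalTuple.mp ν.2) a.1 • m ν) := by
    rw [cls_eq]
    refine mem_B_of_coeff_eq_zero hp b (a - ∑ ν ∈ (Finset.Nat.antidiagonalTuple r n).attach,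
      coeff (fun i => (b i).toMul) (Finset.Nat.mem_antidiagonalTuple.mp ν.2) a.1 • m ν)
      fun {ν'} h => ?_
    let c := (coeffL (fun i => (b i).toMul) h).comp (Z (ZMod p) G n).subtype
    have hcm : ∀ ν, c (m ν) = if ν' = ν.1 then 1 else 0 := fun ν => (hm ν).2 h
    change c (a - _) = 0
    rw [map_sub, map_sum]
    simp only [map_smul, hcm]
    rw [Finset.sum_eq_single ⟨ν', Finset.Nat.mem_antidiagonalTuple.mpr h⟩]
    · rw [if_pos rfl, smul_eq_mul, mul_one]
      exact sub_self _
    · intro ν _ hν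
      rw [if_neg fun h => hν (Subtype.ext h.symm), smul_zero]
    · simp
  rw [e, map_sum, map_sum]
  refine Finset.sum_congr rfl fun ν _ => ?_
  rw [map_smul, (hm ν).1, map_smul]
  exact (map_smul (DirectSum.lof (ZMod p) ℕ (H (ZMod p) G) n) _ _).symm

theorem tau_rho (hp : 2 < p) (b : Module.Basis (Fin r) (ZMod p) (Additive G))
    (x : HStar (ZMod p) G) : tau hp b (rho hp b x) = x := by
  induction x using DirectSum.induction_on with
  | zero => simp
  | of n x =>
    obtain ⟨a, rfl⟩ := cls_surj x
    exact tau_rho_of hp b a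
  | add x y hx hy => rw [map_add, map_add, hx, hy]

end Conclusion

end ElemAb

/-- `G` is an elementary abelian `p`-group, written multiplicatively, with basis `s_1,…,s_r`.
The first two clauses determine the isomorphism of algebras `τ`, as `x ⊗ 1` and `1 ⊗ y_i` generate
its domain; the third one is the formula for its inverse. -/
theorem corollary2p13 {p r : ℕ} [Fact p.Prime] (hp : 2 < p) {G : Type*} [CommGroup G]
    [Module (ZMod p) (Additive G)] (b : Module.Basis (Fin r) (ZMod p) (Additive G)) :
    ∃ τ : ElemAb.ExtPoly p r G ≃ₐ[ZMod p] ElemAb.HStar (ZMod p) G,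
      (∀ v : Module.Dual (ZMod p) (Additive G),
        τ (ExteriorAlgebra.ι (ZMod p) v ⊗ₜ 1) =
          DirectSum.of (ElemAb.H (ZMod p) G) 1 (ElemAb.ofDual v)) ∧
      (∀ i : Fin r, τ (1 ⊗ₜ MvPolynomial.X i) =
        DirectSum.of (ElemAb.H (ZMod p) G) 2 (ElemAb.bockstein p (ElemAb.ofDual (b.coord i)))) ∧
      ∀ (n : ℕ) (a : ElemAb.Z (ZMod p) G n),
        τ.symm (DirectSum.of (ElemAb.H (ZMod p) G) n (ElemAb.cls a)) =
          ∑ ν ∈ (Finset.Nat.antidiagonalTuple r n).attach,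
            ElemAb.coeff (fun i => (b i).toMul) (Finset.Nat.mem_antidiagonalTuple.mp ν.2) a.1 •
              ElemAb.xMon b ν.1 := by
  refine ⟨AlgEquiv.ofBijective (ElemAb.tau hp b)
    ⟨Function.LeftInverse.injective (ElemAb.rho_tau hp b),
      Function.RightInverse.surjective (ElemAb.tau_rho hp b)⟩,
    ElemAb.tau_ι hp b, ElemAb.tau_X hp b, fun n a => ?_⟩
  rw [AlgEquiv.symm_apply_eq, ← ElemAb.rhoDeg_cls hp b, ← ElemAb.rho_of]
  exact (ElemAb.tau_rho hp b _).symm
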